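/- For a positive integer $Q$ let $\mathfrak F_Q$ be the increasing sequence of reduced fractions in $[0,1]$ with denominator $\le Q$. Let $r\ge 3$, $d\ge 2$ and $0\le c_1,\dots,c_r\le d-1$ be integers, $\mathbf c=(c_1,\dots,c_r)$. Let $N_Q^r(\mathbf c,d)$ be the number of $r$-tuples $(q_1,\dots,q_r)$ of denominators of $r$ consecutive elements of $\mathfrak F_Q$ with $q_j\equiv c_j\pmod d$ for $1\le j\le r$, and put $$\rho_Q^r(\mathbf c,d)=\frac{N_Q^r(\mathbf c,d)}{\#\mathfrak F_Q-(r-1)}.$$ Let $\mathcal T=\{(x,y)\in\mathbb R^2: x\le 1,\ y\le 1,\ x+y>1\}$. For $(x,y)\in\mathcal T$ put $L_{-1}=x$, $L_0=y$ and, for $j\ge 1$, $k_j(x,y)=\left\lfloor\frac{1+L_{j-2}}{L_{j-1}}\right\rfloor$, $L_j=k_j(x,y)L_{j-1}-L_{j-2}$. For $\mathbf k=(k_1,\dots,k_s)$ let $\mathcal T[\mathbf k]$ be the (convex polygonal) set of $(x,y)\in\mathcal T$ with $k_j(x,y)=k_j$ for $1\le j\le s$. A pair of coprime integers $(q',q'')\in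 Q\mathcal T$ generates $q_1=q'$, $q_2=q''$, $k_j=\left\lfloor\frac{q_j+Q}{q_{j+1}}\right\rfloor$, $q_{j+2}=k_jq_{j+1}-q_j$ for $j\ge 1$. Let $\mathcal K^{r-2}(\mathbf c,d)$ be the set of all vectors $(k_1,\dots,k_{r-2})$ generated, for some $Q\ge1$, by some pair of coprime integers $(q',q'')\in Q\mathcal T$ for which $q_j\equiv c_j\pmod d$ for $1\le j\le r$. For $Q\ge 1$ let $L_Q=L_Q(\mathcal K^{r-2}(\mathbf c,d))$ be the sum of the perimeters of the polygons $\mathcal T[\mathbf k]$ over those $\mathbf k\in\mathcal K^{r-2}(\mathbf c,d)$ for which the closure of $Q\mathcal T[\mathbf k]$ contains a point of $\mathbb Z^2$; there are finitely many such $\mathbf k$. Then the series $\sum_{\mathbf k\in\mathcal K^{r-2}(\mathbf c,d)}\mathrm{Area}(\mathcal T[\mathbf k])$ converges and, as $Q\to\infty$, $$\rho_Q^r(\mathbf c,d)=\frac{2}{d^2}\prod_{p\mid d}\left(1-\frac1{p^2}\right)^{-1}\sum_{\mathbf k\in\mathcal K^{r-2}(\mathbf c,d)}\mathrm{Area}(\mathcal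 T[\mathbf k])+O\left(L_Q\,Q^{-1}\log Q\right).$$ Here the product is over the primes $p$ dividing $d$. The implied constant depends at most on $d$, and the estimate holds for all $Q\ge Q_0(r,\mathbf c,d)$. -/

import Mathlib

open MeasureTheory
open scoped Pointwise

/-- The Farey fractions of order `Q`: the reduced fractions in `[0, 1]` with denominator `≤ Q`. -/
def fareySet (Q : ℕ) : Set ℚ := {x | 0 ≤ x ∧ x ≤ 1 ∧ x.den ≤ Q}

/-- `f` is an `r`-tuple of consecutive elements of the increasingly ordered Farey sequence
of order `Q`: it is increasing, and no Farey fraction between two of its terms is omitted. -/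
def IsConsecutiveFarey (Q r : ℕ) (f : Fin r → ℚ) : Prop :=
  (∀ j, f j ∈ fareySet Q) ∧ StrictMono f ∧
    ∀ x ∈ fareySet Q, ∀ i j, f i ≤ x → x ≤ f j → ∃ l, f l = x

/-- The set of `r`-tuples of denominators of consecutive Farey fractions of order `Q`. -/
def consecutiveDenominators (Q r : ℕ) : Set (Fin r → ℕ) :=
  {q | ∃ f : Fin r → ℚ, IsConsecutiveFarey Q r f ∧ ∀ j, q j = (f j).den}

/-- The `r`-tuples of consecutive Farey denominators that are congruent to `c` modulo `d`. -/
def congruentDenominators (Q r : ℕ) (c : Fin r → ℕ) (d : ℕ) : Set (Fin r → ℕ) :=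
  {q | q ∈ consecutiveDenominators Q r ∧ ∀ j, q j ≡ c j [MOD d]}

/-- The proportion of `r`-tuples of consecutive Farey denominators congruent to `c` modulo `d`. -/
noncomputable def fareyProportion (Q r : ℕ) (c : Fin r → ℕ) (d : ℕ) : ℝ :=
  ((congruentDenominators Q r c d).ncard : ℝ) / (((fareySet Q).ncard : ℝ) - ((r : ℝ) - 1))

/-- `(a, b)` is a lattice point with coprime coordinates in the `Q`-fold dilated Farey triangle. -/
def IsFareyGenerator (Q a b : ℕ) : Prop :=
  a ≤ Q ∧ b ≤ Q ∧ Q < a + b ∧ Nat.Coprime a b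

/-- The denominators generated by two neighbouring denominators `a, b`
(indexed from `0`, so that the first denominator has index `0`). -/
def genDenominator (Q a b : ℕ) : ℕ → ℤ
  | 0 => a
  | 1 => b
  | n + 2 => (genDenominator Q a b n + Q) / genDenominator Q a b (n + 1) *
      genDenominator Q a b (n + 1) - genDenominator Q a b n

/-- The integers `⌊(q_j + Q) / q_{j+1}⌋` generated by two neighbouring denominators
(indexed from `0`). -/
def genIndex (Q a b : ℕ) (j : ℕ) : ℤ :=
  (genDenominator Q a b j + Q) / genDenominator Q a b (j + 1)

/-- The admissible vectors with `s` components. -/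
def admissible (s : ℕ) : Set (Fin s → ℕ) :=
  {k | ∃ Q a b : ℕ, 1 ≤ Q ∧ IsFareyGenerator Q a b ∧ ∀ j : Fin s, genIndex Q a b j = (k j : ℤ)}

/-- The admissible vectors with `r - 2` components that correspond to `r`-tuples of consecutive
denominators congruent to `c` modulo `d`. -/
def admissibleCongruent (r : ℕ) (c : Fin r → ℕ) (d : ℕ) : Set (Fin (r - 2) → ℕ) :=
  {k | k ∈ admissible (r - 2) ∧ ∃ Q a b : ℕ, 1 ≤ Q ∧ IsFareyGenerator Q a b ∧
    (∀ j : Fin (r - 2), genIndex Q a b j = (k j : ℤ)) ∧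
    ∀ j : Fin r, genDenominator Q a b j ≡ (c j : ℤ) [ZMOD d]}

/-- The Farey triangle, with vertices `(1,0)`, `(1,1)`, `(0,1)`; the side joining `(1,0)` to
`(0,1)` is left out, since neighbouring denominators of order `Q` have sum `> Q`. -/
def fareyTriangle : Set (EuclideanSpace ℝ (Fin 2)) :=
  {p | p 0 ≤ 1 ∧ p 1 ≤ 1 ∧ 1 < p 0 + p 1}

/-- The sequence `L_{-1} = x`, `L_0 = y`, `L_j = ⌊(1 + L_{j-2}) / L_{j-1}⌋ L_{j-1} - L_{j-2}`,
with indices shifted by one so that they start at `0`. -/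
noncomputable def fareyL (x y : ℝ) : ℕ → ℝ
  | 0 => x
  | 1 => y
  | n + 2 => (⌊(1 + fareyL x y n) / fareyL x y (n + 1)⌋ : ℝ) * fareyL x y (n + 1) - fareyL x y n

/-- The polygon `T[k]`: the points of the Farey triangle with
`⌊(1 + L_{j-2}) / L_{j-1}⌋ = k_j` for `j = 1, …, s`. -/
def fareyPolygon {s : ℕ} (k : Fin s → ℕ) : Set (EuclideanSpace ℝ (Fin 2)) :=
  {p | p ∈ fareyTriangle ∧ ∀ j : Fin s,
    ⌊(1 + fareyL (p 0) (p 1) j) / fareyL (p 0) (p 1) (j + 1)⌋ = (k j : ℤ)}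

/-- The area of a plane set. -/
noncomputable def planeArea (S : Set (EuclideanSpace ℝ (Fin 2))) : ℝ := (volume S).toReal

/-- The perimeter of a plane set: the one-dimensional Hausdorff measure of its boundary. -/
noncomputable def planePerimeter (S : Set (EuclideanSpace ℝ (Fin 2))) : ℝ :=
  (Measure.hausdorffMeasure 1 (frontier S)).toReal

/-- The set contains a point with integer coordinates. -/
def HasLatticePoint (S : Set (EuclideanSpace ℝ (Fin 2))) : Prop :=
  ∃ m n : ℤ, !₂[(m : ℝ), (n : ℝ)] ∈ S

/-- The vectors `k` corresponding to `c` modulo `d` for which the closure of the dilated polygon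
`Q • T[k]` contains lattice points. -/
def relevantVectors (Q r : ℕ) (c : Fin r → ℕ) (d : ℕ) : Set (Fin (r - 2) → ℕ) :=
  {k | k ∈ admissibleCongruent r c d ∧ HasLatticePoint (closure ((Q : ℝ) • fareyPolygon k))}

/-- The sum of the perimeters of the polygons `T[k]` over the relevant vectors `k`. -/
noncomputable def perimeterSum (Q r : ℕ) (c : Fin r → ℕ) (d : ℕ) : ℝ :=
  ∑ᶠ k ∈ relevantVectors Q r c d, planePerimeter (fareyPolygon k)

/-! A tuple of consecutive denominators is determined by its first two entries `(a, b)`, which are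
coprime and lie in the `Q`-fold dilated Farey triangle; conversely all but at most `r` such pairs
occur (`ncard_congruentGenerators_le`). Once the index vector `k` is fixed, the later entries are
integral linear forms in `(a, b)`, and the floor conditions become linear inequalities: every entry
is at most `Q`, and neighbouring entries have sum greater than `Q`. So the pairs with vector `k` are
the primitive lattice points of a dilated convex polygon. Modulo `d`, the linear recursion turns
conditions on all `r` entries into conditions on `a` and `b` alone, since one admissible witness for
`k` carries the remaining congruences (`congruentGenerators_eq_iUnion`).

Primitive points in a residue class are counted by Möbius inversion. A modulus `e` coprime to `d`
contributes `μ(e)` times a count on a translated lattice of mesh `e * d / Q`, and other `e`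
contribute nothing. Counting by slices has an error bounded by side length over mesh plus a
constant. That constant must be removed, because the number of polygons grows with `Q` while only
their perimeters may appear. It is absorbed by `mesh_le_of_mem_chainRegion`: by integrality, a
polygon that contains a point of the lattice contains a segment of length comparable to the mesh.
Summation over `e ≤ Q` produces the logarithm, and summation over the relevant `k` produces the
perimeter sum.

The vectors without lattice points only matter through their area. For large `Q` such a vector has
an entry exceeding `√Q`. A large entry forces all others (`coeff_eq_spikeIndex`) and confines the
polygon to two corners of size `O(1/√Q)`, so their total area is `O(1/Q)`
(`eventually_area_tail_le`).

The number of Farey fractions is counted in the same way. The Möbius sum over `e` coprime to `d`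
equals `6/π²` times the Euler factors at the primes dividing `d`; the factor `6/π²` cancels in the
quotient. The perimeter sum is eventually bounded below by a positive constant if some vector is
admissible, so lower-order terms depending on `r` and `c` are absorbed by enlarging `Q₀`. -/

/-! ### Linear recursions and Farey chains -/

/-- The solution of `u (n + 2) = k n * u (n + 1) - u n` with `u 0 = x` and `u 1 = y`. -/
def recSeq {R : Type*} [Ring R] (k : ℕ → ℤ) (x y : R) : ℕ → R
  | 0 => x
  | 1 => y
  | n + 2 => (k n : R) * recSeq k x y (n + 1) - recSeq k x y n

/-- The first `s + 2` terms of `u` are at most `B`, and consecutive ones have sum `> B`. -/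
def IsFareyChain {R : Type*} [Add R] [LE R] [LT R] (B : R) (s : ℕ) (u : ℕ → R) : Prop :=
  (∀ i ≤ s + 1, u i ≤ B) ∧ ∀ i ≤ s, B < u i + u (i + 1)

/-- Extension of a finite vector by zeros. -/
def extendIndex {s : ℕ} (k : Fin s → ℕ) (j : ℕ) : ℤ := if h : j < s then (k ⟨j, h⟩ : ℤ) else 0

lemma extendIndex_apply {s : ℕ} (k : Fin s → ℕ) (j : Fin s) : extendIndex k j = k j := by
  simp [extendIndex]

lemma extendIndex_of_lt {s : ℕ} (k : Fin s → ℕ) {j : ℕ} (h : j < s) :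
    extendIndex k j = k ⟨j, h⟩ := by
  simp [extendIndex, h]

lemma eq_recSeq {R : Type*} [Ring R] {k : ℕ → ℤ} {u : ℕ → R} {s : ℕ}
    (h : ∀ j < s, u (j + 2) = (k j : R) * u (j + 1) - u j) :
    ∀ i ≤ s + 1, u i = recSeq k (u 0) (u 1) i := by
  intro i
  induction i using Nat.strong_induction_on with
  | _ i ih =>
    intro hi
    match i, ih, hi with
    | 0, _, _ => rfl
    | 1, _, _ => rfl
    | n + 2, ih, hi =>
      simp only [recSeq]
      rw [← ih (n + 1) (by omega) (by omega), ← ih n (by omega) (by omega), h n (by omega)]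

lemma recSeq_linear {R : Type*} [CommRing R] (k : ℕ → ℤ) (α β x y x' y' : R) (i : ℕ) :
    recSeq k (α * x + β * x') (α * y + β * y') i
      = α * recSeq k x y i + β * recSeq k x' y' i := by
  induction i using Nat.strong_induction_on with
  | _ i ih =>
    match i, ih with
    | 0, _ => rfl
    | 1, _ => rfl
    | n + 2, ih =>
      simp only [recSeq]
      rw [ih (n + 1) (by omega), ih n (by omega)]
      ring

lemma recSeq_mul {R : Type*} [CommRing R] (k : ℕ → ℤ) (α x y : R) (i : ℕ) :
    recSeq k (α * x) (α * y) i = α * recSeq k x y i := by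
  simpa using recSeq_linear k α 0 x y 0 0 i

lemma recSeq_intCast {R : Type*} [CommRing R] (k : ℕ → ℤ) (x y : ℤ) (i : ℕ) :
    ((recSeq k x y i : ℤ) : R) = recSeq k (x : R) (y : R) i := by
  induction i using Nat.strong_induction_on with
  | _ i ih =>
    match i, ih with
    | 0, _ => rfl
    | 1, _ => rfl
    | n + 2, ih =>
      simp only [recSeq]
      rw [← ih (n + 1) (by omega), ← ih n (by omega)]
      push_cast
      ring

lemma recSeq_modEq (k : ℕ → ℤ) {x y x' y' d : ℤ} (hx : x ≡ x' [ZMOD d]) (hy : y ≡ y' [ZMOD d])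
    (i : ℕ) : recSeq k x y i ≡ recSeq k x' y' i [ZMOD d] := by
  induction i using Nat.strong_induction_on with
  | _ i ih =>
    match i, ih with
    | 0, _ => exact hx
    | 1, _ => exact hy
    | n + 2, ih =>
      simp only [recSeq]
      exact ((ih (n + 1) (by omega)).mul_left _).sub (ih n (by omega))

lemma IsFareyChain.mono {R : Type*} [Add R] [LE R] [LT R] {B : R} {s s' : ℕ}
    {u : ℕ → R} (h : IsFareyChain B s u) (hs : s' ≤ s) :
    IsFareyChain B s' u :=
  ⟨fun i hi => h.1 i (by omega), fun i hi => h.2 i (by omega)⟩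

lemma IsFareyChain.congr {R : Type*} [Add R] [LE R] [LT R] {B : R} {s : ℕ}
    {u v : ℕ → R} (h : IsFareyChain B s u)
    (huv : ∀ i ≤ s + 1, u i = v i) : IsFareyChain B s v :=
  ⟨fun i hi => huv i hi ▸ h.1 i hi, fun i hi => by
    rw [← huv i (by omega), ← huv (i + 1) (by omega)]; exact h.2 i hi⟩

section Chain

variable {R : Type*} [CommRing R] [LinearOrder R] [IsStrictOrderedRing R]

lemma IsFareyChain.pos {B : R} {s : ℕ} {u : ℕ → R} (h : IsFareyChain B s u) {i : ℕ}
    (hi : i ≤ s + 1) : 0 < u i := by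
  rcases Nat.lt_or_ge i (s + 1) with h1 | h1
  · have := h.2 i (by omega)
    have := h.1 (i + 1) (by omega)
    linarith
  · obtain rfl : i = s + 1 := by omega
    have := h.2 s le_rfl
    have := h.1 s (by omega)
    linarith

lemma IsFareyChain.mul {B : R} {s : ℕ} {u : ℕ → R} {α : R} (hα : 0 < α)
    (h : IsFareyChain B s u) : IsFareyChain (α * B) s (fun i => α * u i) :=
  ⟨fun i hi => mul_le_mul_of_nonneg_left (h.1 i hi) hα.le, fun i hi => by
    rw [← mul_add]; exact mul_lt_mul_of_pos_left (h.2 i hi) hα⟩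

/-- A sequence whose recursion coefficients are floors of `(B + u n) / u (n + 1)` has prescribed
coefficients `k` if and only if the linear recursion with coefficients `k` is a Farey chain. -/
lemma isFareyChain_recSeq_iff {B : R} {u : ℕ → R} {g : ℕ → ℤ}
    (hu : ∀ n, u (n + 2) = (g n : R) * u (n + 1) - u n)
    (hg : ∀ n, 0 < u (n + 1) → ∀ z : ℤ,
      g n = z ↔ (z : R) * u (n + 1) ≤ B + u n ∧ B + u n < (z + 1 : R) * u (n + 1))
    (k : ℕ → ℤ) (s : ℕ) :
    ((u 0 ≤ B ∧ u 1 ≤ B ∧ B < u 0 + u 1) ∧ ∀ j < s, g j = k j) ↔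
      IsFareyChain B s (recSeq k (u 0) (u 1)) := by
  induction s with
  | zero =>
    constructor
    · rintro ⟨⟨h0, h1, h2⟩, -⟩
      refine ⟨fun i hi => ?_, fun i hi => ?_⟩
      · interval_cases i <;> simpa [recSeq]
      · interval_cases i; simpa [recSeq]
    · intro h
      exact ⟨⟨h.1 0 (by omega), h.1 1 (by omega), h.2 0 (by omega)⟩, by simp⟩
  | succ s ih =>
    -- For the next term `u (s + 2) = k s * u (s + 1) - u s`, the lower floor bound reads `u (s + 2)
    -- ≤ B` and the upper one reads `B < u (s + 1) + u (s + 2)`.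
    have key : (∀ j < s, g j = k j) → IsFareyChain B s (recSeq k (u 0) (u 1)) →
        (g s = k s ↔ recSeq k (u 0) (u 1) (s + 2) ≤ B ∧
          B < recSeq k (u 0) (u 1) (s + 1) + recSeq k (u 0) (u 1) (s + 2)) := by
      intro hk hc
      have he := eq_recSeq (k := k) (u := u) (s := s) fun j hj => by rw [hu, hk j hj]
      have hpos := hc.pos (i := s + 1) le_rfl
      rw [← he (s + 1) le_rfl] at hpos
      rw [hg s hpos]
      simp only [recSeq]
      rw [← he (s + 1) le_rfl, ← he s (by omega)]
      constructor <;> rintro ⟨h1, h2⟩ <;> constructor <;> linarith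
    constructor
    · rintro ⟨hb, hk⟩
      have hk' : ∀ j < s, g j = k j := fun j hj => hk j (by omega)
      have hc := ih.1 ⟨hb, hk'⟩
      obtain ⟨h1, h2⟩ := (key hk' hc).1 (hk s (by omega))
      refine ⟨fun i hi => ?_, fun i hi => ?_⟩
      · rcases Nat.lt_or_ge i (s + 2) with h | h
        · exact hc.1 i (by omega)
        · obtain rfl : i = s + 2 := by omega
          exact h1
      · rcases Nat.lt_or_ge i (s + 1) with h | h
        · exact hc.2 i (by omega)
        · obtain rfl : i = s + 1 := by omega
          exact h2
    · intro h
      have hc := h.mono (s' := s) (by omega)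
      obtain ⟨hb, hk⟩ := ih.2 hc
      refine ⟨hb, fun j hj => ?_⟩
      rcases Nat.lt_or_ge j s with h' | h'
      · exact hk j h'
      · obtain rfl : j = s := by omega
        exact (key hk hc).2 ⟨h.1 _ le_rfl, h.2 _ le_rfl⟩

end Chain

lemma isFareyChain_intCast {B : ℤ} {s : ℕ} {u : ℕ → ℤ} :
    IsFareyChain (B : ℝ) s (fun i => (u i : ℝ)) ↔ IsFareyChain B s u := by
  refine and_congr (forall₂_congr fun i _ => Int.cast_le) (forall₂_congr fun i _ => ?_)
  rw [← Int.cast_add, Int.cast_lt]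

/-- The region of the plane on which the recursion with coefficients `k` is a Farey chain. -/
def chainRegion (s : ℕ) (k : ℕ → ℤ) : Set (ℝ × ℝ) :=
  {p | IsFareyChain 1 s (recSeq k p.1 p.2)}

/-- Replaces the nested floors by finitely many linear inequalities. Convexity, measurability and
the description of the boundary all rest on this form. -/
lemma mem_fareyPolygon_iff {s : ℕ} (k : Fin s → ℕ) (p : EuclideanSpace ℝ (Fin 2)) :
    p ∈ fareyPolygon k ↔ (p 0, p 1) ∈ chainRegion s (extendIndex k) := by
  have := isFareyChain_recSeq_iff (B := (1 : ℝ)) (u := fareyL (p 0) (p 1))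
    (g := fun n => ⌊(1 + fareyL (p 0) (p 1) n) / fareyL (p 0) (p 1) (n + 1)⌋)
    (fun n => by simp [fareyL])
    (fun n hn z => by
      rw [Int.floor_eq_iff, le_div_iff₀ hn, div_lt_iff₀ hn]) (extendIndex k) s
  simp only [chainRegion, Set.mem_ofPred_eq]
  refine Iff.trans ?_ this
  simp only [fareyPolygon, fareyTriangle, Set.mem_ofPred_eq, fareyL]
  refine and_congr Iff.rfl ⟨fun h j hj => ?_, fun h j => ?_⟩
  · rw [extendIndex_of_lt k hj]; exact h ⟨j, hj⟩
  · rw [← extendIndex_apply k j]; exact h j j.2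

/-- The integer analogue of `mem_fareyPolygon_iff`, with the floor realised by integer division; the
two together identify generators with lattice points of dilated polygons. -/
lemma genDenominator_chain_iff {s : ℕ} (k : ℕ → ℤ) (Q a b : ℕ) :
    ((a ≤ Q ∧ b ≤ Q ∧ Q < a + b) ∧ ∀ j < s, genIndex Q a b j = k j) ↔
      IsFareyChain (Q : ℤ) s (recSeq k (a : ℤ) (b : ℤ)) := by
  have := isFareyChain_recSeq_iff (B := (Q : ℤ)) (u := genDenominator Q a b)
    (g := genIndex Q a b)
    (fun n => by simp [genDenominator, genIndex])
    (fun n hn z => by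
      simp only [genIndex, Int.cast_id]
      constructor
      · rintro rfl
        have h1 := Int.ediv_mul_le (genDenominator Q a b n + Q) hn.ne'
        have h2 := Int.lt_ediv_add_one_mul_self (genDenominator Q a b n + Q) hn
        exact ⟨by linarith, by linarith⟩
      · rintro ⟨h1, h2⟩
        apply le_antisymm
        · exact Int.lt_add_one_iff.1 (Int.ediv_lt_of_lt_mul hn (by linarith))
        · exact Int.le_ediv_of_mul_le hn (by linarith)) k s
  refine Iff.trans ?_ this
  simp only [genDenominator]
  norm_cast

lemma genDenominator_eq_recSeq {s : ℕ} {k : ℕ → ℤ} {Q a b : ℕ}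
    (h : ∀ j < s, genIndex Q a b j = k j) (i : ℕ) (hi : i ≤ s + 1) :
    genDenominator Q a b i = recSeq k (a : ℤ) (b : ℤ) i := by
  refine eq_recSeq (u := genDenominator Q a b) (s := s) (fun j hj => ?_) i hi
  rw [← h j hj]
  simp [genDenominator, genIndex]

lemma div_mem_chainRegion {s : ℕ} {k : ℕ → ℤ} {X : ℝ} (hX : 0 < X) (m n : ℤ) :
    ((m : ℝ) / X, (n : ℝ) / X) ∈ chainRegion s k ↔
      IsFareyChain X s fun i => ((recSeq k m n i : ℤ) : ℝ) := by
  simp only [chainRegion, Set.mem_ofPred_eq, recSeq_intCast]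
  constructor
  · intro h
    have := h.mul hX
    rw [mul_one] at this
    refine this.congr fun i _ => ?_
    rw [← recSeq_mul]
    congr 1 <;> field_simp
  · intro h
    have := IsFareyChain.mul (inv_pos.2 hX) h
    rw [inv_mul_cancel₀ hX.ne'] at this
    refine this.congr fun i _ => ?_
    rw [← recSeq_mul]
    congr 1 <;> field_simp

lemma intCast_mem_chainRegion {s : ℕ} {k : ℕ → ℤ} {Q : ℕ} (hQ : 1 ≤ Q) (m n : ℤ) :
    ((m : ℝ) / Q, (n : ℝ) / Q) ∈ chainRegion s k ↔ IsFareyChain (Q : ℤ) s (recSeq k m n) := by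
  rw [div_mem_chainRegion (by exact_mod_cast hQ), ← isFareyChain_intCast, Int.cast_natCast]

lemma genIndex_iff_mem_chainRegion {s : ℕ} (k : ℕ → ℤ) {Q : ℕ} (hQ : 1 ≤ Q) (a b : ℕ) :
    ((a ≤ Q ∧ b ≤ Q ∧ Q < a + b) ∧ ∀ j < s, genIndex Q a b j = k j) ↔
      ((a : ℝ) / Q, (b : ℝ) / Q) ∈ chainRegion s k := by
  rw [genDenominator_chain_iff, ← intCast_mem_chainRegion hQ]
  simp

lemma convex_chainRegion (s : ℕ) (k : ℕ → ℤ) : Convex ℝ (chainRegion s k) := by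
  intro p hp q hq α β hα hβ hαβ
  have e : ∀ i, recSeq k (α • p + β • q).1 (α • p + β • q).2 i
      = α * recSeq k p.1 p.2 i + β * recSeq k q.1 q.2 i := fun i => by
    rw [← recSeq_linear]; simp
  refine ⟨fun i hi => ?_, fun i hi => ?_⟩
  · rw [e]
    have := mul_le_mul_of_nonneg_left (hp.1 i hi) hα
    have := mul_le_mul_of_nonneg_left (hq.1 i hi) hβ
    linarith
  · rw [e, e]
    have h1 := hp.2 i hi
    have h2 := hq.2 i hi
    rcases hα.eq_or_lt with rfl | hα
    · have : β = 1 := by linarith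
      subst this; linarith
    · have := mul_lt_mul_of_pos_left h1 hα
      have := mul_le_mul_of_nonneg_left h2.le hβ
      linarith

lemma continuous_recSeq (k : ℕ → ℤ) (i : ℕ) : Continuous fun p : ℝ × ℝ => recSeq k p.1 p.2 i := by
  induction i using Nat.strong_induction_on with
  | _ i ih =>
    match i, ih with
    | 0, _ => exact continuous_fst
    | 1, _ => exact continuous_snd
    | n + 2, ih =>
      simp only [recSeq]
      exact (continuous_const.mul (ih (n + 1) (by omega))).sub (ih n (by omega))

lemma measurableSet_chainRegion (s : ℕ) (k : ℕ → ℤ) : MeasurableSet (chainRegion s k) := by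
  have : chainRegion s k = (⋂ i, ⋂ _ : i ≤ s + 1, {p : ℝ × ℝ | recSeq k p.1 p.2 i ≤ 1}) ∩
      ⋂ i, ⋂ _ : i ≤ s, {p : ℝ × ℝ | 1 < recSeq k p.1 p.2 i + recSeq k p.1 p.2 (i + 1)} := by
    ext p; simp [chainRegion, IsFareyChain]
  rw [this]
  refine (MeasurableSet.iInter fun i => MeasurableSet.iInter fun _ => ?_).inter
    (MeasurableSet.iInter fun i => MeasurableSet.iInter fun _ => ?_)
  · exact measurableSet_le (continuous_recSeq k i).measurable measurable_const
  · exact measurableSet_lt measurable_const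
      ((continuous_recSeq k i).add (continuous_recSeq k (i + 1))).measurable

lemma chainRegion_subset (s : ℕ) (k : ℕ → ℤ) :
    chainRegion s k ⊆ Set.Ioc (0 : ℝ) 1 ×ˢ Set.Ioc (0 : ℝ) 1 := fun p hp =>
  ⟨⟨hp.pos (i := 0) (by omega), hp.1 0 (by omega)⟩, ⟨hp.pos (i := 1) (by omega), hp.1 1 (by omega)⟩⟩

/-- The coefficients of a Farey chain are determined by its first two terms. -/
lemma eq_of_mem_chainRegion {s : ℕ} {k k' : ℕ → ℤ} {p : ℝ × ℝ} (h : p ∈ chainRegion s k)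
    (h' : p ∈ chainRegion s k') : ∀ j < s, k j = k' j := by
  have key := fun k => isFareyChain_recSeq_iff (B := (1 : ℝ)) (u := fareyL p.1 p.2)
    (g := fun n => ⌊(1 + fareyL p.1 p.2 n) / fareyL p.1 p.2 (n + 1)⌋)
    (fun n => by simp [fareyL])
    (fun n hn z => by
      rw [Int.floor_eq_iff, le_div_iff₀ hn, div_lt_iff₀ hn]) k s
  intro j hj
  rw [← ((key k).2 h).2 j hj, ((key k').2 h').2 j hj]

/-! ### Lattice points in sets with interval slices -/

lemma Set.OrdConnected.Ioo_subset_of_bounded {J : Set ℝ} (hJ : J.OrdConnected) (hne : J.Nonempty) :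
    Set.Ioo (sInf J) (sSup J) ⊆ J := by
  intro x hx
  obtain ⟨a, ha, hax⟩ := exists_lt_of_csInf_lt hne hx.1
  obtain ⟨b, hb, hxb⟩ := exists_lt_of_lt_csSup hne hx.2
  exact hJ.out ha hb ⟨hax.le, hxb.le⟩

lemma Set.OrdConnected.volume_eq {J : Set ℝ} (hJ : J.OrdConnected) (hne : J.Nonempty) {a b : ℝ}
    (hb : J ⊆ Set.Icc a b) : volume J = ENNReal.ofReal (sSup J - sInf J) := by
  apply le_antisymm
  · rw [← Real.volume_Icc]
    exact measure_mono (subset_Icc_csInf_csSup (bddBelow_Icc.mono hb) (bddAbove_Icc.mono hb))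
  · rw [← Real.volume_Ioo]
    exact measure_mono (hJ.Ioo_subset_of_bounded hne)

/-- The terms of an arithmetic progression that lie in a compact interval. -/
lemma mem_Icc_of_progression {a b t u : ℝ} (ht : 0 < t) {i : ℤ} :
    u + t * i ∈ Set.Icc a b ↔ i ∈ Finset.Icc ⌈(a - u) / t⌉ ⌊(b - u) / t⌋ := by
  rw [Finset.mem_Icc, Int.ceil_le, Int.le_floor, div_le_iff₀ ht, le_div_iff₀ ht, Set.mem_Icc]
  constructor <;> rintro ⟨h1, h2⟩ <;> constructor <;> linarith

lemma card_progression_le {a b t u : ℝ} (ht : 0 < t) (hab : a ≤ b) :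
    ((Finset.Icc ⌈(a - u) / t⌉ ⌊(b - u) / t⌋).card : ℝ) ≤ (b - a) / t + 1 := by
  rw [Int.card_Icc]
  have h1 := Int.le_ceil ((a - u) / t)
  have h2 := Int.floor_le ((b - u) / t)
  have h3 : 0 ≤ (b - a) / t := div_nonneg (by linarith) ht.le
  have h4 : (b - a) / t = (b - u) / t - (a - u) / t := by ring
  rcases le_total 0 (⌊(b - u) / t⌋ + 1 - ⌈(a - u) / t⌉) with h | h
  · have : ((⌊(b - u) / t⌋ + 1 - ⌈(a - u) / t⌉).toNat : ℝ)
        = (⌊(b - u) / t⌋ + 1 - ⌈(a - u) / t⌉ : ℝ) := by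
      exact_mod_cast congrArg (Int.cast : ℤ → ℝ) (Int.toNat_of_nonneg h)
    rw [this]; linarith
  · rw [Int.toNat_of_nonpos h]; push_cast; linarith

lemma finite_progression {J : Set ℝ} {a b t : ℝ} (u : ℝ) (ht : 0 < t) (hb : J ⊆ Set.Icc a b) :
    {i : ℤ | u + t * i ∈ J}.Finite :=
  (Finset.finite_toSet (Finset.Icc ⌈(a - u) / t⌉ ⌊(b - u) / t⌋)).subset fun _ hi =>
    (mem_Icc_of_progression ht).1 (hb hi)

/-- The count is squeezed between those for the open and the closed interval with the same
endpoints, each of which differs from length over step by at most one on its side. -/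
lemma abs_ncard_progression_sub_le {J : Set ℝ} (hJ : J.OrdConnected) {a b t : ℝ} (u : ℝ)
    (ht : 0 < t) (hb : J ⊆ Set.Icc a b) :
    |(({i : ℤ | u + t * i ∈ J}.ncard : ℕ) : ℝ) - volume.real J / t| ≤ 1 := by
  rcases J.eq_empty_or_nonempty with rfl | hne
  · simp
  set α := sInf J
  set β := sSup J
  have hαβ : α ≤ β := by
    obtain ⟨x, hx⟩ := hne
    have := subset_Icc_csInf_csSup (bddBelow_Icc.mono hb) (bddAbove_Icc.mono hb) hx
    exact this.1.trans this.2
  have hv : volume.real J = β - α := by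
    rw [Measure.real, hJ.volume_eq hne hb, ENNReal.toReal_ofReal (by linarith)]
  rw [hv, abs_le]
  constructor
  · have hsub : ((Finset.Ioo ⌊(α - u) / t⌋ ⌈(β - u) / t⌉ : Finset ℤ) : Set ℤ)
        ⊆ {i : ℤ | u + t * i ∈ J} := by
      intro i hi
      rw [Finset.mem_coe, Finset.mem_Ioo, Int.floor_lt, Int.lt_ceil, div_lt_iff₀ ht,
        lt_div_iff₀ ht] at hi
      exact hJ.Ioo_subset_of_bounded hne ⟨by linarith [hi.1], by linarith [hi.2]⟩
    have h := Set.ncard_le_ncard hsub (finite_progression u ht hb)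
    rw [Set.ncard_coe_finset, Int.card_Ioo] at h
    have h1 := Int.floor_le ((α - u) / t)
    have h2 := Int.le_ceil ((β - u) / t)
    have h4 : (β - α) / t = (β - u) / t - (α - u) / t := by ring
    have h5 : ((⌈(β - u) / t⌉ - ⌊(α - u) / t⌋ - 1 : ℤ) : ℝ)
        ≤ ((⌈(β - u) / t⌉ - ⌊(α - u) / t⌋ - 1).toNat : ℝ) := by
      exact_mod_cast Int.self_le_toNat _
    have h6 : ((⌈(β - u) / t⌉ - ⌊(α - u) / t⌋ - 1).toNat : ℝ)
        ≤ ({i : ℤ | u + t * i ∈ J}.ncard : ℝ) := by exact_mod_cast h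
    push_cast at h5
    linarith
  · have hsub : {i : ℤ | u + t * i ∈ J}
        ⊆ ((Finset.Icc ⌈(α - u) / t⌉ ⌊(β - u) / t⌋ : Finset ℤ) : Set ℤ) := fun i hi =>
      (mem_Icc_of_progression ht).1 (subset_Icc_csInf_csSup (bddBelow_Icc.mono hb) (bddAbove_Icc.mono hb) hi)
    have h := Set.ncard_le_ncard hsub (Finset.finite_toSet _)
    rw [Set.ncard_coe_finset] at h
    have h2 := card_progression_le (u := u) ht hαβ
    have h6 : ({i : ℤ | u + t * i ∈ J}.ncard : ℝ)
        ≤ ((Finset.Icc ⌈(α - u) / t⌉ ⌊(β - u) / t⌋).card : ℝ) := by exact_mod_cast h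
    linarith

lemma finite_lattice {D : Set (ℝ × ℝ)} {x₀ x₁ y₀ y₁ t : ℝ} (u v : ℝ) (ht : 0 < t)
    (hD : D ⊆ Set.Icc x₀ x₁ ×ˢ Set.Icc y₀ y₁) :
    {p : ℤ × ℤ | (u + t * p.1, v + t * p.2) ∈ D}.Finite :=
  ((finite_progression u ht (subset_refl (Set.Icc x₀ x₁))).prod
    (finite_progression v ht (subset_refl (Set.Icc y₀ y₁)))).subset fun _ hp => hD hp

/-- Lattice points in a bounded plane set all of whose horizontal and vertical slices are
intervals. -/
lemma abs_ncard_lattice_sub_le {D : Set (ℝ × ℝ)} (hm : MeasurableSet D)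
    (hx : ∀ y, {x | (x, y) ∈ D}.OrdConnected) (hy : ∀ x, {y | (x, y) ∈ D}.OrdConnected)
    {x₀ x₁ y₀ y₁ t : ℝ} (u v : ℝ) (ht : 0 < t) (hx₀ : x₀ ≤ x₁) (hy₀ : y₀ ≤ y₁)
    (hD : D ⊆ Set.Icc x₀ x₁ ×ˢ Set.Icc y₀ y₁) :
    |(({p : ℤ × ℤ | (u + t * p.1, v + t * p.2) ∈ D}.ncard : ℕ) : ℝ) - volume.real D / t ^ 2|
      ≤ (x₁ - x₀) / t + 1 + (y₁ - y₀) / t := by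
  classical
  set I := Finset.Icc ⌈(x₀ - u) / t⌉ ⌊(x₁ - u) / t⌋ with hI
  set f : ℝ × ℝ → ℝ := D.indicator 1 with hf
  have hfin : volume D < ⊤ := lt_of_le_of_lt (measure_mono hD)
    (isCompact_Icc.prod isCompact_Icc).measure_lt_top
  have hfi : Integrable f := (integrable_indicator_iff hm).2 (integrableOn_const hfin.ne)
  have hslx : ∀ x, MeasurableSet {y | (x, y) ∈ D} := fun x => measurable_prodMk_left hm
  have hsly : ∀ y, MeasurableSet {x | (x, y) ∈ D} := fun y => measurable_prodMk_right hm
  have hbx : ∀ y, {x | (x, y) ∈ D} ⊆ Set.Icc x₀ x₁ := fun y x h => (hD h).1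
  have hby : ∀ x, {y | (x, y) ∈ D} ⊆ Set.Icc y₀ y₁ := fun x y h => (hD h).2
  have hfx : ∀ x, (fun y => f (x, y)) = {y | (x, y) ∈ D}.indicator 1 := fun x => rfl
  have hfy : ∀ y, (fun x => f (x, y)) = {x | (x, y) ∈ D}.indicator 1 := fun y => rfl
  have hinty : ∀ x, ∫ y, f (x, y) = volume.real {y | (x, y) ∈ D} := fun x => by
    rw [hfx, integral_indicator_one (hslx x)]
  have hintx : ∀ y, ∫ x, f (x, y) = volume.real {x | (x, y) ∈ D} := fun y => by
    rw [hfy, integral_indicator_one (hsly y)]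
  have hinteg : ∀ x, Integrable fun y => f (x, y) := fun x => by
    rw [hfx, integrable_indicator_iff (hslx x)]
    exact integrableOn_const (lt_of_le_of_lt (measure_mono (hby x)) measure_Icc_lt_top).ne
  -- the count is a sum over vertical slices
  have hN : ((({p : ℤ × ℤ | (u + t * p.1, v + t * p.2) ∈ D}.ncard : ℕ) : ℝ))
      = ∑ i ∈ I, (({j : ℤ | v + t * j ∈ {y | (u + t * i, y) ∈ D}}.ncard : ℕ) : ℝ) := by
    have hS := finite_lattice u v ht hD
    rw [Set.ncard_eq_toFinset_card _ hS, Finset.card_eq_sum_card_fiberwise (f := Prod.fst) (t := I)]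
    · push_cast
      refine Finset.sum_congr rfl fun i _ => ?_
      rw [← Set.ncard_coe_finset, ← Set.ncard_image_of_injective
        {j : ℤ | v + t * j ∈ {y | (u + t * i, y) ∈ D}} (Prod.mk_right_injective i)]
      refine congrArg (fun S : Set (ℤ × ℤ) => (S.ncard : ℝ)) ?_
      ext ⟨a, b⟩
      simp only [Finset.coe_filter, Set.Finite.mem_toFinset, Set.mem_ofPred_eq, Set.mem_image,
        Prod.mk.injEq]
      constructor
      · rintro ⟨h, rfl⟩; exact ⟨b, h, rfl, rfl⟩
      · rintro ⟨b, h, rfl, rfl⟩; exact ⟨h, rfl⟩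
    · intro p hp
      rw [Finset.mem_coe, Set.Finite.mem_toFinset] at hp
      exact (mem_Icc_of_progression ht).1 (hD hp).1
  -- At most `(x₁ - x₀) / t + 1` columns are met, each with an error of at most one.
  have hstep1 : |∑ i ∈ I, (({j : ℤ | v + t * j ∈ {y | (u + t * i, y) ∈ D}}.ncard : ℕ) : ℝ)
      - (∑ i ∈ I, volume.real {y | (u + t * i, y) ∈ D}) / t| ≤ (x₁ - x₀) / t + 1 := by
    rw [Finset.sum_div, ← Finset.sum_sub_distrib]
    refine (Finset.abs_sum_le_sum_abs _ _).trans ?_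
    refine (Finset.sum_le_card_nsmul _ _ 1 fun i _ =>
      abs_ncard_progression_sub_le (hy _) v ht (hby _)).trans ?_
    rw [nsmul_eq_mul, mul_one]
    exact card_progression_le ht hx₀
  have hcount : ∀ y, ∑ i ∈ I, f (u + t * i, y)
      = (({i : ℤ | u + t * i ∈ {x | (x, y) ∈ D}}.ncard : ℕ) : ℝ) := fun y => by
    have : {i : ℤ | u + t * i ∈ {x | (x, y) ∈ D}}
        = ((I.filter fun i : ℤ => (u + t * i, y) ∈ D : Finset ℤ) : Set ℤ) := by
      ext i
      simp only [Set.mem_ofPred_eq, Finset.coe_filter]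
      exact ⟨fun h => ⟨(mem_Icc_of_progression ht).1 (hD h).1, h⟩, fun h => h.2⟩
    rw [this, Set.ncard_coe_finset, Finset.card_filter]
    push_cast
    refine Finset.sum_congr rfl fun i _ => ?_
    simp [hf, Set.indicator_apply]
  -- The sum of the column lengths is the integral over `y` of the number of columns met by the
  -- horizontal slice at height `y`. The one-dimensional estimate applies to that slice, and slices
  -- outside `[y₀, y₁]` are empty.
  have hstep2 : |∑ i ∈ I, volume.real {y | (u + t * i, y) ∈ D} - volume.real D / t|
      ≤ y₁ - y₀ := by
    have e1 : ∑ i ∈ I, volume.real {y | (u + t * i, y) ∈ D}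
        = ∫ y, ∑ i ∈ I, f (u + t * i, y) := by
      rw [integral_finsetSum _ fun i _ => hinteg _]
      exact Finset.sum_congr rfl fun i _ => (hinty _).symm
    have e2 : volume.real D / t = ∫ y, (∫ x, f (x, y)) / t := by
      rw [integral_div, ← integral_indicator_one hm]
      congr 1
      exact integral_prod_symm f hfi
    have hi1 : Integrable fun y => ∑ i ∈ I, f (u + t * i, y) :=
      integrable_finsetSum _ fun i _ => hinteg _
    have hi2 : Integrable fun y => (∫ x, f (x, y)) / t :=
      (Integrable.integral_prod_right hfi).div_const t
    rw [e1, e2, ← integral_sub hi1 hi2, ← Real.norm_eq_abs]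
    have hbd : ∀ y, ‖∑ i ∈ I, f (u + t * i, y) - (∫ x, f (x, y)) / t‖
        ≤ (Set.Icc y₀ y₁).indicator (1 : ℝ → ℝ) y := fun y => by
      rw [hcount, hintx, Real.norm_eq_abs]
      by_cases hyy : y ∈ Set.Icc y₀ y₁
      · rw [Set.indicator_of_mem hyy]
        exact abs_ncard_progression_sub_le (hx y) u ht (hbx y)
      · have : {x | (x, y) ∈ D} = ∅ := Set.eq_empty_of_forall_notMem fun x h => hyy (hD h).2
        rw [Set.indicator_of_notMem hyy, this]
        simp
    refine (norm_integral_le_of_norm_le ?_ (Filter.Eventually.of_forall hbd)).trans ?_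
    · exact (integrable_indicator_iff measurableSet_Icc).2 (integrableOn_const measure_Icc_lt_top.ne)
    · rw [integral_indicator_one measurableSet_Icc, Measure.real, Real.volume_Icc,
        ENNReal.toReal_ofReal (by linarith)]
  rw [hN]
  have e3 : volume.real D / t ^ 2 = volume.real D / t / t := by field_simp
  have h2 : |(∑ i ∈ I, volume.real {y | (u + t * i, y) ∈ D}) / t - volume.real D / t ^ 2|
      ≤ (y₁ - y₀) / t := by
    rw [e3, ← sub_div, abs_div, abs_of_pos ht]
    gcongr
  calc _ ≤ _ + _ := abs_sub_le _ ((∑ i ∈ I, volume.real {y | (u + t * i, y) ∈ D}) / t) _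
    _ ≤ _ := add_le_add hstep1 h2

/-! ### Primitive lattice points in a residue class -/

open ArithmeticFunction in
lemma sum_moebius_divisors (n : ℕ) :
    ∑ e ∈ n.divisors, (moebius e : ℤ) = if n = 1 then 1 else 0 := by
  have h := congrArg (fun g : ArithmeticFunction ℤ => g n) moebius_mul_coe_zeta
  simp only [coe_mul_zeta_apply, one_apply] at h
  exact h

/-- The pairs of natural numbers in a residue class modulo `d` that lie in the `Q`-fold dilation
of `D`. -/
def residuePoints (D : Set (ℝ × ℝ)) (Q d a₀ b₀ : ℕ) : Set (ℕ × ℕ) :=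
  {p | p.1 ≡ a₀ [MOD d] ∧ p.2 ≡ b₀ [MOD d] ∧ ((p.1 : ℝ) / Q, (p.2 : ℝ) / Q) ∈ D}

/-- The coprime pairs in `residuePoints`. -/
def primitivePoints (D : Set (ℝ × ℝ)) (Q d a₀ b₀ : ℕ) : Set (ℕ × ℕ) :=
  {p | p ∈ residuePoints D Q d a₀ b₀ ∧ Nat.Coprime p.1 p.2}

section Primitive

variable {D : Set (ℝ × ℝ)} (hD : D ⊆ Set.Ioc (0 : ℝ) 1 ×ˢ Set.Ioc (0 : ℝ) 1) {Q : ℕ} (hQ : 1 ≤ Q)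

include hD hQ

lemma residuePoints_subset (d a₀ b₀ : ℕ) :
    residuePoints D Q d a₀ b₀ ⊆ ((Finset.Icc 1 Q ×ˢ Finset.Icc 1 Q : Finset (ℕ × ℕ)) : Set _) := by
  rintro ⟨a, b⟩ ⟨-, -, h⟩
  have hQ' : (0 : ℝ) < Q := by exact_mod_cast hQ
  obtain ⟨⟨h1, h2⟩, h3, h4⟩ := hD h
  simp only [Finset.coe_product, Finset.coe_Icc, Set.mem_prod, Set.mem_Icc]
  rw [div_le_one hQ'] at h2 h4
  have h1' : (0 : ℝ) < a := by
    by_contra hh; push Not at hh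
    exact absurd h1 (not_lt.2 (div_nonpos_of_nonpos_of_nonneg hh hQ'.le))
  have h3' : (0 : ℝ) < b := by
    by_contra hh; push Not at hh
    exact absurd h3 (not_lt.2 (div_nonpos_of_nonpos_of_nonneg hh hQ'.le))
  exact ⟨⟨by exact_mod_cast h1', by exact_mod_cast h2⟩, by exact_mod_cast h3', by exact_mod_cast h4⟩

lemma finite_residuePoints (d a₀ b₀ : ℕ) : (residuePoints D Q d a₀ b₀).Finite :=
  (Finset.finite_toSet _).subset (residuePoints_subset hD hQ d a₀ b₀)

/-- Möbius inversion over the common divisors. The range `e ≤ Q` is enough because both coordinates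
lie between `1` and `Q`. -/
lemma ncard_primitivePoints_eq (d a₀ b₀ : ℕ) :
    ((primitivePoints D Q d a₀ b₀).ncard : ℤ) = ∑ e ∈ Finset.Icc 1 Q,
      ArithmeticFunction.moebius e *
        ({p | p ∈ residuePoints D Q d a₀ b₀ ∧ e ∣ p.1 ∧ e ∣ p.2}.ncard : ℤ) := by
  classical
  have hfin := finite_residuePoints hD hQ d a₀ b₀
  set S := hfin.toFinset with hS
  have h1 : primitivePoints D Q d a₀ b₀ = ((S.filter fun p => Nat.gcd p.1 p.2 = 1 :
      Finset (ℕ × ℕ)) : Set (ℕ × ℕ)) := by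
    ext p; simp [primitivePoints, hS, Nat.Coprime]
  have h2 : ∀ e, {p | p ∈ residuePoints D Q d a₀ b₀ ∧ e ∣ p.1 ∧ e ∣ p.2}
      = ((S.filter fun p => e ∣ p.1 ∧ e ∣ p.2 : Finset (ℕ × ℕ)) : Set (ℕ × ℕ)) := by
    intro e; ext p; simp [hS]
  simp_rw [h1, h2, Set.ncard_coe_finset, Finset.card_filter]
  push_cast
  simp_rw [Finset.mul_sum]
  rw [Finset.sum_comm]
  refine Finset.sum_congr rfl fun p hp => ?_
  have hp' := residuePoints_subset hD hQ d a₀ b₀ (hfin.mem_toFinset.1 hp)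
  simp only [Finset.coe_product, Finset.coe_Icc, Set.mem_prod, Set.mem_Icc] at hp'
  rw [← sum_moebius_divisors]
  simp_rw [mul_ite, mul_one, mul_zero]
  rw [← Finset.sum_filter]
  refine Finset.sum_congr ?_ fun _ _ => rfl
  ext e
  simp only [Nat.mem_divisors, Finset.mem_filter, Finset.mem_Icc, Nat.dvd_gcd_iff]
  constructor
  · rintro ⟨⟨h1, h2⟩, -⟩
    have := Nat.le_of_dvd (by omega) h1
    exact ⟨⟨Nat.pos_of_dvd_of_pos h1 (by omega), by omega⟩, h1, h2⟩
  · rintro ⟨-, h⟩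
    exact ⟨h, (Nat.gcd_pos_of_pos_left _ (by omega)).ne'⟩

omit hD hQ in
-- A common prime of `e` and `d` would divide both coordinates, hence `a₀`, `b₀` and `d`.
lemma residuePoints_dvd_eq_empty {d a₀ b₀ e : ℕ} (hc : Nat.gcd (Nat.gcd a₀ b₀) d = 1)
    (he : ¬ Nat.Coprime e d) :
    {p | p ∈ residuePoints D Q d a₀ b₀ ∧ e ∣ p.1 ∧ e ∣ p.2} = ∅ := by
  refine Set.eq_empty_of_forall_notMem ?_
  rintro ⟨a, b⟩ ⟨⟨h1, h2, -⟩, h3, h4⟩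
  obtain ⟨p, hp, hpe, hpd⟩ := Nat.Prime.not_coprime_iff_dvd.1 he
  have ha : p ∣ a₀ := ((h1.of_dvd hpd).dvd_iff dvd_rfl).1 (hpe.trans h3)
  have hb : p ∣ b₀ := ((h2.of_dvd hpd).dvd_iff dvd_rfl).1 (hpe.trans h4)
  have := Nat.dvd_gcd (Nat.dvd_gcd ha hb) hpd
  rw [hc] at this
  exact hp.one_lt.ne' (Nat.dvd_one.1 this)

/-- By the Chinese remainder theorem the two conditions on a coordinate form one class modulo `e *
d`. The divisibility of `A` and `B` by `e` is recorded because it places the translated lattice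
inside the lattice of mesh `e / Q`, to which `mesh_le_of_mem_chainRegion` applies. -/
lemma exists_ncard_residuePoints_dvd_eq {d a₀ b₀ e : ℕ} (hd : 1 ≤ d) (he1 : 1 ≤ e)
    (he : Nat.Coprime e d) :
    ∃ A B : ℤ, (e : ℤ) ∣ A ∧ (e : ℤ) ∣ B ∧
      {p | p ∈ residuePoints D Q d a₀ b₀ ∧ e ∣ p.1 ∧ e ∣ p.2}.ncard =
      {p : ℤ × ℤ | ((A : ℝ) / Q + (e * d / Q : ℝ) * p.1, (B : ℝ) / Q + (e * d / Q : ℝ) * p.2) ∈ D}.ncard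
    := by
  obtain ⟨A, hA1, hA2⟩ := Nat.chineseRemainder he 0 a₀
  obtain ⟨B, hB1, hB2⟩ := Nat.chineseRemainder he 0 b₀
  refine ⟨A, B, ?_, ?_, ?_⟩
  · exact_mod_cast (Nat.modEq_zero_iff_dvd.1 hA1)
  · exact_mod_cast (Nat.modEq_zero_iff_dvd.1 hB1)
  have hQ' : (0 : ℝ) < Q := by exact_mod_cast hQ
  have hed : 0 < e * d := Nat.mul_pos he1 hd
  -- the residue class of a coordinate modulo `e * d`
  have hcls : ∀ {A a₀ a : ℕ}, A ≡ 0 [MOD e] → A ≡ a₀ [MOD d] →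
      ((a ≡ a₀ [MOD d] ∧ e ∣ a) ↔ ∃ i : ℤ, (a : ℤ) = A + (e * d : ℕ) * i) := by
    intro A a₀ a h1 h2
    constructor
    · rintro ⟨h3, h4⟩
      have h5 : A ≡ a [MOD e * d] := (Nat.modEq_and_modEq_iff_modEq_mul he).1
        ⟨h1.trans (Nat.modEq_zero_iff_dvd.2 h4).symm, h2.trans h3.symm⟩
      obtain ⟨i, hi⟩ := Nat.modEq_iff_dvd.1 h5
      exact ⟨i, by linarith⟩
    · rintro ⟨i, hi⟩
      have h5 : A ≡ a [MOD e * d] := Nat.modEq_iff_dvd.2 ⟨i, by rw [hi]; ring⟩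
      obtain ⟨h6, h7⟩ := (Nat.modEq_and_modEq_iff_modEq_mul he).2 h5
      exact ⟨h7.symm.trans h2, Nat.modEq_zero_iff_dvd.1 (h6.symm.trans h1)⟩
  have hcoord : ∀ (A i : ℤ), (A : ℝ) / Q + (e * d / Q : ℝ) * i
      = ((A + (e * d : ℕ) * i : ℤ) : ℝ) / Q := by
    intro A i; push_cast; ring
  have hinj : Function.Injective fun p : ℤ × ℤ => ((A + (e * d : ℕ) * p.1 : ℤ),
      (B + (e * d : ℕ) * p.2 : ℤ)) := by
    rintro ⟨i, j⟩ ⟨i', j'⟩ h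
    simp only [Prod.mk.injEq, add_right_inj, mul_eq_mul_left_iff, Nat.cast_eq_zero, hed.ne',
      or_false] at h
    exact Prod.ext h.1 h.2
  have hinj2 : Function.Injective fun p : ℕ × ℕ => ((p.1 : ℤ), (p.2 : ℤ)) := by
    rintro ⟨i, j⟩ ⟨i', j'⟩ h
    simpa using h
  rw [← Set.ncard_image_of_injective _ hinj, ← Set.ncard_image_of_injective _ hinj2]
  congr 1
  ext ⟨x, y⟩
  simp only [Set.mem_image, Set.mem_ofPred_eq, Prod.mk.injEq, Prod.exists, Int.cast_natCast]
  constructor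
  · rintro ⟨a, b, ⟨⟨h1, h2, h3⟩, h4, h5⟩, rfl, rfl⟩
    obtain ⟨i, hi⟩ := (hcls hA1 hA2).1 ⟨h1, h4⟩
    obtain ⟨j, hj⟩ := (hcls hB1 hB2).1 ⟨h2, h5⟩
    refine ⟨i, j, ?_, hi.symm, hj.symm⟩
    have e1 := hcoord A i
    have e2 := hcoord B j
    rw [← hi] at e1; rw [← hj] at e2
    rw [Int.cast_natCast] at e1 e2
    rw [e1, e2]
    simp only [Int.cast_natCast]
    exact h3
  · rintro ⟨i, j, h, rfl, rfl⟩
    have e1 := hcoord A i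
    have e2 := hcoord B j
    rw [Int.cast_natCast] at e1 e2
    rw [e1, e2] at h
    obtain ⟨⟨hx, -⟩, hy, -⟩ := hD h
    have hx' : (0 : ℝ) < ((A + (e * d : ℕ) * i : ℤ) : ℝ) := by
      by_contra hh; push Not at hh
      exact absurd hx (not_lt.2 (div_nonpos_of_nonpos_of_nonneg hh hQ'.le))
    have hy' : (0 : ℝ) < ((B + (e * d : ℕ) * j : ℤ) : ℝ) := by
      by_contra hh; push Not at hh
      exact absurd hy (not_lt.2 (div_nonpos_of_nonpos_of_nonneg hh hQ'.le))
    obtain ⟨a, ha⟩ := Int.eq_ofNat_of_zero_le (Int.cast_pos.1 hx').le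
    obtain ⟨b, hb⟩ := Int.eq_ofNat_of_zero_le (Int.cast_pos.1 hy').le
    rw [ha, hb] at h
    simp only [Int.cast_natCast] at h
    have h1 := (hcls (a := a) hA1 hA2).2 ⟨i, ha.symm⟩
    have h2 := (hcls (a := b) hB1 hB2).2 ⟨j, hb.symm⟩
    exact ⟨a, b, ⟨⟨h1.1, h2.1, h⟩, h1.2, h2.2⟩, ha.symm, hb.symm⟩

omit hD hQ in
lemma sum_Icc_inv_le (Q : ℕ) : ∑ e ∈ Finset.Icc 1 Q, (1 : ℝ) / e ≤ 1 + Real.log Q := by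
  have := harmonic_le_one_add_log Q
  rw [harmonic_eq_sum_Icc] at this
  push_cast at this
  simpa [one_div] using this

/-- Reduces the primitive count to a bound `W * (Q / e)` for each modulus; the harmonic sum of these
bounds is the source of the logarithm. -/
lemma abs_ncard_primitivePoints_sub_le {d a₀ b₀ : ℕ} (hd : 1 ≤ d)
    (hc : Nat.gcd (Nat.gcd a₀ b₀) d = 1) {W : ℝ}
    (hW : ∀ e : ℕ, 1 ≤ e → e ≤ Q → ∀ A B : ℤ, (e : ℤ) ∣ A → (e : ℤ) ∣ B →
      |(({p : ℤ × ℤ | ((A : ℝ) / Q + (e * d / Q : ℝ) * p.1,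
        (B : ℝ) / Q + (e * d / Q : ℝ) * p.2) ∈ D}.ncard : ℕ) : ℝ)
          - volume.real D / (e * d / Q : ℝ) ^ 2| ≤ W * (Q / e)) :
    |((primitivePoints D Q d a₀ b₀).ncard : ℝ) - volume.real D * ((Q : ℝ) ^ 2 / (d : ℝ) ^ 2) *
        ∑ e ∈ (Finset.Icc 1 Q).filter (Nat.Coprime · d),
          (ArithmeticFunction.moebius e : ℝ) / (e : ℝ) ^ 2|
      ≤ W * (Q * (1 + Real.log Q)) := by
  have hQ' : (0 : ℝ) < Q := by exact_mod_cast hQ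
  have hd' : (0 : ℝ) < d := by exact_mod_cast hd
  have hW0 : 0 ≤ W := by
    have := (abs_nonneg _).trans (hW 1 le_rfl hQ 0 0 (by simp) (by simp))
    have h2 : (0 : ℝ) < Q / (1 : ℕ) := by simpa using hQ'
    exact nonneg_of_mul_nonneg_left this h2
  have h := ncard_primitivePoints_eq hD hQ d a₀ b₀
  have h' : ((primitivePoints D Q d a₀ b₀).ncard : ℝ) =
      ∑ e ∈ (Finset.Icc 1 Q).filter (Nat.Coprime · d), (ArithmeticFunction.moebius e : ℝ) *
        ({p | p ∈ residuePoints D Q d a₀ b₀ ∧ e ∣ p.1 ∧ e ∣ p.2}.ncard : ℝ) := by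
    have := congrArg (Int.cast : ℤ → ℝ) h
    push_cast at this
    rw [this, Finset.sum_filter]
    refine Finset.sum_congr rfl fun e _ => ?_
    split_ifs with hcop
    · rfl
    · rw [residuePoints_dvd_eq_empty hc hcop]; simp
  rw [h', Finset.mul_sum, ← Finset.sum_sub_distrib]
  refine (Finset.abs_sum_le_sum_abs _ _).trans ?_
  have hterm : ∀ e ∈ (Finset.Icc 1 Q).filter (Nat.Coprime · d),
      |(ArithmeticFunction.moebius e : ℝ) *
        ({p | p ∈ residuePoints D Q d a₀ b₀ ∧ e ∣ p.1 ∧ e ∣ p.2}.ncard : ℝ) -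
        volume.real D * ((Q : ℝ) ^ 2 / (d : ℝ) ^ 2) *
          ((ArithmeticFunction.moebius e : ℝ) / (e : ℝ) ^ 2)| ≤ W * Q * (1 / e) := by
    intro e he
    rw [Finset.mem_filter, Finset.mem_Icc] at he
    obtain ⟨⟨he1, he2⟩, he3⟩ := he
    obtain ⟨A, B, hA, hB, hAB⟩ := exists_ncard_residuePoints_dvd_eq hD hQ (a₀ := a₀) (b₀ := b₀)
      hd he1 he3
    have he' : (0 : ℝ) < e := by exact_mod_cast he1
    have key := hW e he1 he2 A B hA hB
    rw [← hAB] at key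
    have e1 : (ArithmeticFunction.moebius e : ℝ) *
        ({p | p ∈ residuePoints D Q d a₀ b₀ ∧ e ∣ p.1 ∧ e ∣ p.2}.ncard : ℝ) -
        volume.real D * ((Q : ℝ) ^ 2 / (d : ℝ) ^ 2) *
          ((ArithmeticFunction.moebius e : ℝ) / (e : ℝ) ^ 2) =
        (ArithmeticFunction.moebius e : ℝ) *
        (({p | p ∈ residuePoints D Q d a₀ b₀ ∧ e ∣ p.1 ∧ e ∣ p.2}.ncard : ℝ) -
          volume.real D / (e * d / Q : ℝ) ^ 2) := by
      field_simp
    have hμ : |(ArithmeticFunction.moebius e : ℝ)| ≤ 1 := by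
      exact_mod_cast ArithmeticFunction.abs_moebius_le_one (n := e)
    rw [e1, abs_mul]
    calc _ ≤ 1 * (W * (Q / e)) := mul_le_mul hμ key (abs_nonneg _) zero_le_one
      _ = _ := by ring
  refine (Finset.sum_le_sum hterm).trans ?_
  rw [← Finset.mul_sum, mul_assoc]
  gcongr
  refine le_trans ?_ (sum_Icc_inv_le Q)
  exact Finset.sum_le_sum_of_subset_of_nonneg (Finset.filter_subset _ _) fun _ _ _ => by positivity

end Primitive

/-- A form of the lattice point estimate without the constant term, for sets that are long
compared with the mesh as soon as they contain a point of the lattice. -/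
lemma abs_ncard_lattice_sub_le_of_mesh {D : Set (ℝ × ℝ)} (hm : MeasurableSet D)
    (hx : ∀ y, {x | (x, y) ∈ D}.OrdConnected) (hy : ∀ x, {y | (x, y) ∈ D}.OrdConnected)
    {x₀ x₁ y₀ y₁ t κ : ℝ} (u v : ℝ) (ht : 0 < t) (hx₀ : x₀ ≤ x₁) (hy₀ : y₀ ≤ y₁) (hκ : 0 ≤ κ)
    (hD : D ⊆ Set.Icc x₀ x₁ ×ˢ Set.Icc y₀ y₁)
    (hmesh : (∃ p : ℤ × ℤ, (u + t * p.1, v + t * p.2) ∈ D) →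
      t ≤ κ * ((x₁ - x₀) + (y₁ - y₀))) :
    |(({p : ℤ × ℤ | (u + t * p.1, v + t * p.2) ∈ D}.ncard : ℕ) : ℝ) - volume.real D / t ^ 2|
      ≤ (2 + κ) * ((x₁ - x₀) + (y₁ - y₀)) / t := by
  have hwx : 0 ≤ (x₁ - x₀) / t := div_nonneg (by linarith) ht.le
  have hwy : 0 ≤ (y₁ - y₀) / t := div_nonneg (by linarith) ht.le
  have e : (2 + κ) * ((x₁ - x₀) + (y₁ - y₀)) / t
      = (2 + κ) * ((x₁ - x₀) / t + (y₁ - y₀) / t) := by ring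
  have hκ' := mul_nonneg hκ (add_nonneg hwx hwy)
  have main := abs_ncard_lattice_sub_le hm hx hy u v ht hx₀ hy₀ hD
  rw [e]
  -- Three ways to dispose of the constant term: the width exceeds the mesh, or a lattice point
  -- makes `hmesh` available, or the count vanishes and the area alone is small.
  by_cases h1 : t ≤ x₁ - x₀
  · have : 1 ≤ (x₁ - x₀) / t := (one_le_div ht).2 h1
    linarith
  by_cases h2 : ∃ p : ℤ × ℤ, (u + t * p.1, v + t * p.2) ∈ D
  · have h3 : 1 ≤ κ * ((x₁ - x₀) + (y₁ - y₀)) / t := (one_le_div ht).2 (hmesh h2)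
    have h4 : κ * ((x₁ - x₀) + (y₁ - y₀)) / t = κ * ((x₁ - x₀) / t + (y₁ - y₀) / t) := by ring
    linarith
  · have h0 : {p : ℤ × ℤ | (u + t * p.1, v + t * p.2) ∈ D} = ∅ :=
      Set.eq_empty_of_forall_notMem fun p hp => h2 ⟨p, hp⟩
    have hv : volume.real D ≤ (x₁ - x₀) * (y₁ - y₀) := by
      have : volume.real D ≤ volume.real (Set.Icc x₀ x₁ ×ˢ Set.Icc y₀ y₁) :=
        measureReal_mono hD (isCompact_Icc.prod isCompact_Icc).measure_lt_top.ne
      refine this.trans ?_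
      rw [Measure.volume_eq_prod, measureReal_prod_prod, Real.volume_real_Icc_of_le hx₀,
        Real.volume_real_Icc_of_le hy₀]
    rw [h0, Set.ncard_empty, Nat.cast_zero, zero_sub, abs_neg,
      abs_of_nonneg (by positivity)]
    -- Here the width is less than `t`, so one factor of the box area is bounded by `t`.
    have : volume.real D / t ^ 2 ≤ 1 * ((y₁ - y₀) / t) := by
      calc _ ≤ (x₁ - x₀) * (y₁ - y₀) / t ^ 2 := by gcongr
        _ = (x₁ - x₀) / t * ((y₁ - y₀) / t) := by field_simp
        _ ≤ _ := mul_le_mul_of_nonneg_right ((div_le_one ht).2 (by linarith)) hwy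
    linarith

/-! ### The Möbius sums over integers coprime to `d` -/

/-- The terms of the sum of `μ n / n ^ 2` over the integers coprime to `d`. -/
noncomputable def moebiusTerm (d n : ℕ) : ℝ :=
  if Nat.Coprime n d then (ArithmeticFunction.moebius n : ℝ) / (n : ℝ) ^ 2 else 0

lemma abs_moebiusTerm_le (d n : ℕ) : |moebiusTerm d n| ≤ 1 / (n : ℝ) ^ 2 := by
  unfold moebiusTerm
  split_ifs
  · rw [abs_div, abs_of_nonneg (by positivity : (0 : ℝ) ≤ (n : ℝ) ^ 2)]
    gcongr
    exact_mod_cast ArithmeticFunction.abs_moebius_le_one (n := n)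
  · simp

lemma summable_moebiusTerm (d : ℕ) : Summable (moebiusTerm d) :=
  Summable.of_norm_bounded (Real.summable_one_div_nat_pow.2 one_lt_two) fun n => by
    rw [Real.norm_eq_abs]; exact abs_moebiusTerm_le d n

lemma sum_filter_moebius_eq (Q d : ℕ) :
    ∑ e ∈ (Finset.Icc 1 Q).filter (Nat.Coprime · d),
      (ArithmeticFunction.moebius e : ℝ) / (e : ℝ) ^ 2 = ∑ e ∈ Finset.range (Q + 1),
        moebiusTerm d e := by
  rw [Finset.sum_filter, Finset.range_eq_Ico, Finset.sum_eq_sum_Ico_succ_bot (by omega)]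
  have : moebiusTerm d 0 = 0 := by simp [moebiusTerm]
  rw [this, zero_add]
  rfl

/-- The tail is dominated by the sum of `1 / n ^ 2` over `n > Q`, which telescopes to at most `1 /
Q`. -/
lemma abs_sum_moebius_sub_tsum_le {Q : ℕ} (hQ : 1 ≤ Q) (d : ℕ) :
    |∑ e ∈ (Finset.Icc 1 Q).filter (Nat.Coprime · d),
      (ArithmeticFunction.moebius e : ℝ) / (e : ℝ) ^ 2 - ∑' n, moebiusTerm d n| ≤ 1 / Q := by
  rw [sum_filter_moebius_eq]
  have hlim := (summable_moebiusTerm d).hasSum.tendsto_sum_nat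
  have hlim' := ((tendsto_const_nhds (x := ∑ e ∈ Finset.range (Q + 1), moebiusTerm d e)).sub
    hlim).abs
  refine le_of_tendsto hlim' ?_
  filter_upwards [Filter.eventually_ge_atTop (Q + 1)] with N hN
  rw [← abs_neg, neg_sub, ← Finset.sum_Ico_eq_sub _ hN]
  refine (Finset.abs_sum_le_sum_abs _ _).trans ?_
  refine (Finset.sum_le_sum fun n _ => abs_moebiusTerm_le d n).trans ?_
  obtain ⟨M, rfl⟩ : ∃ M, N = M + 1 := ⟨N - 1, by omega⟩
  have e : Finset.Ico (Q + 1) (M + 1) = Finset.Ioc Q M := by ext; simp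
  rw [e]
  have h1 := sum_Ioc_inv_sq_le_sub (α := ℝ) (by omega : Q ≠ 0) (by omega : Q ≤ M)
  have h2 : (0 : ℝ) ≤ (M : ℝ)⁻¹ := by positivity
  simp only [one_div]
  linarith

/-- At `2`, the Dirichlet series of `μ` twisted by the trivial character modulo `d` is inverse to
that character's L-function, which is `ζ(2)` with the Euler factors at `p ∣ d` removed. -/
lemma moebiusSum_mul {d : ℕ} (hd : 1 ≤ d) :
    (∑' n, moebiusTerm d n) * ((∏ p ∈ d.primeFactors, (1 - 1 / (p : ℝ) ^ 2)) *
      (Real.pi ^ 2 / 6)) = 1 := by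
  have : NeZero d := ⟨by omega⟩
  have h2 : (1 : ℝ) < (2 : ℂ).re := by norm_num
  have hmul := DirichletCharacter.LSeries.mul_mu_eq_one (1 : DirichletCharacter ℂ d) h2
  rw [← DirichletCharacter.LFunction_eq_LSeries _ h2,
    show DirichletCharacter.LFunction (1 : DirichletCharacter ℂ d) 2 = _ from
      DirichletCharacter.LFunctionTrivChar_eq_mul_riemannZeta (by norm_num),
    riemannZeta_two] at hmul
  have hL : LSeries ((fun n : ℕ => (1 : DirichletCharacter ℂ d) (n : ZMod d)) *
      fun n : ℕ => ((ArithmeticFunction.moebius n : ℤ) : ℂ)) 2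
      = ((∑' n, moebiusTerm d n : ℝ) : ℂ) := by
    rw [LSeries, Complex.ofReal_tsum]
    refine tsum_congr fun n => ?_
    rcases eq_or_ne n 0 with rfl | hn
    · simp [moebiusTerm]
    rw [LSeries.term_of_ne_zero hn, moebiusTerm]
    split_ifs with hc
    · rw [Pi.mul_apply, MulChar.one_apply ((ZMod.isUnit_iff_coprime n d).2 hc)]
      simp
    · rw [Pi.mul_apply, MulChar.map_nonunit _ (fun h => hc ((ZMod.isUnit_iff_coprime n d).1 h))]
      simp
  rw [hL] at hmul
  have hP : (∏ p ∈ d.primeFactors, (1 - (p : ℂ) ^ (-(2 : ℂ))))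
      = ((∏ p ∈ d.primeFactors, (1 - 1 / (p : ℝ) ^ 2) : ℝ) : ℂ) := by
    push_cast
    refine Finset.prod_congr rfl fun p _ => ?_
    rw [Complex.cpow_neg, Complex.cpow_ofNat, one_div]
  rw [hP] at hmul
  rw [mul_comm]
  exact_mod_cast hmul

/-! ### Neighbours in the Farey sequence -/

lemma finite_fareySet (Q : ℕ) : (fareySet Q).Finite := by
  refine Set.Finite.of_finite_image (f := fun x : ℚ => (x.num, x.den)) ?_ ?_
  · refine ((Set.finite_Icc (0 : ℤ) Q).prod (Set.finite_Icc (0 : ℕ) Q)).subset ?_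
    rintro _ ⟨x, ⟨h0, h1, h2⟩, rfl⟩
    have h3 : x.num ≤ x.den := Rat.num_le_denom_iff.2 h1
    exact ⟨⟨Rat.num_nonneg.2 h0, by simp only; omega⟩, ⟨Nat.zero_le _, h2⟩⟩
  · intro x _ y _ h
    simp only [Prod.mk.injEq] at h
    exact Rat.ext h.1 h.2

/-- The determinant of two fractions. -/
def ratDet (x y : ℚ) : ℤ := y.num * x.den - x.num * y.den

lemma lt_iff_ratDet_pos {x y : ℚ} : x < y ↔ 0 < ratDet x y := by
  rw [ratDet, Rat.lt_iff]
  constructor <;> intro h <;> linarith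

/-- By unimodularity, `z.den` is the combination of `x.den` and `y.den` with coefficients `ratDet z
y` and `ratDet x z`, which are positive integers. -/
lemma den_add_den_le {x y z : ℚ} (h : ratDet x y = 1) (hxz : x < z) (hzy : z < y) :
    x.den + y.den ≤ z.den := by
  rw [lt_iff_ratDet_pos] at hxz hzy
  have hx : (0 : ℤ) < x.den := by exact_mod_cast x.den_pos
  have hy : (0 : ℤ) < y.den := by exact_mod_cast y.den_pos
  have e : (z.den : ℤ) = x.den * ratDet z y + y.den * ratDet x z := by
    have : (z.den : ℤ) = z.den * ratDet x y := by rw [h, mul_one]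
    rw [this]; simp only [ratDet]; ring
  have h1 : (x.den : ℤ) * 1 ≤ x.den * ratDet z y := mul_le_mul_of_nonneg_left (by omega) hx.le
  have h2 : (y.den : ℤ) * 1 ≤ y.den * ratDet x z := mul_le_mul_of_nonneg_left (by omega) hy.le
  omega

lemma num_den_of_isCoprime {u v : ℤ} (hv : 0 < v) (h : IsCoprime u v) :
    ((u : ℚ) / v).num = u ∧ (((u : ℚ) / v).den : ℤ) = v := by
  have h' : Nat.Coprime u.natAbs v.natAbs := Int.isCoprime_iff_gcd_eq_one.1 h
  exact ⟨Rat.num_div_eq_of_coprime hv h', Rat.den_div_eq_of_coprime hv h'⟩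

/-- The denominators of the solutions of the determinant equation form a class modulo `x.den`, so
exactly one lies in the window `(Q - x.den, Q]`. -/
lemma exists_farey_succ {Q : ℕ} {x : ℚ} (hx : x ∈ fareySet Q) (hx1 : x < 1) :
    ∃ y ∈ fareySet Q, ratDet x y = 1 ∧ Q < x.den + y.den := by
  obtain ⟨h0, -, hQ⟩ := hx
  have hq : (0 : ℤ) < x.den := by exact_mod_cast x.den_pos
  have ha : 0 ≤ x.num := Rat.num_nonneg.2 h0
  have haq : x.num < x.den := Rat.num_lt_denom_iff.2 hx1
  have hcop : IsCoprime x.num (x.den : ℤ) := Int.isCoprime_iff_gcd_eq_one.2 x.reduced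
  obtain ⟨α, β, hαβ⟩ := hcop
  -- solutions of `u * den - num * v = 1` are `(β + m * num, -α + m * den)`
  set m := ((Q : ℤ) + α) / x.den with hm
  set v := -α + m * x.den with hv
  set u := β + m * x.num with hu
  have hdet : u * x.den - x.num * v = 1 := by rw [hu, hv]; linarith
  have hv1 : v ≤ Q := by
    have := Int.ediv_mul_le ((Q : ℤ) + α) hq.ne'
    rw [← hm] at this; linarith
  have hv2 : (Q : ℤ) < v + x.den := by
    have := Int.lt_ediv_add_one_mul_self ((Q : ℤ) + α) hq
    rw [← hm] at this; linarith
  have hv0 : 0 < v := by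
    have : (x.den : ℤ) ≤ Q := by exact_mod_cast hQ
    omega
  have hcop' : IsCoprime u v := ⟨x.den, -x.num, by linarith⟩
  obtain ⟨hn, hden⟩ := num_den_of_isCoprime hv0 hcop'
  set y : ℚ := (u : ℚ) / v
  have hdet' : ratDet x y = 1 := by rw [ratDet, hn, hden, hdet]
  have huv : u ≤ v := by
    have h1 : u * x.den ≤ v * x.den := by
      have : x.num * v ≤ (x.den - 1) * v := mul_le_mul_of_nonneg_right (by omega) hv0.le
      nlinarith
    exact le_of_mul_le_mul_right h1 hq
  have hxy : x < y := lt_iff_ratDet_pos.2 (by rw [hdet']; norm_num)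
  refine ⟨y, ⟨h0.trans hxy.le, Rat.num_le_denom_iff.1 (by rw [hn, hden]; exact huv),
    by omega⟩, hdet', by omega⟩

/-- The candidate from `exists_farey_succ` cannot precede `y`, as there is no gap to fill; nor can
it follow `y`, since `y` would then have denominator greater than `Q`. -/
lemma ratDet_of_neighbours {Q : ℕ} {x y : ℚ} (hx : x ∈ fareySet Q) (hy : y ∈ fareySet Q)
    (hxy : x < y) (hgap : ∀ z ∈ fareySet Q, x < z → ¬ z < y) :
    ratDet x y = 1 ∧ Q < x.den + y.den := by
  obtain ⟨y', hy', hdet, hQ⟩ := exists_farey_succ hx (hxy.trans_le hy.2.1)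
  have hxy' : x < y' := lt_iff_ratDet_pos.2 (by rw [hdet]; norm_num)
  have : y' = y := by
    rcases lt_trichotomy y' y with h | h | h
    · exact absurd h (hgap y' hy' hxy')
    · exact h
    · have := den_add_den_le hdet hxy h
      have := hy.2.2
      omega
  rw [← this]
  exact ⟨hdet, hQ⟩

/-- Subtracting the two determinant equations shows that `y.den` divides `x.den + z.den`; the window
`Q - y.den < z.den ≤ Q` then identifies the quotient with the floor. -/
lemma den_succ_succ {Q : ℕ} {x y z : ℚ} (hxy : ratDet x y = 1) (hyz : ratDet y z = 1)
    (hz : z.den ≤ Q) (hQ : Q < y.den + z.den) :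
    (z.den : ℤ) = ((x.den : ℤ) + Q) / y.den * y.den - x.den := by
  have hy : (0 : ℤ) < y.den := by exact_mod_cast y.den_pos
  have hdvd : (y.den : ℤ) ∣ x.den + z.den := by
    have hc : IsCoprime (y.den : ℤ) y.num :=
      (show IsCoprime y.num (y.den : ℤ) from Int.isCoprime_iff_gcd_eq_one.2 y.reduced).symm
    refine hc.dvd_of_dvd_mul_left ⟨x.num + z.num, ?_⟩
    simp only [ratDet] at hxy hyz
    linarith
  obtain ⟨k, hk⟩ := hdvd
  have : ((x.den : ℤ) + Q) / y.den = k := by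
    apply le_antisymm
    · apply Int.lt_add_one_iff.1
      apply Int.ediv_lt_of_lt_mul hy
      have : (Q : ℤ) < y.den + z.den := by exact_mod_cast hQ
      linarith
    · apply Int.le_ediv_of_mul_le hy
      have : (z.den : ℤ) ≤ Q := by exact_mod_cast hz
      linarith
  rw [this]; linarith

section Consecutive

variable {Q r : ℕ} {f : Fin r → ℚ} (hf : IsConsecutiveFarey Q r f)

include hf

lemma IsConsecutiveFarey.ratDet_succ {j : ℕ} (hj : j + 1 < r) :
    ratDet (f ⟨j, by omega⟩) (f ⟨j + 1, hj⟩) = 1 ∧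
      Q < (f ⟨j, by omega⟩).den + (f ⟨j + 1, hj⟩).den := by
  obtain ⟨hmem, hmono, hgap⟩ := hf
  refine ratDet_of_neighbours (hmem _) (hmem _) (hmono (by simp [Fin.lt_def])) ?_
  intro z hz h1 h2
  obtain ⟨l, rfl⟩ := hgap z hz _ _ h1.le h2.le
  have h3 := hmono.lt_iff_lt.1 h1
  have h4 := hmono.lt_iff_lt.1 h2
  simp only [Fin.lt_def] at h3 h4
  omega

lemma IsConsecutiveFarey.den_eq (hr : 2 ≤ r) :
    ∀ j, ∀ hj : j < r, ((f ⟨j, hj⟩).den : ℤ) =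
      genDenominator Q (f ⟨0, by omega⟩).den (f ⟨1, by omega⟩).den j := by
  intro j
  induction j using Nat.strong_induction_on with
  | _ j ih =>
    intro hj
    match j, ih, hj with
    | 0, _, _ => rfl
    | 1, _, _ => rfl
    | n + 2, ih, hj =>
      simp only [genDenominator]
      rw [← ih (n + 1) (by omega) (by omega), ← ih n (by omega) (by omega)]
      exact den_succ_succ (hf.ratDet_succ (by omega)).1 (hf.ratDet_succ hj).1 (hf.1 _).2.2
        (hf.ratDet_succ hj).2

lemma IsConsecutiveFarey.isFareyGenerator (hr : 2 ≤ r) :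
    IsFareyGenerator Q (f ⟨0, by omega⟩).den (f ⟨1, by omega⟩).den := by
  obtain ⟨h1, h2⟩ := hf.ratDet_succ (j := 0) (by omega)
  refine ⟨(hf.1 _).2.2, (hf.1 _).2.2, h2, ?_⟩
  rw [Nat.coprime_iff_gcd_eq_one, ← Int.gcd_natCast_natCast, ← Int.isCoprime_iff_gcd_eq_one]
  simp only [ratDet, zero_add] at h1
  exact ⟨(f ⟨1, by omega⟩).num, -(f ⟨0, by omega⟩).num, by rw [← h1]; ring⟩

end Consecutive

/-- The generators whose first `r` denominators are congruent to `c` modulo `d`. -/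
def congruentGenerators (Q r : ℕ) (c : Fin r → ℕ) (d : ℕ) : Set (ℕ × ℕ) :=
  {p | IsFareyGenerator Q p.1 p.2 ∧ ∀ j : Fin r, genDenominator Q p.1 p.2 j ≡ c j [ZMOD d]}

lemma finite_congruentGenerators (Q r : ℕ) (c : Fin r → ℕ) (d : ℕ) :
    (congruentGenerators Q r c d).Finite :=
  ((Set.finite_Iic Q).prod (Set.finite_Iic Q)).subset fun _ h => ⟨h.1.1, h.1.2.1⟩

lemma mapsTo_congruentDenominators {Q r : ℕ} (hr : 2 ≤ r) (c : Fin r → ℕ) (d : ℕ) :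
    Set.MapsTo (fun q : Fin r → ℕ => (q ⟨0, by omega⟩, q ⟨1, by omega⟩))
      (congruentDenominators Q r c d) (congruentGenerators Q r c d) := by
  rintro q ⟨⟨f, hf, hq⟩, hc⟩
  simp only [hq]
  refine ⟨hf.isFareyGenerator hr, fun j => ?_⟩
  rw [← hf.den_eq hr j j.2, ← hq]
  exact Int.natCast_modEq_iff.2 (hc j)

lemma injOn_congruentDenominators {Q r : ℕ} (hr : 2 ≤ r) (c : Fin r → ℕ) (d : ℕ) :
    Set.InjOn (fun q : Fin r → ℕ => (q ⟨0, by omega⟩, q ⟨1, by omega⟩))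
      (congruentDenominators Q r c d) := by
  rintro q ⟨⟨f, hf, hq⟩, -⟩ q' ⟨⟨f', hf', hq'⟩, -⟩ h
  simp only [hq, hq', Prod.mk.injEq] at h
  funext j
  have h1 := hf.den_eq hr j j.2
  have h2 := hf'.den_eq hr j j.2
  rw [h.1, h.2, ← h2] at h1
  rw [hq, hq']
  exact_mod_cast h1

/-- Each generator is the pair of denominators of two neighbours; the first of these is
determined by a congruence. -/
lemma exists_fraction_of_generator {Q a b : ℕ} (h : IsFareyGenerator Q a b) :
    ∃ x ∈ fareySet Q, x < 1 ∧ x.den = a ∧ (a : ℤ) ∣ 1 + x.num * b := by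
  obtain ⟨haQ, hbQ, hab, hcop⟩ := h
  have ha : (0 : ℤ) < a := by omega
  have hc : IsCoprime (a : ℤ) b := Nat.isCoprime_iff_coprime.2 hcop
  obtain ⟨u, v, huv⟩ := hc
  set e := (-v) % (a : ℤ) with he
  have he0 : 0 ≤ e := Int.emod_nonneg _ ha.ne'
  have hea : e < a := Int.emod_lt_of_pos _ ha
  have hdvd : (a : ℤ) ∣ 1 + e * b := by
    have h1 : (a : ℤ) ∣ e + v := by
      have := Int.emod_add_mul_ediv (-v) a
      exact ⟨-((-v) / a), by rw [he]; linarith⟩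
    have : 1 + e * b = u * a + (e + v) * b := by rw [← huv]; ring
    rw [this]
    exact dvd_add (dvd_mul_left _ _) (h1.mul_right _)
  obtain ⟨w, hw⟩ := hdvd
  have hcop' : IsCoprime e (a : ℤ) := ⟨-b, w, by linarith⟩
  obtain ⟨hn, hden⟩ := num_den_of_isCoprime ha hcop'
  set x : ℚ := (e : ℚ) / (a : ℤ)
  have hden' : x.den = a := by exact_mod_cast hden
  have hx1 : x < 1 := Rat.num_lt_denom_iff.1 (by rw [hn, hden]; exact hea)
  exact ⟨x, ⟨Rat.num_nonneg.1 (by rw [hn]; exact he0), hx1.le, by omega⟩, hx1, hden',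
    ⟨w, by rw [hn]; exact hw⟩⟩

/-- `e` is invertible modulo `a`, so `b` is determined modulo `a`, and it is confined to an interval
of length `a`. -/
lemma eq_of_dvd_one_add {Q a b b' : ℕ} {e : ℤ} (h : (a : ℤ) ∣ 1 + e * b)
    (h' : (a : ℤ) ∣ 1 + e * b') (hb : b ≤ Q) (hb' : b' ≤ Q) (hab : Q < a + b)
    (hab' : Q < a + b') : b = b' := by
  have h1 : (a : ℤ) ∣ e * (b - b') := by
    have := dvd_sub h h'
    have e1 : 1 + e * b - (1 + e * b') = e * (b - b') := by ring
    rwa [e1] at this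
  have hc : IsCoprime (a : ℤ) e := by
    obtain ⟨w, hw⟩ := h
    exact ⟨w, -b, by linarith⟩
  have h2 := hc.dvd_of_dvd_mul_left h1
  have h3 : |(b : ℤ) - b'| < a := by rw [abs_lt]; constructor <;> omega
  have := Int.eq_zero_of_abs_lt_dvd h2 h3
  omega

/-- A generator fails to start a tuple only if its fraction is one of the last `r - 1` Farey
fractions, and the fraction determines the generator. -/
lemma ncard_congruentGenerators_le {Q r : ℕ} (hr : 2 ≤ r) (c : Fin r → ℕ) (d : ℕ) :
    (congruentGenerators Q r c d).ncard ≤ (congruentDenominators Q r c d).ncard + r := by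
  classical
  have hD : (congruentDenominators Q r c d).Finite :=
    Set.Finite.of_injOn (mapsTo_congruentDenominators hr c d) (injOn_congruentDenominators hr c d)
      (finite_congruentGenerators Q r c d)
  set F := (finite_fareySet Q).toFinset with hF
  set n := F.card with hn
  let e : Fin n ≃o F := F.orderIsoOfFin rfl
  have hmemF : ∀ {x}, x ∈ F ↔ x ∈ fareySet Q := by simp [hF]
  choose! X hX using fun p : ℕ × ℕ =>
    fun h : IsFareyGenerator Q p.1 p.2 => exists_fraction_of_generator h
  -- the last fractions do not start a tuple
  let lastF : Finset ℚ := (Finset.univ.filter fun i : Fin n => n < i + r).image fun i => (e i : ℚ)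
  have hlast : lastF.card ≤ r := by
    refine Finset.card_image_le.trans ?_
    rw [← Finset.card_image_of_injective _ Fin.val_injective]
    refine (Finset.card_le_card (t := Finset.Ico (n - r) n) ?_).trans ?_
    · intro i hi
      simp only [Finset.mem_image, Finset.mem_filter, Finset.mem_univ, true_and] at hi
      obtain ⟨j, hj, rfl⟩ := hi
      rw [Finset.mem_Ico]
      exact ⟨by omega, j.2⟩
    · rw [Nat.card_Ico]; omega
  set B := {p ∈ congruentGenerators Q r c d | X p ∈ lastF} with hB
  have hBfin : B.Finite := (finite_congruentGenerators Q r c d).subset fun p hp => hp.1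
  have hBcard : B.ncard ≤ r := by
    refine le_trans ?_ hlast
    rw [← Set.ncard_coe_finset]
    refine Set.ncard_le_ncard_of_injOn X (fun p hp => hp.2) ?_ (Finset.finite_toSet _)
    rintro ⟨a, b⟩ hp ⟨a', b'⟩ hp' hpp
    obtain ⟨-, -, h1, h2⟩ := hX _ hp.1.1
    obtain ⟨-, -, h1', h2'⟩ := hX _ hp'.1.1
    rw [hpp] at h1 h2
    simp only at h1 h1' h2 h2'
    obtain rfl : a = a' := h1.symm.trans h1'
    have := eq_of_dvd_one_add h2 h2' hp.1.1.2.1 hp'.1.1.2.1 hp.1.1.2.2.1 hp'.1.1.2.2.1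
    rw [this]
  have hsub : congruentGenerators Q r c d ⊆
      (fun q : Fin r → ℕ => (q ⟨0, by omega⟩, q ⟨1, by omega⟩)) ''
        congruentDenominators Q r c d ∪ B := by
    rintro ⟨a, b⟩ hp
    obtain ⟨hx, hx1, hxa, hdvd⟩ := hX _ hp.1
    by_cases hB' : X (a, b) ∈ lastF
    · exact Or.inr ⟨hp, hB'⟩
    left
    set i := e.symm ⟨X (a, b), hmemF.2 hx⟩ with hi
    have hir : i + r ≤ n := by
      by_contra hcon
      exact hB' (Finset.mem_image.2 ⟨i, by simpa using hcon, by simp [hi]⟩)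
    let f : Fin r → ℚ := fun j => (e ⟨i + j, by omega⟩ : ℚ)
    have hf : IsConsecutiveFarey Q r f := by
      refine ⟨fun j => hmemF.1 (e _).2, fun j l hjl => ?_, fun x hx j l h1 h2 => ?_⟩
      · simp only [f, Subtype.coe_lt_coe, OrderIso.lt_iff_lt, Fin.lt_def]
        have : (j : ℕ) < l := hjl
        omega
      · obtain ⟨m, hm⟩ := e.surjective ⟨x, hmemF.2 hx⟩
        have hm' : (e m : ℚ) = x := by rw [hm]
        rw [← hm'] at h1 h2
        simp only [f, Subtype.coe_le_coe, OrderIso.le_iff_le, Fin.le_def] at h1 h2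
        refine ⟨⟨m - i, by omega⟩, ?_⟩
        rw [← hm']
        simp only [f]
        congr 3
        omega
    have hf0 : f ⟨0, by omega⟩ = X (a, b) := by simp [f, hi]
    have ha : (f ⟨0, by omega⟩).den = a := by rw [hf0]; exact hxa
    obtain ⟨hdet, hsum⟩ := hf.ratDet_succ (j := 0) (by omega)
    have hb : (f ⟨1, by omega⟩).den = b := by
      refine eq_of_dvd_one_add (Q := Q) (a := a) (e := (X (a, b)).num) ?_ hdvd (hf.1 _).2.2
        hp.1.2.1 (lt_of_lt_of_eq hsum (congrArg (· + _) ha)) hp.1.2.2.1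
      refine ⟨(f ⟨1, by omega⟩).num, ?_⟩
      simp only [ratDet, zero_add] at hdet
      rw [hf0] at hdet
      simp only at hxa
      rw [hxa] at hdet
      linarith
    refine ⟨fun j => (f j).den, ⟨⟨f, hf, fun j => rfl⟩, fun j => ?_⟩, by simp only [ha, hb]⟩
    rw [← Int.natCast_modEq_iff, hf.den_eq hr j j.2, ha, hb]
    exact hp.2 j
  calc _ ≤ _ := Set.ncard_le_ncard hsub ((hD.image _).union hBfin)
    _ ≤ _ := Set.ncard_union_le _ _
    _ ≤ _ := add_le_add (Set.ncard_image_le hD) hBcard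

lemma ncard_congruentDenominators_le {Q r : ℕ} (hr : 2 ≤ r) (c : Fin r → ℕ) (d : ℕ) :
    (congruentDenominators Q r c d).ncard ≤ (congruentGenerators Q r c d).ncard :=
  Set.ncard_le_ncard_of_injOn _ (mapsTo_congruentDenominators hr c d)
    (injOn_congruentDenominators hr c d) (finite_congruentGenerators Q r c d)

/-- The triangle with vertices `(0, 0)`, `(0, 1)`, `(1, 1)`. -/
def halfSquare : Set (ℝ × ℝ) := {p | 0 < p.1 ∧ p.1 ≤ p.2 ∧ p.2 ≤ 1}

/-- A nonzero fraction corresponds to its coprime numerator and denominator; the extra one counts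
the fraction `0`. Modulus `1` makes the congruence conditions void. -/
lemma ncard_fareySet {Q : ℕ} (hQ : 1 ≤ Q) :
    (fareySet Q).ncard = (primitivePoints halfSquare Q 1 0 0).ncard + 1 := by
  have hQ' : (0 : ℝ) < Q := by exact_mod_cast hQ
  have h0 : (0 : ℚ) ∈ fareySet Q := ⟨le_rfl, zero_le_one, by simpa using hQ⟩
  rw [← Set.ncard_sdiff_singleton_add_one h0 (finite_fareySet Q)]
  congr 1
  have hinj : Set.InjOn (fun x : ℚ => (x.num.toNat, x.den)) (fareySet Q \ {0}) := by
    intro x hx y hy h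
    simp only [Prod.mk.injEq] at h
    have h1 := Rat.num_nonneg.2 hx.1.1
    have h2 := Rat.num_nonneg.2 hy.1.1
    exact Rat.ext (by omega) h.2
  rw [← hinj.ncard_image]
  congr 1
  ext ⟨a, b⟩
  simp only [Set.mem_image, Prod.mk.injEq, primitivePoints, residuePoints, halfSquare,
    Set.mem_ofPred_eq, Set.mem_sdiff, Set.mem_singleton_iff, Nat.modEq_one, true_and,
    div_le_div_iff_of_pos_right hQ', div_le_one hQ', Nat.cast_le, div_pos_iff_of_pos_right hQ',
    Nat.cast_pos]
  constructor
  · rintro ⟨x, ⟨⟨h1, h2, h3⟩, h4⟩, rfl, rfl⟩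
    have h5 : 0 < x.num := Rat.num_pos.2 (lt_of_le_of_ne h1 (Ne.symm h4))
    have h6 := Rat.num_le_denom_iff.2 h2
    have h7 : x.num.toNat = x.num.natAbs := by omega
    refine ⟨⟨by omega, by omega, h3⟩, ?_⟩
    rw [h7]; exact x.reduced
  · rintro ⟨⟨h1, h2, h3⟩, h4⟩
    have hb : (0 : ℤ) < b := by omega
    obtain ⟨hn, hden⟩ := num_den_of_isCoprime (u := a) hb (Nat.isCoprime_iff_coprime.2 h4)
    have hden' : (((a : ℤ) : ℚ) / ((b : ℤ) : ℚ)).den = b := by exact_mod_cast hden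
    refine ⟨((a : ℤ) : ℚ) / ((b : ℤ) : ℚ), ⟨⟨Rat.num_nonneg.1 ?_,
      Rat.num_le_denom_iff.1 ?_, ?_⟩, fun h => ?_⟩, ?_, ?_⟩
    · rw [hn]; omega
    · rw [hn, hden]; omega
    · rw [hden']; exact h3
    · have := hn
      rw [h] at this
      simp at this
      omega
    · rw [hn]; simp
    · exact hden'

/-! ### Farey chains with a small term -/

/-- In a Farey chain that starts with a small term, all coefficients are forced, and from the
second term on the chain is an arithmetic progression. -/
lemma IsFareyChain.of_small_head {u : ℕ → ℝ} {k : ℕ → ℤ} {n : ℕ} (h : IsFareyChain 1 n u)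
    (hrec : ∀ i < n, u i + u (i + 2) = k i * u (i + 1)) (hy : (2 * n + 3) * u 0 < 1) :
    (∀ i ≤ n, u (i + 1) = u 1 - i * u 0) ∧ ∀ i < n, k i = if i = 0 then 1 else 2 := by
  have hy0 : 0 < u 0 := h.pos (by omega)
  have hu1 : 1 - u 0 < u 1 := by have := h.2 0 (by omega); simp only [zero_add] at this; linarith
  -- At `i = 0`, the coefficient `2` would give a term exceeding `1`. Later, the coefficient `1`
  -- would give `-u 0`, and `3` would give at least `2 * u (i + 1) - u 0 > 2 - (2 * i + 3) * u 0 >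
  -- 1`.
  have step : ∀ i < n, (i ≠ 0 → u i = u (i + 1) + u 0) → u (i + 1) = u 1 - i * u 0 →
      k i = (if i = 0 then 1 else 2) ∧ u (i + 2) = u (i + 1) - u 0 := by
    intro i hi h1 h2
    have hr := hrec i hi
    have hle := h.1 (i + 2) (by omega)
    have hpos := h.pos (i := i + 2) (by omega)
    have hpos1 := h.pos (i := i + 1) (by omega)
    have hin : (i : ℝ) + 1 ≤ n := by exact_mod_cast hi
    have hiy : (i + 1) * u 0 ≤ n * u 0 := mul_le_mul_of_nonneg_right hin hy0.le
    rcases eq_or_ne i 0 with rfl | hi0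
    · simp only [zero_add, Nat.cast_zero, if_true] at *
      have hk1 : 0 < k 0 := by
        have : (0 : ℝ) < k 0 := by
          by_contra hcon; push Not at hcon
          have := mul_nonpos_of_nonpos_of_nonneg hcon hpos1.le
          linarith
        exact_mod_cast this
      have hk2 : k 0 < 2 := by
        by_contra hcon; push Not at hcon
        have h3 : (2 : ℝ) ≤ k 0 := by exact_mod_cast hcon
        have := mul_le_mul_of_nonneg_right h3 hpos1.le
        linarith
      have hk : k 0 = 1 := by omega
      refine ⟨hk, ?_⟩
      rw [hk] at hr; push_cast at hr; linarith
    · rw [if_neg hi0]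
      have h1' := h1 hi0
      have hk1 : 1 < k i := by
        by_contra hcon; push Not at hcon
        have h3 : (k i : ℝ) ≤ 1 := by exact_mod_cast hcon
        have := mul_le_mul_of_nonneg_right h3 hpos1.le
        linarith
      have hk2 : k i < 3 := by
        by_contra hcon; push Not at hcon
        have h3 : (3 : ℝ) ≤ k i := by exact_mod_cast hcon
        have := mul_le_mul_of_nonneg_right h3 hpos1.le
        linarith
      have hk : k i = 2 := by omega
      refine ⟨hk, ?_⟩
      rw [hk] at hr; push_cast at hr; linarith
  have hform : ∀ i ≤ n, u (i + 1) = u 1 - i * u 0 ∧ (i ≠ 0 → u i = u (i + 1) + u 0) := by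
    intro i
    induction i with
    | zero => intro _; simp
    | succ i ih =>
      intro hi
      obtain ⟨h1, h2⟩ := ih (by omega)
      have h3 := (step i (by omega) h2 h1).2
      refine ⟨?_, fun _ => by linarith⟩
      rw [show i + 1 + 1 = i + 2 from rfl, h3, h1]; push_cast; ring
  exact ⟨fun i hi => (hform i hi).1, fun i hi => (step i hi (hform i hi.le).2 (hform i hi.le).1).1⟩

/-- The coefficients around a large coefficient with index `j`. -/
def spikeIndex (j : ℕ) (i : ℕ) : ℤ := if i + 1 = j ∨ i = j + 1 then 1 else 2

section Spike

variable {s : ℕ} {k : ℕ → ℤ} {p : ℝ × ℝ} (hp : p ∈ chainRegion s k) {j : ℕ} (hj : j < s)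

include hp hj

lemma coeff_mul_le_two_of_mem_chainRegion : (k j : ℝ) * recSeq k p.1 p.2 (j + 1) ≤ 2 := by
  have h1 := IsFareyChain.pos hp (i := j) (by omega)
  have h2 := hp.1 j (by omega)
  have h3 := hp.1 (j + 2) (by omega)
  simp only [recSeq] at h3
  linarith

/-- The threshold works because `2 * (2 * s + 3) < 4 * s + 7`. -/
lemma small_of_large_coeff (hk : (4 * s + 7 : ℤ) ≤ k j) :
    (2 * s + 3) * recSeq k p.1 p.2 (j + 1) < 1 := by
  have h0 := IsFareyChain.pos hp (i := j + 1) (by omega)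
  have h1 := coeff_mul_le_two_of_mem_chainRegion hp hj
  have h2 : (4 * s + 7 : ℝ) ≤ k j := by exact_mod_cast hk
  have := mul_le_mul_of_nonneg_right h2 h0.le
  nlinarith

/-- The recursion is symmetric under reversal, so the chain read backwards from its small term of
index `j + 1` is again a Farey chain with a small head. -/
lemma backward_of_large_coeff (hk : (4 * s + 7 : ℤ) ≤ k j) :
    (∀ i ≤ j, recSeq k p.1 p.2 (j - i) = recSeq k p.1 p.2 j - i * recSeq k p.1 p.2 (j + 1)) ∧
      ∀ i < j, k i = spikeIndex j i := by
  have hy := small_of_large_coeff hp hj hk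
  set u := recSeq k p.1 p.2 with hu
  have hy0 := IsFareyChain.pos hp (i := j + 1) (by omega)
  have hc : IsFareyChain 1 j (fun i => u (j + 1 - i)) := by
    refine ⟨fun i hi => hp.1 _ (by omega), fun i hi => ?_⟩
    have := hp.2 (j - i) (by omega)
    beta_reduce
    rw [show j + 1 - i = j - i + 1 by omega, show j + 1 - (i + 1) = j - i by omega]
    linarith
  have hjs : (j : ℝ) ≤ s := by exact_mod_cast hj.le
  have hm := mul_le_mul_of_nonneg_right hjs hy0.le
  have := hc.of_small_head (k := fun i => k (j - 1 - i)) (fun i hi => ?_) ?_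
  · obtain ⟨h1, h2⟩ := this
    refine ⟨fun i hi => ?_, fun i hi => ?_⟩
    · have := h1 i hi
      simpa using this
    · have := h2 (j - 1 - i) (by omega)
      rw [show j - 1 - (j - 1 - i) = i by omega] at this
      rw [this, spikeIndex]
      refine if_congr ?_ rfl rfl
      omega
  · obtain ⟨l, rfl⟩ : ∃ l, j = i + 1 + l := ⟨j - (i + 1), by omega⟩
    have e1 : i + 1 + l + 1 - i = l + 2 := by omega
    have e2 : i + 1 + l + 1 - (i + 2) = l := by omega
    have e3 : i + 1 + l + 1 - (i + 1) = l + 1 := by omega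
    have e4 : i + 1 + l - 1 - i = l := by omega
    simp only [e1, e2, e3, e4, hu, recSeq]
    ring
  · simp only [Nat.sub_zero]
    change (2 * (j : ℝ) + 3) * recSeq k p.1 p.2 (j + 1) < 1
    linarith

lemma forward_of_large_coeff (hk : (4 * s + 7 : ℤ) ≤ k j) :
    ∀ i, j < i → i < s → k i = spikeIndex j i := by
  have hy := small_of_large_coeff hp hj hk
  set u := recSeq k p.1 p.2 with hu
  have hy0 := IsFareyChain.pos hp (i := j + 1) (by omega)
  have hc : IsFareyChain 1 (s - j - 1) (fun i => u (j + 1 + i)) :=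
    ⟨fun i hi => hp.1 _ (by omega), fun i hi => hp.2 (j + 1 + i) (by omega)⟩
  have hjs : ((s - j - 1 : ℕ) : ℝ) ≤ s := by exact_mod_cast (by omega : s - j - 1 ≤ s)
  have hm := mul_le_mul_of_nonneg_right hjs hy0.le
  have := hc.of_small_head (k := fun i => k (j + 1 + i)) (fun i hi => ?_) ?_
  · intro i hi his
    have := this.2 (i - (j + 1)) (by omega)
    rw [show j + 1 + (i - (j + 1)) = i by omega] at this
    rw [this, spikeIndex]
    refine if_congr ?_ rfl rfl
    omega
  · rw [hu, ← Nat.add_assoc, ← Nat.add_assoc]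
    simp only [recSeq]
    ring
  · change (2 * ((s - j - 1 : ℕ) : ℝ) + 3) * recSeq k p.1 p.2 (j + 1) < 1
    linarith

/-- The vector has the shape `…, 2, 2, 1, k j, 1, 2, 2, …`; the value of `spikeIndex` at `j` itself
has no meaning. -/
lemma coeff_eq_spikeIndex (hk : (4 * s + 7 : ℤ) ≤ k j) :
    ∀ i < s, i ≠ j → k i = spikeIndex j i := by
  intro i hi hij
  rcases lt_or_gt_of_ne hij with h | h
  · exact (backward_of_large_coeff hp hj hk).2 i h
  · exact forward_of_large_coeff hp hj hk i h hi

/-- The region with a large coefficient is close to the corners `(1, 1)` and `(1, 0)`. -/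
lemma mem_corners_of_large_coeff (hk : (4 * s + 7 : ℤ) ≤ k j) {η : ℝ}
    (hη : 2 * (s + 1) ≤ η * k j) :
    p ∈ Set.Icc (1 - η) 1 ×ˢ (Set.Icc (1 - η) 1 ∪ Set.Icc 0 η) := by
  obtain ⟨hb, -⟩ := backward_of_large_coeff hp hj hk
  have h2 := coeff_mul_le_two_of_mem_chainRegion hp hj
  have hy0 := IsFareyChain.pos hp (i := j + 1) (by omega)
  have hsum := hp.2 j (by omega)
  have hx := hb j le_rfl
  simp only [Nat.sub_self] at hx
  set y := recSeq k p.1 p.2 (j + 1) with hy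
  have hkpos : (0 : ℝ) < k j := by
    have : (4 * s + 7 : ℝ) ≤ k j := by exact_mod_cast hk
    have : (0 : ℝ) ≤ s := Nat.cast_nonneg s
    linarith
  have hyη : (s + 1) * y ≤ η := by
    have : (s + 1) * y * k j ≤ η * k j := by
      have := mul_le_mul_of_nonneg_left h2 (by positivity : (0 : ℝ) ≤ s + 1)
      linarith
    exact le_of_mul_le_mul_right this hkpos
  have hjs : (j : ℝ) + 1 ≤ s := by exact_mod_cast hj
  have hjy := mul_le_mul_of_nonneg_right hjs hy0.le
  have h0 : recSeq k p.1 p.2 0 = p.1 := rfl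
  have h1 : recSeq k p.1 p.2 1 = p.2 := rfl
  refine ⟨⟨?_, hp.1 0 (by omega)⟩, ?_⟩
  · rw [← h0, hx]; linarith
  · rcases Nat.eq_zero_or_pos j with rfl | hj0
    · right
      have : y = p.2 := rfl
      rw [← this]
      have : (0 : ℝ) ≤ s * y := by positivity
      exact ⟨hy0.le, by linarith⟩
    · left
      have hx1 := hb (j - 1) (by omega)
      rw [show j - (j - 1) = 1 by omega, h1] at hx1
      have hj1 : ((j - 1 : ℕ) : ℝ) = j - 1 := by
        rw [Nat.cast_sub hj0]; simp
      refine ⟨?_, hp.1 1 (by omega)⟩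
      rw [hx1, hj1]; linarith

/-- If the large coefficient is at most `√Q`, the `Q`-fold dilation of the region contains a
lattice point. -/
lemma exists_lattice_of_large_coeff {Q : ℕ} (hk : (4 * s + 7 : ℤ) ≤ k j) (hQ : k j ^ 2 ≤ Q) :
    ∃ m n : ℤ, ((m : ℝ) / Q, (n : ℝ) / Q) ∈ chainRegion s k := by
  have hspike := coeff_eq_spikeIndex hp hj hk
  set m := k j with hm
  have hm0 : 0 < m := by omega
  have hQ1 : 1 ≤ Q := by
    have : 0 < m ^ 2 := by positivity
    omega
  set b : ℤ := 2 * Q / m with hb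
  have hb1 : b * m ≤ 2 * Q := Int.ediv_mul_le _ hm0.ne'
  have hb2 : 2 * Q < (b + 1) * m := Int.lt_ediv_add_one_mul_self _ hm0
  -- This is where `m ^ 2 ≤ Q` enters: it yields `(m + 1) * b ≥ (b + 1) * m > 2 * Q`, the strict
  -- inequality needed just after the small term.
  have hb3 : m ≤ b := Int.le_ediv_of_mul_le hm0 (by nlinarith)
  have hb0 : 0 < b := by omega
  have hb4 : (4 * s + 7) * b ≤ 2 * Q := by
    have := mul_le_mul_of_nonneg_right hk hb0.le
    linarith
  -- The chain rises in steps of `b` to the peak `Q` at index `j`, takes the small value `b`, jumps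
  -- to `m * b - Q` and descends in steps of `b`.
  let w : ℕ → ℤ := fun i =>
    if i ≤ j then Q - (j - i) * b else if i = j + 1 then b else m * b - Q - (i - j - 2) * b
  have hrec : ∀ i < s, w (i + 2) = (k i : ℤ) * w (i + 1) - w i := by
    intro i hi
    rcases lt_trichotomy i j with h | h | h
    · rw [hspike i hi h.ne]
      rcases Nat.lt_or_ge (i + 1) j with h' | h'
      · have e : spikeIndex j i = 2 := if_neg (by omega)
        simp only [w, e, if_pos (show i + 2 ≤ j by omega), if_pos (show i + 1 ≤ j by omega),
          if_pos h.le]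
        push_cast; ring
      · obtain rfl : j = i + 1 := by omega
        have e : spikeIndex (i + 1) i = 1 := if_pos (by omega)
        simp only [w, e, if_neg (show ¬ i + 2 ≤ i + 1 by omega), if_pos h.le, le_refl, if_true]
        push_cast; ring
    · subst h
      simp only [w, ← hm, if_neg (show ¬ i + 2 ≤ i by omega),
        if_neg (show ¬ i + 2 = i + 1 by omega), if_neg (show ¬ i + 1 ≤ i by omega), le_refl,
        if_true]
      push_cast; ring
    · rw [hspike i hi h.ne']
      rcases Nat.lt_or_ge (j + 1) i with h' | h'
      · have e : spikeIndex j i = 2 := if_neg (by omega)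
        simp only [w, e, if_neg (show ¬ i + 2 ≤ j by omega),
          if_neg (show ¬ i + 2 = j + 1 by omega), if_neg (show ¬ i + 1 ≤ j by omega),
          if_neg (show ¬ i + 1 = j + 1 by omega), if_neg (show ¬ i ≤ j by omega),
          if_neg h'.ne']
        push_cast; ring
      · obtain rfl : i = j + 1 := by omega
        have e : spikeIndex j (j + 1) = 1 := if_pos (by omega)
        simp only [w, e, if_neg (show ¬ j + 1 + 2 ≤ j by omega),
          if_neg (show ¬ j + 1 + 2 = j + 1 by omega), if_neg (show ¬ j + 1 + 1 ≤ j by omega),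
          if_neg (show ¬ j + 1 + 1 = j + 1 by omega), if_neg (show ¬ j + 1 ≤ j by omega), if_true]
        push_cast; ring
  have hsb : ∀ i : ℤ, i ≤ s → i * b ≤ s * b := fun i hi => mul_le_mul_of_nonneg_right hi hb0.le
  have hjs : (j : ℤ) < s := by exact_mod_cast hj
  have hchain : IsFareyChain (Q : ℤ) s w := by
    refine ⟨fun i hi => ?_, fun i hi => ?_⟩
    · rcases Nat.lt_or_ge j i with h | h
      · rcases eq_or_ne i (j + 1) with h' | h'
        · simp only [w, if_neg (show ¬ i ≤ j by omega), if_pos h']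
          nlinarith
        · simp only [w, if_neg (show ¬ i ≤ j by omega), if_neg h']
          have : 0 ≤ ((i : ℤ) - j - 2) * b := mul_nonneg (by omega) hb0.le
          linarith
      · simp only [w, if_pos h]
        have : 0 ≤ ((j : ℤ) - i) * b := mul_nonneg (by omega) hb0.le
        linarith
    · rcases Nat.lt_or_ge i (j + 1) with h | h
      · rcases eq_or_ne i j with rfl | h'
        · simp only [w, le_refl, if_true, if_neg (show ¬ i + 1 ≤ i by omega)]
          linarith
        · simp only [w, if_pos (show i ≤ j by omega), if_pos (show i + 1 ≤ j by omega)]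
          have h3 := hsb ((j : ℤ) - i) (by omega)
          push_cast
          linarith
      · rcases eq_or_ne i (j + 1) with rfl | h'
        · simp only [w, if_neg (show ¬ j + 1 ≤ j by omega), if_true,
            if_neg (show ¬ j + 1 + 1 ≤ j by omega), if_neg (show ¬ j + 1 + 1 = j + 1 by omega)]
          push_cast
          linarith
        · simp only [w, if_neg (show ¬ i ≤ j by omega), if_neg h',
            if_neg (show ¬ i + 1 ≤ j by omega), if_neg (show ¬ i + 1 = j + 1 by omega)]
          have h3 := hsb ((i : ℤ) - j) (by omega)
          push_cast
          linarith
  refine ⟨w 0, w 1, (intCast_mem_chainRegion hQ1 _ _).2 ?_⟩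
  exact hchain.congr (eq_recSeq hrec)

end Spike

/-! ### Interior points and lattice points of large dilations -/

/-- Scaling a point by `t` slightly below `1` makes the upper bounds strict and preserves the strict
lower bounds, so an interior point results. -/
lemma exists_ball_subset_chainRegion {s : ℕ} {k : ℕ → ℤ} (h : (chainRegion s k).Nonempty) :
    ∃ c : ℝ × ℝ, ∃ ε > 0, Metric.ball c ε ⊆ chainRegion s k := by
  obtain ⟨p, hp⟩ := h
  let V : Set (ℝ × ℝ) := ⋂ i ∈ Finset.range (s + 1),
    {q : ℝ × ℝ | 1 < recSeq k q.1 q.2 i + recSeq k q.1 q.2 (i + 1)}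
  let U : Set (ℝ × ℝ) := ⋂ i ∈ Finset.range (s + 2), {q : ℝ × ℝ | recSeq k q.1 q.2 i < 1}
  have hV : IsOpen V := isOpen_biInter_finset fun i _ => isOpen_lt continuous_const
    ((continuous_recSeq k i).add (continuous_recSeq k (i + 1)))
  have hU : IsOpen U := isOpen_biInter_finset fun i _ => isOpen_lt (continuous_recSeq k i)
    continuous_const
  have hpV : p ∈ V := by
    simp only [V, Set.mem_iInter, Finset.mem_range]
    exact fun i hi => hp.2 i (by omega)
  have hcont : Continuous fun t : ℝ => (t • p : ℝ × ℝ) := by fun_prop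
  have hev : ∀ᶠ t : ℝ in nhdsWithin 1 (Set.Iio 1), t • p ∈ V :=
    nhdsWithin_le_nhds (hcont.continuousAt.eventually_mem (hV.mem_nhds (by simpa using hpV)))
  have hev2 : ∀ᶠ t : ℝ in nhdsWithin 1 (Set.Iio 1), 0 < t :=
    nhdsWithin_le_nhds (lt_mem_nhds one_pos)
  obtain ⟨t, ⟨htV, ht0⟩, ht1⟩ := ((hev.and hev2).and self_mem_nhdsWithin).exists
  have ht1' : t < 1 := ht1
  have htU : t • p ∈ U := by
    simp only [U, Set.mem_iInter, Finset.mem_range]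
    intro i hi
    simp only [Set.mem_ofPred_eq, Prod.smul_fst, Prod.smul_snd, smul_eq_mul, recSeq_mul]
    have h1 := hp.1 i (by omega)
    have := mul_le_mul_of_nonneg_left h1 ht0.le
    linarith
  obtain ⟨ε, hε, hball⟩ := Metric.isOpen_iff.1 (hU.inter hV) _ ⟨htU, htV⟩
  refine ⟨t • p, ε, hε, hball.trans ?_⟩
  rintro q ⟨hqU, hqV⟩
  simp only [U, V, Set.mem_iInter, Finset.mem_range, Set.mem_ofPred_eq] at hqU hqV
  exact ⟨fun i hi => (hqU i (by omega)).le, fun i hi => hqV i (by omega)⟩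

lemma eventually_exists_lattice {D : Set (ℝ × ℝ)} {c : ℝ × ℝ} {ε : ℝ} (hε : 0 < ε)
    (hD : Metric.ball c ε ⊆ D) :
    ∀ᶠ Q : ℕ in Filter.atTop, ∃ m n : ℤ, ((m : ℝ) / Q, (n : ℝ) / Q) ∈ D := by
  obtain ⟨N, hN⟩ := exists_nat_gt (1 / ε)
  filter_upwards [Filter.eventually_ge_atTop (max N 1)] with Q hQ
  have hQ0 : (0 : ℝ) < Q := by
    have : 1 ≤ Q := le_trans (le_max_right _ _) hQ
    exact_mod_cast this
  have hQN : (1 : ℝ) / ε < Q := hN.trans_le (by exact_mod_cast le_trans (le_max_left _ _) hQ)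
  have hQε : 1 / (Q : ℝ) < ε := by
    rw [div_lt_iff₀ hε] at hQN
    rw [div_lt_iff₀ hQ0]; linarith
  have key : ∀ x : ℝ, |(⌊Q * x⌋ : ℝ) / Q - x| < ε := by
    intro x
    have h1 := Int.floor_le (Q * x)
    have h2 := Int.lt_floor_add_one (Q * x)
    have e : (⌊Q * x⌋ : ℝ) / Q - x = (⌊Q * x⌋ - Q * x) / Q := by field_simp
    rw [e, abs_div, abs_of_pos hQ0]
    refine lt_of_le_of_lt ?_ hQε
    gcongr
    rw [abs_le]; constructor <;> linarith
  refine ⟨⌊Q * c.1⌋, ⌊Q * c.2⌋, hD ?_⟩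
  rw [Metric.mem_ball, Prod.dist_eq, max_lt_iff, Real.dist_eq, Real.dist_eq]
  exact ⟨key _, key _⟩

/-- If `Q` is large, the vectors whose regions have no lattice points in their `Q`-fold dilation
have a large component. -/
lemma eventually_large_coeff_of_no_lattice (s : ℕ) :
    ∀ᶠ Q : ℕ in Filter.atTop, ∀ k : Fin s → ℕ, (chainRegion s (extendIndex k)).Nonempty →
      (¬ ∃ m n : ℤ, ((m : ℝ) / Q, (n : ℝ) / Q) ∈ chainRegion s (extendIndex k)) →
      ∃ j : Fin s, 4 * s + 7 ≤ k j ∧ Q < k j ^ 2 := by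
  have hfin : {k : Fin s → ℕ | ∀ j, k j ∈ Set.Iio (4 * s + 7)}.Finite :=
    Set.Finite.pi' fun _ => Set.finite_Iio _
  -- Only finitely many vectors have all entries below the threshold, so one bound on `Q` serves
  -- them all.
  have hsmall : ∀ᶠ Q : ℕ in Filter.atTop, ∀ k ∈ {k : Fin s → ℕ | ∀ j, k j ∈ Set.Iio (4 * s + 7)},
      (chainRegion s (extendIndex k)).Nonempty →
      ∃ m n : ℤ, ((m : ℝ) / Q, (n : ℝ) / Q) ∈ chainRegion s (extendIndex k) := by
    rw [Filter.eventually_all_finite hfin]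
    intro k _
    by_cases hne : (chainRegion s (extendIndex k)).Nonempty
    · obtain ⟨c, ε, hε, hball⟩ := exists_ball_subset_chainRegion hne
      filter_upwards [eventually_exists_lattice hε hball] with Q hQ _ using hQ
    · exact Filter.Eventually.of_forall fun Q h => absurd h hne
  filter_upwards [hsmall] with Q hQ k hne hno
  have : ∃ j : Fin s, 4 * s + 7 ≤ k j := by
    by_contra hcon; push Not at hcon
    exact hno (hQ k hcon hne)
  obtain ⟨j, hj⟩ := this
  refine ⟨j, hj, ?_⟩
  by_contra hcon; push Not at hcon
  obtain ⟨p, hp⟩ := hne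
  refine hno (exists_lattice_of_large_coeff hp j.2 ?_ ?_)
  · rw [extendIndex_apply]; exact_mod_cast hj
  · rw [extendIndex_apply]; exact_mod_cast hcon

lemma chainRegion_subset_corners {s Q : ℕ} (hQ : 1 ≤ Q) {k : Fin s → ℕ} {j : Fin s}
    (hk : 4 * s + 7 ≤ k j) (hkQ : Q < k j ^ 2) :
    chainRegion s (extendIndex k) ⊆ Set.Icc (1 - 2 * (s + 1) / Real.sqrt Q) 1 ×ˢ
      (Set.Icc (1 - 2 * (s + 1) / Real.sqrt Q) 1 ∪ Set.Icc 0 (2 * (s + 1) / Real.sqrt Q)) := by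
  intro p hp
  have hQ0 : (0 : ℝ) < Real.sqrt Q := Real.sqrt_pos.2 (by exact_mod_cast hQ)
  refine mem_corners_of_large_coeff hp j.2 ?_ ?_
  · rw [extendIndex_apply]; exact_mod_cast hk
  · rw [extendIndex_apply, Int.cast_natCast, div_mul_eq_mul_div, le_div_iff₀ hQ0]
    gcongr
    rw [Real.sqrt_le_left (by positivity)]
    exact_mod_cast hkQ.le

lemma volume_corners_le {η : ℝ} (hη : 0 ≤ η) :
    volume (Set.Icc (1 - η) 1 ×ˢ (Set.Icc (1 - η) 1 ∪ Set.Icc 0 η)) ≤ ENNReal.ofReal (2 * η ^ 2) := by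
  rw [Measure.volume_eq_prod, Measure.prod_prod]
  have h1 : volume (Set.Icc (1 - η) 1) = ENNReal.ofReal η := by rw [Real.volume_Icc]; congr 1; ring
  have h2 : volume (Set.Icc 0 η) = ENNReal.ofReal η := by rw [Real.volume_Icc]; congr 1; ring
  calc _ ≤ volume (Set.Icc (1 - η) 1) * (volume (Set.Icc (1 - η) 1) + volume (Set.Icc 0 η)) := by
        gcongr; exact measure_union_le _ _
    _ = _ := by
        rw [h1, h2, ← ENNReal.ofReal_add hη hη, ← ENNReal.ofReal_mul hη]; congr 1; ring

/-! ### Perimeters -/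

/-- The coordinate map from the Euclidean plane to `ℝ × ℝ`. -/
def planeCoords (p : EuclideanSpace ℝ (Fin 2)) : ℝ × ℝ := (p 0, p 1)

lemma measurePreserving_planeCoords : MeasurePreserving planeCoords := by
  have := (volume_preserving_finTwoArrow ℝ).comp (PiLp.volume_preserving_ofLp (Fin 2))
  exact this

lemma continuous_planeCoords : Continuous planeCoords := by
  unfold planeCoords; fun_prop

lemma fareyPolygon_eq_preimage {s : ℕ} (k : Fin s → ℕ) :
    fareyPolygon k = planeCoords ⁻¹' chainRegion s (extendIndex k) := by
  ext p; exact mem_fareyPolygon_iff k p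

lemma planeArea_fareyPolygon {s : ℕ} (k : Fin s → ℕ) :
    planeArea (fareyPolygon k) = volume.real (chainRegion s (extendIndex k)) := by
  rw [planeArea, fareyPolygon_eq_preimage, measurePreserving_planeCoords.measure_preimage
    (measurableSet_chainRegion _ _).nullMeasurableSet]
  rfl

/-- The one-dimensional measure of the boundary of a bounded plane set is at least the length of
its projection to a coordinate axis. -/
lemma volume_coord_image_le {S : Set (EuclideanSpace ℝ (Fin 2))} {b : ℝ}
    (hb : ∀ p ∈ S, ∀ i, p i ≤ b) (i : Fin 2) :
    volume ((fun p : EuclideanSpace ℝ (Fin 2) => p i) '' S) ≤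
      Measure.hausdorffMeasure 1 (frontier S) := by
  have hlip : LipschitzWith 1 fun p : EuclideanSpace ℝ (Fin 2) => p i :=
    LipschitzWith.of_dist_le_mul fun p q => by
      rw [NNReal.coe_one, one_mul, dist_eq_norm, dist_eq_norm]
      exact PiLp.norm_apply_le (p - q) i
  have hsub : (fun p : EuclideanSpace ℝ (Fin 2) => p i) '' S ⊆
      (fun p : EuclideanSpace ℝ (Fin 2) => p i) '' frontier S := by
    rintro _ ⟨p, hp, rfl⟩
    obtain ⟨l, hl⟩ : ∃ l : Fin 2, l ≠ i := exists_ne i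
    -- The line through `p` in the other coordinate direction leaves `S`, which is bounded above, so
    -- it meets the frontier at a point with the same `i`-th coordinate.
    let g : ℝ → EuclideanSpace ℝ (Fin 2) := fun t => p + t • EuclideanSpace.single l (1 : ℝ)
    have hg : Continuous g := by fun_prop
    have hgi : ∀ t, g t i = p i := fun t => by simp [g, hl.symm]
    have hgl : ∀ t, g t l = p l + t := fun t => by simp [g]
    have h1 : (g ⁻¹' S).Nonempty := ⟨0, by simpa [g] using hp⟩
    have h2 : g ⁻¹' S ≠ Set.univ := by
      intro h
      have : b - p l + 1 ∈ g ⁻¹' S := h ▸ Set.mem_univ _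
      have := hb _ this l
      rw [hgl] at this
      linarith
    obtain ⟨t, ht⟩ := nonempty_frontier_iff.2 ⟨h1, h2⟩
    exact ⟨g t, hg.frontier_preimage_subset S ht, hgi t⟩
  calc _ ≤ volume ((fun p : EuclideanSpace ℝ (Fin 2) => p i) '' frontier S) := measure_mono hsub
    _ = Measure.hausdorffMeasure 1 ((fun p : EuclideanSpace ℝ (Fin 2) => p i) '' frontier S) := by
        rw [hausdorffMeasure_real]
    _ ≤ _ := by simpa using hlip.hausdorffMeasure_image_le zero_le_one (frontier S)

lemma hausdorffMeasure_segment_lt_top (v w : EuclideanSpace ℝ (Fin 2)) :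
    Measure.hausdorffMeasure 1 ((fun t : ℝ => t • v + w) '' Set.Icc (0 : ℝ) 1) < ⊤ := by
  have hlip : LipschitzWith ‖v‖₊ fun t : ℝ => t • v + w :=
    LipschitzWith.of_dist_le_mul fun t u => by
      rw [dist_eq_norm, dist_eq_norm, add_sub_add_right_eq_sub, ← sub_smul, norm_smul, mul_comm,
        coe_nnnorm]
  refine (hlip.hausdorffMeasure_image_le zero_le_one _).trans_lt ?_
  rw [hausdorffMeasure_real]
  exact ENNReal.mul_lt_top (by simp) (by simp)

lemma hausdorffMeasure_line_inter_square_lt_top (α β : ℝ) :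
    Measure.hausdorffMeasure 1 {p : EuclideanSpace ℝ (Fin 2) | p 0 ∈ Set.Icc (0 : ℝ) 1 ∧
      p 1 ∈ Set.Icc (0 : ℝ) 1 ∧ p 0 * α + p 1 * β = 1} < ⊤ := by
  by_cases hβ : β = 0
  · by_cases hα : α = 0
    · have : {p : EuclideanSpace ℝ (Fin 2) | p 0 ∈ Set.Icc (0 : ℝ) 1 ∧
        p 1 ∈ Set.Icc (0 : ℝ) 1 ∧ p 0 * α + p 1 * β = 1} = ∅ := by
        refine Set.eq_empty_of_forall_notMem ?_
        rintro p ⟨-, -, h⟩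
        simp [hα, hβ] at h
      rw [this, measure_empty]; exact ENNReal.zero_lt_top
    · refine (measure_mono ?_).trans_lt
        (hausdorffMeasure_segment_lt_top !₂[-β / α, (1 : ℝ)] !₂[1 / α, (0 : ℝ)])
      rintro p ⟨-, h1, h⟩
      refine ⟨p 1, h1, ?_⟩
      ext i
      fin_cases i
      · simp; field_simp; linarith
      · simp
  · refine (measure_mono ?_).trans_lt
      (hausdorffMeasure_segment_lt_top !₂[(1 : ℝ), -α / β] !₂[(0 : ℝ), 1 / β])
    rintro p ⟨h0, -, h⟩
    refine ⟨p 0, h0, ?_⟩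
    ext i
    fin_cases i
    · simp
    · simp; field_simp; linarith

lemma recSeq_eq_add (k : ℕ → ℤ) (x y : ℝ) (i : ℕ) :
    recSeq k x y i = x * recSeq k 1 0 i + y * recSeq k 0 1 i := by
  have := recSeq_linear k x y 1 0 0 1 i
  simpa using this

/-- The boundary lies on finitely many lines inside the unit square. Finiteness matters because
`planePerimeter` would assign the value `0` to an infinite measure. -/
lemma hausdorffMeasure_frontier_fareyPolygon_lt_top {s : ℕ} (k : Fin s → ℕ) :
    Measure.hausdorffMeasure 1 (frontier (fareyPolygon k)) < ⊤ := by
  set K := extendIndex k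
  let A : ℕ → Set (EuclideanSpace ℝ (Fin 2)) := fun i => {p | p 0 ∈ Set.Icc (0 : ℝ) 1 ∧
      p 1 ∈ Set.Icc (0 : ℝ) 1 ∧ p 0 * recSeq K 1 0 i + p 1 * recSeq K 0 1 i = 1}
  let B : ℕ → Set (EuclideanSpace ℝ (Fin 2)) := fun i => {p | p 0 ∈ Set.Icc (0 : ℝ) 1 ∧
      p 1 ∈ Set.Icc (0 : ℝ) 1 ∧ p 0 * (recSeq K 1 0 i + recSeq K 1 0 (i + 1)) +
        p 1 * (recSeq K 0 1 i + recSeq K 0 1 (i + 1)) = 1}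
  have hsub : frontier (fareyPolygon k) ⊆
      (⋃ i ∈ Finset.range (s + 2), A i) ∪ ⋃ i ∈ Finset.range (s + 1), B i := by
    intro p hp
    have hc : ∀ i, Continuous fun p : EuclideanSpace ℝ (Fin 2) => recSeq K (p 0) (p 1) i :=
      fun i => (continuous_recSeq K i).comp continuous_planeCoords
    -- the closure satisfies the weak inequalities
    have hle : ∀ i ≤ s + 1, recSeq K (p 0) (p 1) i ≤ 1 := fun i hi => by
      have hcl : IsClosed {p : EuclideanSpace ℝ (Fin 2) | recSeq K (p 0) (p 1) i ≤ 1} :=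
        isClosed_le (hc i) continuous_const
      exact closure_minimal (fun q hq => ((mem_fareyPolygon_iff k q).1 hq).1 i hi) hcl hp.1
    have hge : ∀ i ≤ s, 1 ≤ recSeq K (p 0) (p 1) i + recSeq K (p 0) (p 1) (i + 1) := fun i hi => by
      have hcl : IsClosed {p : EuclideanSpace ℝ (Fin 2) |
          1 ≤ recSeq K (p 0) (p 1) i + recSeq K (p 0) (p 1) (i + 1)} :=
        isClosed_le continuous_const ((hc i).add (hc (i + 1)))
      exact closure_minimal (fun q hq => (((mem_fareyPolygon_iff k q).1 hq).2 i hi).le) hcl hp.1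
    have h0 : recSeq K (p 0) (p 1) 0 = p 0 := rfl
    have h1 : recSeq K (p 0) (p 1) 1 = p 1 := rfl
    have a0 := hle 0 (by omega)
    have a1 := hle 1 (by omega)
    have a2 := hge 0 (by omega)
    rw [zero_add, h0, h1] at a2
    rw [h0] at a0
    rw [h1] at a1
    have hb0 : p 0 ∈ Set.Icc (0 : ℝ) 1 := ⟨by linarith, a0⟩
    have hb1 : p 1 ∈ Set.Icc (0 : ℝ) 1 := ⟨by linarith, a1⟩
    by_contra hcon
    simp only [Set.mem_union, Set.mem_iUnion, Finset.mem_range, not_or, not_exists] at hcon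
    obtain ⟨hA, hB⟩ := hcon
    have hlt : ∀ i ≤ s + 1, recSeq K (p 0) (p 1) i < 1 := fun i hi => by
      refine lt_of_le_of_ne (hle i hi) fun h => hA i (by omega) ⟨hb0, hb1, ?_⟩
      rw [← recSeq_eq_add, h]
    have hgt : ∀ i ≤ s, 1 < recSeq K (p 0) (p 1) i + recSeq K (p 0) (p 1) (i + 1) := fun i hi => by
      refine lt_of_le_of_ne (hge i hi) fun h => hB i (by omega) ⟨hb0, hb1, ?_⟩
      have e1 := recSeq_eq_add K (p 0) (p 1) i
      have e2 := recSeq_eq_add K (p 0) (p 1) (i + 1)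
      linarith
    refine hp.2 (mem_interior.2 ⟨(⋂ i ∈ Finset.range (s + 2),
      {q : EuclideanSpace ℝ (Fin 2) | recSeq K (q 0) (q 1) i < 1}) ∩
      ⋂ i ∈ Finset.range (s + 1), {q : EuclideanSpace ℝ (Fin 2) |
        1 < recSeq K (q 0) (q 1) i + recSeq K (q 0) (q 1) (i + 1)}, ?_, ?_, ?_⟩)
    · rintro q ⟨hq1, hq2⟩
      simp only [Set.mem_iInter, Finset.mem_range, Set.mem_ofPred_eq] at hq1 hq2
      exact (mem_fareyPolygon_iff k q).2 ⟨fun i hi => (hq1 i (by omega)).le,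
        fun i hi => hq2 i (by omega)⟩
    · exact (isOpen_biInter_finset fun i _ => isOpen_lt (hc i) continuous_const).inter
        (isOpen_biInter_finset fun i _ => isOpen_lt continuous_const ((hc i).add (hc (i + 1))))
    · simp only [Set.mem_inter_iff, Set.mem_iInter, Finset.mem_range, Set.mem_ofPred_eq]
      exact ⟨fun i hi => hlt i (by omega), fun i hi => hgt i (by omega)⟩
  refine (measure_mono hsub).trans_lt ((measure_union_le _ _).trans_lt (ENNReal.add_lt_top.2 ⟨?_, ?_⟩))
  · exact measure_biUnion_lt_top (Finset.finite_toSet _)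
      fun i _ => hausdorffMeasure_line_inter_square_lt_top _ _
  · exact measure_biUnion_lt_top (Finset.finite_toSet _)
      fun i _ => hausdorffMeasure_line_inter_square_lt_top _ _

/-- The sum of the lengths of the projections of a plane set to the coordinate axes. -/
noncomputable def projectionLength (D : Set (ℝ × ℝ)) : ℝ :=
  volume.real (Prod.fst '' D) + volume.real (Prod.snd '' D)

lemma projectionLength_le_planePerimeter {s : ℕ} (k : Fin s → ℕ) :
    projectionLength (chainRegion s (extendIndex k)) ≤ 2 * planePerimeter (fareyPolygon k) := by
  have hb : ∀ p ∈ fareyPolygon k, ∀ i, p i ≤ 1 := by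
    intro p hp i
    have := chainRegion_subset _ _ ((mem_fareyPolygon_iff k p).1 hp)
    fin_cases i
    · exact this.1.2
    · exact this.2.2
  have hfin := (hausdorffMeasure_frontier_fareyPolygon_lt_top k).ne
  have himg : ∀ i : Fin 2, volume.real ((fun p : EuclideanSpace ℝ (Fin 2) => p i) ''
      fareyPolygon k) ≤ planePerimeter (fareyPolygon k) := fun i =>
    ENNReal.toReal_mono hfin (volume_coord_image_le hb i)
  have h0 := himg 0
  have h1 := himg 1
  have hsurj : planeCoords '' fareyPolygon k = chainRegion s (extendIndex k) := by
    rw [fareyPolygon_eq_preimage]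
    exact Set.image_preimage_eq _ fun q => ⟨!₂[q.1, q.2], by simp [planeCoords]⟩
  have e0 : (fun p : EuclideanSpace ℝ (Fin 2) => p 0) '' fareyPolygon k
      = Prod.fst '' chainRegion s (extendIndex k) := by
    rw [← hsurj, Set.image_image]; rfl
  have e1 : (fun p : EuclideanSpace ℝ (Fin 2) => p 1) '' fareyPolygon k
      = Prod.snd '' chainRegion s (extendIndex k) := by
    rw [← hsurj, Set.image_image]; rfl
  rw [e0] at h0
  rw [e1] at h1
  rw [projectionLength]
  linarith

lemma convex_slice_fst {D : Set (ℝ × ℝ)} (hD : Convex ℝ D) (y : ℝ) :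
    {x | (x, y) ∈ D}.OrdConnected := by
  refine Convex.ordConnected ?_
  intro a ha b hb α β hα hβ hαβ
  have := hD ha hb hα hβ hαβ
  simp only [Set.mem_ofPred_eq, smul_eq_mul] at *
  convert this using 1
  ext
  · simp
  · simp [← add_mul, hαβ]

lemma convex_slice_snd {D : Set (ℝ × ℝ)} (hD : Convex ℝ D) (x : ℝ) :
    {y | (x, y) ∈ D}.OrdConnected := by
  refine Convex.ordConnected ?_
  intro a ha b hb α β hα hβ hαβ
  have := hD ha hb hα hβ hαβ
  simp only [Set.mem_ofPred_eq, smul_eq_mul] at *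
  convert this using 1
  ext
  · simp [← add_mul, hαβ]
  · simp

/-- A nonempty convex subset of the unit square lies in a box whose sides are its projections. -/
lemma exists_box {D : Set (ℝ × ℝ)} (hD : Convex ℝ D) (hne : D.Nonempty)
    (hsub : D ⊆ Set.Ioc (0 : ℝ) 1 ×ˢ Set.Ioc (0 : ℝ) 1) :
    ∃ x₀ x₁ y₀ y₁ : ℝ, x₀ ≤ x₁ ∧ y₀ ≤ y₁ ∧ D ⊆ Set.Icc x₀ x₁ ×ˢ Set.Icc y₀ y₁ ∧
      x₁ - x₀ = volume.real (Prod.fst '' D) ∧ y₁ - y₀ = volume.real (Prod.snd '' D) := by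
  have key : ∀ J : Set ℝ, Convex ℝ J → J.Nonempty → J ⊆ Set.Icc 0 1 →
      sInf J ≤ sSup J ∧ J ⊆ Set.Icc (sInf J) (sSup J) ∧ sSup J - sInf J = volume.real J := by
    intro J hJ hne hb
    have h1 := subset_Icc_csInf_csSup (bddBelow_Icc.mono hb) (bddAbove_Icc.mono hb)
    obtain ⟨x, hx⟩ := hne
    have h2 := (h1 hx).1.trans (h1 hx).2
    refine ⟨h2, h1, ?_⟩
    rw [Measure.real, hJ.ordConnected.volume_eq ⟨x, hx⟩ hb, ENNReal.toReal_ofReal (by linarith)]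
  obtain ⟨h1, h2, h3⟩ := key (Prod.fst '' D) (hD.linear_image (LinearMap.fst ℝ ℝ ℝ)) (hne.image _)
    (by rintro _ ⟨p, hp, rfl⟩; exact ⟨(hsub hp).1.1.le, (hsub hp).1.2⟩)
  obtain ⟨h4, h5, h6⟩ := key (Prod.snd '' D) (hD.linear_image (LinearMap.snd ℝ ℝ ℝ)) (hne.image _)
    (by rintro _ ⟨p, hp, rfl⟩; exact ⟨(hsub hp).2.1.le, (hsub hp).2.2⟩)
  exact ⟨_, _, _, _, h1, h4, fun p hp => ⟨h2 ⟨p, hp, rfl⟩, h5 ⟨p, hp, rfl⟩⟩, h3, h6⟩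

/-- The area of a convex subset of the unit square is at most the sum of the lengths of its
projections. -/
lemma volume_le_projectionLength {D : Set (ℝ × ℝ)} (hD : Convex ℝ D)
    (hsub : D ⊆ Set.Ioc (0 : ℝ) 1 ×ˢ Set.Ioc (0 : ℝ) 1) :
    volume.real D ≤ projectionLength D := by
  rcases D.eq_empty_or_nonempty with rfl | hne
  · simp [projectionLength]
  obtain ⟨x₀, x₁, y₀, y₁, hx, hy, hbox, hx', hy'⟩ := exists_box hD hne hsub
  have hv : volume.real D ≤ (x₁ - x₀) * (y₁ - y₀) := by
    have : volume.real D ≤ volume.real (Set.Icc x₀ x₁ ×ˢ Set.Icc y₀ y₁) :=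
      measureReal_mono hbox (isCompact_Icc.prod isCompact_Icc).measure_lt_top.ne
    refine this.trans ?_
    rw [Measure.volume_eq_prod, measureReal_prod_prod, Real.volume_real_Icc_of_le hx,
      Real.volume_real_Icc_of_le hy]
  have hx1 : x₁ - x₀ ≤ 1 := by
    rw [hx']
    have h : Prod.fst '' D ⊆ Set.Icc 0 1 := by
      rintro _ ⟨p, hp, rfl⟩; exact ⟨(hsub hp).1.1.le, (hsub hp).1.2⟩
    refine (measureReal_mono h measure_Icc_lt_top.ne).trans ?_
    simp
  rw [projectionLength, ← hx', ← hy']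
  have := mul_le_mul_of_nonneg_right hx1 (by linarith : 0 ≤ y₁ - y₀)
  linarith

/-- A chain region that contains a point of the lattice of mesh `e / Q` is not much shorter than
this mesh. -/
lemma mesh_le_of_mem_chainRegion {s : ℕ} {k : ℕ → ℤ} {Q e : ℕ} (he : 1 ≤ e) (heQ : e ≤ Q)
    {x₀ x₁ y₀ y₁ : ℝ} (hbox : chainRegion s k ⊆ Set.Icc x₀ x₁ ×ˢ Set.Icc y₀ y₁) {m n : ℤ}
    (h : ((m : ℝ) / (Q / e : ℝ), (n : ℝ) / (Q / e : ℝ)) ∈ chainRegion s k) :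
    (e / Q : ℝ) ≤ 2 * ((x₁ - x₀) + (y₁ - y₀)) := by
  have he' : (0 : ℝ) < e := by exact_mod_cast he
  have hQ' : (0 : ℝ) < Q := by exact_mod_cast he.trans heQ
  set X : ℝ := Q / e with hX
  have hX1 : 1 ≤ X := (one_le_div he').2 (by exact_mod_cast heQ)
  have hX0 : 0 < X := by linarith
  set N : ℤ := ⌊X⌋ with hN
  have hN1 : 1 ≤ N := Int.le_floor.2 (by simpa using hX1)
  have hNX : (N : ℝ) ≤ X := Int.floor_le X
  have hN1' : (1 : ℝ) ≤ N := by exact_mod_cast hN1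
  obtain ⟨hle, hgt⟩ := (div_mem_chainRegion hX0 m n).1 h
  -- The terms are integers, so the chain conditions depend on `X` only through `N`, and every
  -- dilation factor in `[N, N + 1)` is allowed.
  have hle' : ∀ i ≤ s + 1, recSeq k m n i ≤ N := fun i hi => Int.le_floor.2 (hle i hi)
  have hgt' : ∀ i ≤ s, N + 1 ≤ recSeq k m n i + recSeq k m n (i + 1) := fun i hi => by
    have h1 := hgt i hi
    have : (N : ℝ) < ((recSeq k m n i + recSeq k m n (i + 1) : ℤ) : ℝ) := by
      push_cast; linarith
    exact_mod_cast this
  have hmem : ∀ t : ℝ, N ≤ t → t < N + 1 → ((m : ℝ) / t, (n : ℝ) / t) ∈ chainRegion s k := by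
    intro t ht1 ht2
    refine (div_mem_chainRegion (by linarith) m n).2 ⟨fun i hi => ?_, fun i hi => ?_⟩
    · have : ((recSeq k m n i : ℤ) : ℝ) ≤ N := by exact_mod_cast hle' i hi
      linarith
    · have : (N : ℝ) + 1 ≤ ((recSeq k m n i : ℤ) : ℝ) + ((recSeq k m n (i + 1) : ℤ) : ℝ) := by
        exact_mod_cast hgt' i hi
      linarith
  -- Two points on one ray through the origin; their coordinate differences add up to `(m + n) / (N
  -- * (2 * N + 1))`, which is at least `1 / (2 * N)`.
  have h1 := hbox (hmem N le_rfl (by linarith))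
  have h2 := hbox (hmem (N + 1 / 2) (by linarith) (by linarith))
  have hmn : (N : ℝ) + 1 ≤ m + n := by
    have := hgt' 0 (by omega)
    simp only [recSeq] at this
    exact_mod_cast this
  have hxx : (m : ℝ) / N - m / (N + 1 / 2) ≤ x₁ - x₀ := by linarith [h1.1.2, h2.1.1]
  have hyy : (n : ℝ) / N - n / (N + 1 / 2) ≤ y₁ - y₀ := by linarith [h1.2.2, h2.2.1]
  have e1 : (m : ℝ) / N - m / (N + 1 / 2) + ((n : ℝ) / N - n / (N + 1 / 2))
      = (m + n) / (N * (2 * N + 1)) := by field_simp; ring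
  have e2 : 1 / (2 * (N : ℝ)) ≤ (m + n) / (N * (2 * N + 1)) := by
    rw [div_le_div_iff₀ (by positivity) (by positivity)]
    nlinarith
  have e3 : (e / Q : ℝ) = 1 / X := by rw [hX]; field_simp
  have e4 : 1 / X ≤ 1 / (N : ℝ) := by gcongr
  have e5 : 1 / (N : ℝ) = 2 * (1 / (2 * (N : ℝ))) := by field_simp
  rw [e3]
  linarith

/-- Primitive points in a residue class and in a dilated chain region. -/
lemma abs_ncard_primitivePoints_chainRegion_sub_le {s : ℕ} {k : ℕ → ℤ} {Q d a₀ b₀ : ℕ}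
    (hQ : 1 ≤ Q) (hd : 1 ≤ d) (hc : Nat.gcd (Nat.gcd a₀ b₀) d = 1)
    (hne : (chainRegion s k).Nonempty) :
    |((primitivePoints (chainRegion s k) Q d a₀ b₀).ncard : ℝ) -
        volume.real (chainRegion s k) * ((Q : ℝ) ^ 2 / (d : ℝ) ^ 2) *
        ∑ e ∈ (Finset.Icc 1 Q).filter (Nat.Coprime · d),
          (ArithmeticFunction.moebius e : ℝ) / (e : ℝ) ^ 2|
      ≤ 4 * projectionLength (chainRegion s k) * (Q * (1 + Real.log Q)) := by
  have hconv := convex_chainRegion s k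
  have hsub := chainRegion_subset s k
  have hQ' : (0 : ℝ) < Q := by exact_mod_cast hQ
  have hd' : (1 : ℝ) ≤ d := by exact_mod_cast hd
  have hd0 : (0 : ℝ) < d := by linarith
  obtain ⟨x₀, x₁, y₀, y₁, hx, hy, hbox, hx', hy'⟩ := exists_box hconv hne hsub
  refine abs_ncard_primitivePoints_sub_le hsub hQ hd hc fun e he heQ A B hA hB => ?_
  have he' : (0 : ℝ) < e := by exact_mod_cast he
  have ht : (0 : ℝ) < e * d / Q := by positivity
  have hw : 0 ≤ (x₁ - x₀) + (y₁ - y₀) := by linarith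
  -- The lattice in use has mesh `d` times `e / Q`, whence `κ = 2 * d`; dividing by the mesh cancels
  -- this `d`, and the final constant `4` comes from `(2 + 2 * d) / d ≤ 4`.
  refine (abs_ncard_lattice_sub_le_of_mesh (κ := 2 * d) (measurableSet_chainRegion s k)
    (convex_slice_fst hconv) (convex_slice_snd hconv) _ _ ht hx hy (by positivity) hbox ?_).trans ?_
  · rintro ⟨⟨i, j⟩, hij⟩
    obtain ⟨A', rfl⟩ := hA
    obtain ⟨B', rfl⟩ := hB
    have e1 : ∀ A' i : ℤ, (((e : ℤ) * A' : ℤ) : ℝ) / Q + e * d / Q * i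
        = ((A' + d * i : ℤ) : ℝ) / (Q / e : ℝ) := by
      intro A' i; push_cast; field_simp
    simp only at hij
    rw [e1, e1] at hij
    have := mesh_le_of_mem_chainRegion he heQ hbox hij
    have e2 : (e * d / Q : ℝ) = d * (e / Q) := by ring
    rw [e2]
    nlinarith
  · rw [projectionLength, ← hx', ← hy']
    have e3 : (2 + 2 * (d : ℝ)) * ((x₁ - x₀) + (y₁ - y₀)) / (e * d / Q)
        = ((2 + 2 * d) / d) * ((x₁ - x₀) + (y₁ - y₀)) * (Q / e) := by field_simp
    rw [e3]
    gcongr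
    rw [div_le_iff₀ hd0]; linarith

lemma volume_measurable_convex_halfSquare : volume.real halfSquare = 1 / 2 ∧ MeasurableSet halfSquare ∧
    Convex ℝ halfSquare := by
  have hm : MeasurableSet halfSquare := by
    have : halfSquare = {p : ℝ × ℝ | 0 < p.1} ∩ ({p : ℝ × ℝ | p.1 ≤ p.2} ∩ {p | p.2 ≤ 1}) := rfl
    rw [this]
    exact (measurableSet_lt measurable_const measurable_fst).inter
      ((measurableSet_le measurable_fst measurable_snd).inter
        (measurableSet_le measurable_snd measurable_const))
  refine ⟨?_, hm, ?_⟩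
  · have h1 : ∀ y : ℝ, volume ((fun x : ℝ => (x, y)) ⁻¹' halfSquare)
        = (Set.Ioc (0 : ℝ) 1).indicator (fun y => ENNReal.ofReal y) y := by
      intro y
      by_cases hy : y ∈ Set.Ioc (0 : ℝ) 1
      · rw [Set.indicator_of_mem hy]
        have : (fun x : ℝ => (x, y)) ⁻¹' halfSquare = Set.Ioc 0 y := by
          ext x
          simp only [halfSquare, Set.mem_preimage, Set.mem_ofPred_eq, Set.mem_Ioc]
          exact ⟨fun h => ⟨h.1, h.2.1⟩, fun h => ⟨h.1, h.2, hy.2⟩⟩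
        rw [this, Real.volume_Ioc, sub_zero]
      · rw [Set.indicator_of_notMem hy]
        have : (fun x : ℝ => (x, y)) ⁻¹' halfSquare = ∅ := by
          refine Set.eq_empty_of_forall_notMem ?_
          rintro x ⟨h1, h2, h3⟩
          exact hy ⟨lt_of_lt_of_le h1 h2, h3⟩
        rw [this, measure_empty]
    have h2 : volume halfSquare = ENNReal.ofReal (1 / 2) := by
      rw [Measure.volume_eq_prod, Measure.prod_apply_symm hm]
      simp_rw [h1]
      rw [lintegral_indicator measurableSet_Ioc, ← ofReal_integral_eq_lintegral_ofReal]
      · rw [← intervalIntegral.integral_of_le zero_le_one, integral_id]; norm_num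
      · exact (continuous_id.integrableOn_Icc (a := (0 : ℝ)) (b := 1)).mono_set
          Set.Ioc_subset_Icc_self
      · exact (ae_restrict_mem measurableSet_Ioc).mono fun y hy => hy.1.le
    rw [Measure.real, h2, ENNReal.toReal_ofReal (by norm_num)]
  · rintro ⟨x, y⟩ ⟨h1, h2, h3⟩ ⟨x', y'⟩ ⟨h1', h2', h3'⟩ α β hα hβ hαβ
    simp only at h1 h2 h3 h1' h2' h3'
    refine ⟨?_, ?_, ?_⟩
    · simp only [Prod.smul_mk, Prod.mk_add_mk, smul_eq_mul]
      rcases hα.eq_or_lt with rfl | hα'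
      · have : β = 1 := by linarith
        subst this; linarith
      · have := mul_pos hα' h1
        have := mul_nonneg hβ h1'.le
        linarith
    · simp only [Prod.smul_mk, Prod.mk_add_mk, smul_eq_mul]
      gcongr
    · simp only [Prod.smul_mk, Prod.mk_add_mk, smul_eq_mul]
      have := mul_le_mul_of_nonneg_left h3 hα
      have := mul_le_mul_of_nonneg_left h3' hβ
      linarith

/-- The number of Farey fractions. -/
lemma abs_ncard_fareySet_sub_le {Q : ℕ} (hQ : 1 ≤ Q) :
    |((fareySet Q).ncard : ℝ) - (Q : ℝ) ^ 2 / 2 * ∑ e ∈ (Finset.Icc 1 Q).filter (Nat.Coprime · 1),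
        (ArithmeticFunction.moebius e : ℝ) / (e : ℝ) ^ 2| ≤ 7 * (Q * (1 + Real.log Q)) := by
  obtain ⟨hv, hm, hconv⟩ := volume_measurable_convex_halfSquare
  have hQ' : (1 : ℝ) ≤ Q := by exact_mod_cast hQ
  have hQ0 : (0 : ℝ) < Q := by linarith
  have hsub : halfSquare ⊆ Set.Ioc (0 : ℝ) 1 ×ˢ Set.Ioc (0 : ℝ) 1 := by
    rintro ⟨x, y⟩ ⟨h1, h2, h3⟩
    exact ⟨⟨h1, h2.trans h3⟩, lt_of_lt_of_le h1 h2, h3⟩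
  have hbox : halfSquare ⊆ Set.Icc (0 : ℝ) 1 ×ˢ Set.Icc (0 : ℝ) 1 := fun p hp =>
    ⟨⟨(hsub hp).1.1.le, (hsub hp).1.2⟩, (hsub hp).2.1.le, (hsub hp).2.2⟩
  have key := abs_ncard_primitivePoints_sub_le (d := 1) (a₀ := 0) (b₀ := 0) (W := 6) hsub hQ le_rfl
    (by simp) (fun e he heQ A B _ _ => by
      have he' : (0 : ℝ) < e := by exact_mod_cast he
      have heQ' : (e : ℝ) ≤ Q := by exact_mod_cast heQ
      have ht : (0 : ℝ) < e * (1 : ℕ) / Q := by simp only [Nat.cast_one, mul_one]; positivity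
      refine (abs_ncard_lattice_sub_le_of_mesh (κ := 1) hm (convex_slice_fst hconv)
        (convex_slice_snd hconv) _ _ ht zero_le_one zero_le_one zero_le_one hbox ?_).trans ?_
      · intro _
        have : (e : ℝ) / Q ≤ 1 := (div_le_one hQ0).2 heQ'
        simp only [Nat.cast_one, mul_one]
        linarith
      · apply le_of_eq
        simp only [Nat.cast_one, mul_one]
        field_simp
        norm_num)
  rw [hv] at key
  rw [ncard_fareySet hQ]
  push_cast at key ⊢
  have hlog : 0 ≤ Real.log Q := Real.log_nonneg hQ'
  have h1 : 1 ≤ (Q : ℝ) * (1 + Real.log Q) := by nlinarith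
  have e : ∀ S : ℝ, (1 / 2 : ℝ) * ((Q : ℝ) ^ 2 / 1 ^ 2) * S = (Q : ℝ) ^ 2 / 2 * S := fun S => by ring
  rw [e] at key
  rw [abs_le] at key ⊢
  constructor <;> linarith [key.1, key.2]

/-! ### Decomposition of the generators according to their coefficients -/

section Decomposition

variable {r : ℕ} {c : Fin r → ℕ} {d : ℕ}

lemma hasLatticePoint_of_mem {s Q : ℕ} (hQ : 1 ≤ Q) {k : Fin s → ℕ}
    (h : ∃ m n : ℤ, ((m : ℝ) / Q, (n : ℝ) / Q) ∈ chainRegion s (extendIndex k)) :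
    HasLatticePoint (closure ((Q : ℝ) • fareyPolygon k)) := by
  obtain ⟨m, n, h⟩ := h
  have hQ' : (Q : ℝ) ≠ 0 := by positivity
  refine ⟨m, n, subset_closure ⟨!₂[(m : ℝ) / Q, (n : ℝ) / Q], (mem_fareyPolygon_iff k _).2 ?_, ?_⟩⟩
  · simpa using h
  · ext i
    fin_cases i
    · simp; field_simp
    · simp; field_simp

/-- On the closure the chain inequalities hold weakly. Integrality forces the middle term to be at
least `1`, and then `k j` is at most the sum of its two neighbours. -/
lemma le_two_mul_of_hasLatticePoint {s Q : ℕ} (hQ : 1 ≤ Q) {k : Fin s → ℕ}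
    (h : HasLatticePoint (closure ((Q : ℝ) • fareyPolygon k))) (j : Fin s) : k j ≤ 2 * Q := by
  obtain ⟨m, n, hmn⟩ := h
  set K := extendIndex k with hK
  have hc : ∀ i, Continuous fun p : EuclideanSpace ℝ (Fin 2) => recSeq K (p 0) (p 1) i :=
    fun i => (continuous_recSeq K i).comp continuous_planeCoords
  have hQ0 : (0 : ℝ) < Q := by exact_mod_cast hQ
  have hscale : ∀ q ∈ fareyPolygon k, ∀ i, recSeq K (((Q : ℝ) • q) 0) (((Q : ℝ) • q) 1) i
      = Q * recSeq K (q 0) (q 1) i := fun q _ i => by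
    rw [← recSeq_mul]; simp
  have hle : ∀ i ≤ s + 1, recSeq K m n i ≤ Q := fun i hi => by
    have hcl : IsClosed {p : EuclideanSpace ℝ (Fin 2) | recSeq K (p 0) (p 1) i ≤ Q} :=
      isClosed_le (hc i) continuous_const
    have := closure_minimal (s := (Q : ℝ) • fareyPolygon k) (by
      rintro _ ⟨q, hq, rfl⟩
      simp only [Set.mem_ofPred_eq]
      rw [hscale q hq]
      have : Q * recSeq K (q 0) (q 1) i ≤ Q * 1 :=
        mul_le_mul_of_nonneg_left (((mem_fareyPolygon_iff k q).1 hq).1 i hi) hQ0.le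
      linarith) hcl hmn
    have h' : ((recSeq K m n i : ℤ) : ℝ) ≤ ((Q : ℤ) : ℝ) := by
      rw [recSeq_intCast, Int.cast_natCast]; simpa using this
    exact_mod_cast h'
  have hge : ∀ i ≤ s, (Q : ℤ) ≤ recSeq K m n i + recSeq K m n (i + 1) := fun i hi => by
    have hcl : IsClosed {p : EuclideanSpace ℝ (Fin 2) |
        (Q : ℝ) ≤ recSeq K (p 0) (p 1) i + recSeq K (p 0) (p 1) (i + 1)} :=
      isClosed_le continuous_const ((hc i).add (hc (i + 1)))
    have := closure_minimal (s := (Q : ℝ) • fareyPolygon k) (by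
      rintro _ ⟨q, hq, rfl⟩
      simp only [Set.mem_ofPred_eq]
      rw [hscale q hq, hscale q hq]
      have : Q * 1 < Q * (recSeq K (q 0) (q 1) i + recSeq K (q 0) (q 1) (i + 1)) :=
        mul_lt_mul_of_pos_left (((mem_fareyPolygon_iff k q).1 hq).2 i hi) hQ0
      linarith) hcl hmn
    have h' : ((Q : ℤ) : ℝ) ≤ ((recSeq K m n i + recSeq K m n (i + 1) : ℤ) : ℝ) := by
      rw [Int.cast_add, recSeq_intCast, recSeq_intCast, Int.cast_natCast]; simpa using this
    exact_mod_cast h'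
  have h1 := hle j (by omega)
  have h2 := hle (j + 1) (by omega)
  have h3 := hle (j + 2) (by omega)
  have h4 := hge j (by omega)
  have h5 := hge (j + 1) (by omega)
  have hrec : recSeq K m n (j + 2) = (k j : ℤ) * recSeq K m n (j + 1) - recSeq K m n j := by
    simp only [recSeq, hK, extendIndex_apply, Int.cast_id]
  have hQ1 : (1 : ℤ) ≤ Q := by exact_mod_cast hQ
  rw [show (j : ℕ) + 1 + 1 = j + 2 from rfl] at h5
  have hk0 : (0 : ℤ) ≤ k j := Int.natCast_nonneg _
  have hpos : 1 ≤ recSeq K m n (j + 1) := by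
    by_contra hcon; push Not at hcon
    have : ((k j : ℤ) + 1) * recSeq K m n (j + 1) ≤ 0 :=
      mul_nonpos_of_nonneg_of_nonpos (by omega) (by omega)
    nlinarith
  have := mul_le_mul_of_nonneg_left hpos hk0
  have h6 : (k j : ℤ) ≤ 2 * Q := by linarith
  exact_mod_cast h6

lemma finite_relevantVectors (Q r : ℕ) (hQ : 1 ≤ Q) (c : Fin r → ℕ) (d : ℕ) :
    (relevantVectors Q r c d).Finite :=
  (Set.Finite.pi' fun _ : Fin (r - 2) => Set.finite_Iic (2 * Q)).subset fun _ hk j =>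
    le_two_mul_of_hasLatticePoint hQ hk.2 j

lemma chainRegion_nonempty_of_mem {k : Fin (r - 2) → ℕ} (hk : k ∈ admissibleCongruent r c d) :
    (chainRegion (r - 2) (extendIndex k)).Nonempty := by
  obtain ⟨Q, a, b, hQ, hab, hj⟩ := hk.1
  exact ⟨_, (genIndex_iff_mem_chainRegion (extendIndex k) hQ a b).1 ⟨⟨hab.1, hab.2.1, hab.2.2.1⟩,
    fun j hjs => by rw [extendIndex_of_lt k hjs]; exact hj ⟨j, hjs⟩⟩⟩

variable (hr : 2 ≤ r)

include hr

lemma gcd_eq_one_of_mem {k : Fin (r - 2) → ℕ} (hk : k ∈ admissibleCongruent r c d) :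
    Nat.gcd (Nat.gcd (c ⟨0, by omega⟩) (c ⟨1, by omega⟩)) d = 1 := by
  obtain ⟨-, Q, a, b, hQ, hab, -, hc⟩ := hk
  have ha : a ≡ c ⟨0, by omega⟩ [MOD d] := Int.natCast_modEq_iff.1 (hc ⟨0, by omega⟩)
  have hb : b ≡ c ⟨1, by omega⟩ [MOD d] := Int.natCast_modEq_iff.1 (hc ⟨1, by omega⟩)
  by_contra hne
  obtain ⟨p, hp, hpd⟩ := Nat.exists_prime_and_dvd hne
  obtain ⟨h1, h2⟩ := Nat.dvd_gcd_iff.1 hpd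
  obtain ⟨h3, h4⟩ := Nat.dvd_gcd_iff.1 h1
  have h5 : p ∣ a := ((ha.of_dvd h2).dvd_iff dvd_rfl).2 h3
  have h6 : p ∣ b := ((hb.of_dvd h2).dvd_iff dvd_rfl).2 h4
  have := Nat.dvd_gcd h5 h6
  rw [hab.2.2.2] at this
  exact hp.one_lt.ne' (Nat.dvd_one.1 this)

lemma congruentGenerators_eq_iUnion {Q : ℕ} (hQ : 1 ≤ Q) :
    congruentGenerators Q r c d = ⋃ k ∈ relevantVectors Q r c d,
      primitivePoints (chainRegion (r - 2) (extendIndex k)) Q d (c ⟨0, by omega⟩)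
        (c ⟨1, by omega⟩) := by
  ext ⟨a, b⟩
  simp only [Set.mem_iUnion, exists_prop]
  constructor
  · rintro ⟨hab, hc⟩
    have hchain := (genDenominator_chain_iff (s := r - 2) (genIndex Q a b) Q a b).1
      ⟨⟨hab.1, hab.2.1, hab.2.2.1⟩, fun _ _ => rfl⟩
    have hpos : ∀ i ≤ r - 2 + 1, 0 < genDenominator Q a b i := fun i hi => by
      rw [genDenominator_eq_recSeq (s := r - 2) (k := genIndex Q a b) (fun _ _ => rfl) i hi]
      exact hchain.pos hi
    have hnn : ∀ j < r - 2, 0 ≤ genIndex Q a b j := fun j hj => by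
      have h1 := hpos j (by omega)
      have h2 := hpos (j + 1) (by omega)
      exact Int.ediv_nonneg (by positivity) h2.le
    let k : Fin (r - 2) → ℕ := fun j => (genIndex Q a b j).toNat
    have hk : ∀ j : Fin (r - 2), genIndex Q a b j = (k j : ℤ) := fun j =>
      (Int.toNat_of_nonneg (hnn j j.2)).symm
    have hmem : ((a : ℝ) / Q, (b : ℝ) / Q) ∈ chainRegion (r - 2) (extendIndex k) :=
      (genIndex_iff_mem_chainRegion (extendIndex k) hQ a b).1
        ⟨⟨hab.1, hab.2.1, hab.2.2.1⟩, fun j hjs => by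
          rw [extendIndex_of_lt k hjs]; exact hk ⟨j, hjs⟩⟩
    refine ⟨k, ⟨⟨⟨Q, a, b, hQ, hab, hk⟩, Q, a, b, hQ, hab, hk, hc⟩,
      hasLatticePoint_of_mem hQ ⟨a, b, by simpa using hmem⟩⟩, ⟨?_, ?_, hmem⟩, hab.2.2.2⟩
    · exact Int.natCast_modEq_iff.1 (hc ⟨0, by omega⟩)
    · exact Int.natCast_modEq_iff.1 (hc ⟨1, by omega⟩)
  · rintro ⟨k, hk, ⟨ha, hb, hmem⟩, hcop⟩
    obtain ⟨-, Q', a', b', hQ', hab', hk', hc'⟩ := hk.1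
    obtain ⟨⟨h1, h2, h3⟩, hidx⟩ := (genIndex_iff_mem_chainRegion (extendIndex k) hQ a b).2 hmem
    have ha' : a' ≡ c ⟨0, by omega⟩ [MOD d] := Int.natCast_modEq_iff.1 (hc' ⟨0, by omega⟩)
    have hb' : b' ≡ c ⟨1, by omega⟩ [MOD d] := Int.natCast_modEq_iff.1 (hc' ⟨1, by omega⟩)
    refine ⟨⟨h1, h2, h3, hcop⟩, fun j => ?_⟩
    have hj : (j : ℕ) ≤ r - 2 + 1 := by omega
    have hidx' : ∀ j < r - 2, genIndex Q' a' b' j = extendIndex k j := fun j hjs => by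
      rw [extendIndex_of_lt k hjs]; exact hk' ⟨j, hjs⟩
    -- Both generators follow the linear recursion with coefficients `k` and agree modulo `d` in
    -- their first two terms, so the congruences of the witness transfer to `(a, b)`.
    rw [genDenominator_eq_recSeq hidx j hj]
    refine Int.ModEq.trans ?_ (hc' j)
    rw [genDenominator_eq_recSeq hidx' j hj]
    exact recSeq_modEq _ (Int.natCast_modEq_iff.2 (ha.trans ha'.symm))
      (Int.natCast_modEq_iff.2 (hb.trans hb'.symm)) j

lemma ncard_congruentGenerators {Q : ℕ} (hQ : 1 ≤ Q) :
    (congruentGenerators Q r c d).ncard = ∑ k ∈ (finite_relevantVectors Q r hQ c d).toFinset,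
      (primitivePoints (chainRegion (r - 2) (extendIndex k)) Q d (c ⟨0, by omega⟩)
        (c ⟨1, by omega⟩)).ncard := by
  classical
  have hfin : ∀ k : Fin (r - 2) → ℕ, (primitivePoints (chainRegion (r - 2) (extendIndex k)) Q d
      (c ⟨0, by omega⟩) (c ⟨1, by omega⟩)).Finite := fun k =>
    (finite_residuePoints (chainRegion_subset _ _) hQ _ _ _).subset fun p hp => hp.1
  have e : congruentGenerators Q r c d = (((finite_relevantVectors Q r hQ c d).toFinset.biUnion
      fun k => (hfin k).toFinset : Finset (ℕ × ℕ)) : Set (ℕ × ℕ)) := by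
    rw [congruentGenerators_eq_iUnion hr hQ]
    ext p
    simp
  rw [e, Set.ncard_coe_finset, Finset.card_biUnion]
  · exact Finset.sum_congr rfl fun k _ => (Set.ncard_eq_toFinset_card _ (hfin k)).symm
  · intro k _ k' _ hkk'
    rw [Function.onFun, Finset.disjoint_left]
    intro p hp hp'
    rw [Set.Finite.mem_toFinset] at hp hp'
    refine hkk' (funext fun j => ?_)
    have := eq_of_mem_chainRegion hp.1.2.2 hp'.1.2.2 j j.2
    rw [extendIndex_apply, extendIndex_apply] at this
    exact_mod_cast this

end Decomposition

/-! ### Areas -/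

lemma disjoint_chainRegion {s : ℕ} {k k' : Fin s → ℕ} (h : k ≠ k') :
    Disjoint (chainRegion s (extendIndex k)) (chainRegion s (extendIndex k')) := by
  rw [Set.disjoint_left]
  intro p hp hp'
  refine h (funext fun j => ?_)
  have := eq_of_mem_chainRegion hp hp' j j.2
  rw [extendIndex_apply, extendIndex_apply] at this
  exact_mod_cast this

/-- The regions are disjoint and measurable inside the unit square, so countable additivity gives
convergence for any index set. -/
lemma hasSum_volume_chainRegion {s : ℕ} (I : Set (Fin s → ℕ)) :
    HasSum (fun k : I => volume.real (chainRegion s (extendIndex k.1)))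
      (volume.real (⋃ k ∈ I, chainRegion s (extendIndex k))) := by
  have hU : volume (⋃ k ∈ I, chainRegion s (extendIndex k))
      = ∑' k : I, volume (chainRegion s (extendIndex k.1)) := by
    rw [Set.biUnion_eq_iUnion]
    refine measure_iUnion (fun k k' hkk' => disjoint_chainRegion fun h => hkk' (Subtype.ext h))
      fun k => measurableSet_chainRegion _ _
  have hfin : volume (⋃ k ∈ I, chainRegion s (extendIndex k)) ≠ ⊤ := by
    refine ((measure_mono (Set.iUnion₂_subset fun k _ => ?_)).trans_lt
      (isCompact_Icc.prod isCompact_Icc : IsCompact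
        (Set.Icc (0 : ℝ) 1 ×ˢ Set.Icc (0 : ℝ) 1)).measure_lt_top).ne
    exact (chainRegion_subset _ _).trans
      (Set.prod_mono Set.Ioc_subset_Icc_self Set.Ioc_subset_Icc_self)
  rw [hU] at hfin
  have := ENNReal.hasSum_toReal hfin
  rw [Measure.real, hU]
  rw [ENNReal.tsum_toReal_eq (ENNReal.ne_top_of_tsum_ne_top hfin)]
  exact this

lemma sum_volume_chainRegion {s : ℕ} {I : Set (Fin s → ℕ)} (hI : I.Finite) :
    ∑ k ∈ hI.toFinset, volume.real (chainRegion s (extendIndex k))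
      = volume.real (⋃ k ∈ I, chainRegion s (extendIndex k)) := by
  rw [← (hasSum_volume_chainRegion I).tsum_eq, ← Finset.tsum_subtype']
  have : (hI.toFinset : Set (Fin s → ℕ)) = I := hI.coe_toFinset
  rw [this]

/-- The area of the regions without lattice points is `O(1 / Q)`. -/
lemma eventually_area_tail_le (r : ℕ) (c : Fin r → ℕ) (d : ℕ) :
    ∀ᶠ Q : ℕ in Filter.atTop, ∀ hQ : 1 ≤ Q,
      0 ≤ ∑' k : admissibleCongruent r c d, planeArea (fareyPolygon k.1) -
        ∑ k ∈ (finite_relevantVectors Q r hQ c d).toFinset, planeArea (fareyPolygon k) ∧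
      ∑' k : admissibleCongruent r c d, planeArea (fareyPolygon k.1) -
        ∑ k ∈ (finite_relevantVectors Q r hQ c d).toFinset, planeArea (fareyPolygon k) ≤
        8 * ((r - 2 : ℕ) + 1 : ℝ) ^ 2 / Q := by
  filter_upwards [eventually_large_coeff_of_no_lattice (r - 2)] with Q hlarge hQ
  set s := r - 2
  have hQ0 : (0 : ℝ) < Q := by exact_mod_cast hQ
  simp_rw [planeArea_fareyPolygon]
  rw [(hasSum_volume_chainRegion _).tsum_eq, sum_volume_chainRegion]
  set K := admissibleCongruent r c d
  set R := relevantVectors Q r c d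
  have hRK : R ⊆ K := fun k hk => hk.1
  have hsq : MeasurableSet (⋃ k ∈ K \ R, chainRegion s (extendIndex k)) :=
    MeasurableSet.biUnion (Set.to_countable _) fun k _ => measurableSet_chainRegion _ _
  have hfin : ∀ I : Set (Fin s → ℕ), volume (⋃ k ∈ I, chainRegion s (extendIndex k)) ≠ ⊤ := by
    intro I
    refine ((measure_mono (Set.iUnion₂_subset fun k _ => ?_)).trans_lt
      (isCompact_Icc.prod isCompact_Icc : IsCompact
        (Set.Icc (0 : ℝ) 1 ×ˢ Set.Icc (0 : ℝ) 1)).measure_lt_top).ne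
    exact (chainRegion_subset _ _).trans
      (Set.prod_mono Set.Ioc_subset_Icc_self Set.Ioc_subset_Icc_self)
  have hsplit : volume.real (⋃ k ∈ K, chainRegion s (extendIndex k))
      = volume.real (⋃ k ∈ R, chainRegion s (extendIndex k))
        + volume.real (⋃ k ∈ K \ R, chainRegion s (extendIndex k)) := by
    rw [← measureReal_union _ hsq (hfin _) (hfin _)]
    · rw [← Set.biUnion_union, Set.union_sdiff_cancel hRK]
    · rw [Set.disjoint_left]
      intro p hp hp'
      simp only [Set.mem_iUnion, exists_prop] at hp hp'
      obtain ⟨k, hk, hpk⟩ := hp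
      obtain ⟨k', hk', hpk'⟩ := hp'
      have : k ≠ k' := fun h => hk'.2 (h ▸ hk)
      exact Set.disjoint_left.1 (disjoint_chainRegion this) hpk hpk'
  rw [hsplit, add_sub_cancel_left]
  refine ⟨measureReal_nonneg, ?_⟩
  set η : ℝ := 2 * (s + 1) / Real.sqrt Q
  have hη : 0 ≤ η := by positivity
  have hsub : (⋃ k ∈ K \ R, chainRegion s (extendIndex k)) ⊆
      Set.Icc (1 - η) 1 ×ˢ (Set.Icc (1 - η) 1 ∪ Set.Icc 0 η) := by
    refine Set.iUnion₂_subset fun k hk => ?_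
    obtain ⟨j, hj1, hj2⟩ := hlarge k (chainRegion_nonempty_of_mem hk.1)
      fun h => hk.2 ⟨hk.1, hasLatticePoint_of_mem hQ h⟩
    exact chainRegion_subset_corners hQ hj1 hj2
  have h1 : volume.real (⋃ k ∈ K \ R, chainRegion s (extendIndex k)) ≤ 2 * η ^ 2 := by
    refine ENNReal.toReal_le_of_le_ofReal (by positivity) ?_
    exact (measure_mono hsub).trans (volume_corners_le hη)
  refine h1.trans (le_of_eq ?_)
  simp only [η]
  rw [div_pow, Real.sq_sqrt hQ0.le]
  ring

/-! ### The sum of the perimeters -/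

lemma planePerimeter_nonneg (S : Set (EuclideanSpace ℝ (Fin 2))) : 0 ≤ planePerimeter S :=
  ENNReal.toReal_nonneg

lemma planeArea_le_planePerimeter {s : ℕ} (k : Fin s → ℕ) :
    planeArea (fareyPolygon k) ≤ 2 * planePerimeter (fareyPolygon k) := by
  rw [planeArea_fareyPolygon]
  exact (volume_le_projectionLength (convex_chainRegion _ _) (chainRegion_subset _ _)).trans
    (projectionLength_le_planePerimeter k)

lemma perimeterSum_eq (Q r : ℕ) (hQ : 1 ≤ Q) (c : Fin r → ℕ) (d : ℕ) :
    perimeterSum Q r c d = ∑ k ∈ (finite_relevantVectors Q r hQ c d).toFinset,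
      planePerimeter (fareyPolygon k) :=
  finsum_mem_eq_finite_toFinset_sum _ _

/-- A single admissible polygon has positive perimeter and is relevant for all large `Q`. The bound
depends on `r` and `c`, so it may influence `Q₀` but not the implied constant. -/
lemma eventually_le_perimeterSum {r : ℕ} {c : Fin r → ℕ} {d : ℕ}
    (hne : (admissibleCongruent r c d).Nonempty) :
    ∃ P > 0, ∀ᶠ Q : ℕ in Filter.atTop, P ≤ perimeterSum Q r c d := by
  obtain ⟨k, hk⟩ := hne
  obtain ⟨p, ε, hε, hball⟩ := exists_ball_subset_chainRegion (chainRegion_nonempty_of_mem hk)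
  refine ⟨planePerimeter (fareyPolygon k), ?_, ?_⟩
  · have h1 : 0 < planeArea (fareyPolygon k) := by
      rw [planeArea_fareyPolygon]
      have hfin : volume (chainRegion (r - 2) (extendIndex k)) ≠ ⊤ :=
        ((measure_mono ((chainRegion_subset _ _).trans
          (Set.prod_mono Set.Ioc_subset_Icc_self Set.Ioc_subset_Icc_self))).trans_lt
          (isCompact_Icc.prod isCompact_Icc).measure_lt_top).ne
      exact ENNReal.toReal_pos ((Metric.measure_ball_pos volume p hε).trans_le
        (measure_mono hball)).ne' hfin
    have h2 := planeArea_le_planePerimeter k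
    linarith
  · filter_upwards [eventually_exists_lattice hε hball, Filter.eventually_ge_atTop 1] with Q hQ hQ1
    rw [perimeterSum_eq Q r hQ1]
    refine Finset.single_le_sum (f := fun k => planePerimeter (fareyPolygon k))
      (fun _ _ => planePerimeter_nonneg _) ?_
    rw [Set.Finite.mem_toFinset]
    exact ⟨hk, hasLatticePoint_of_mem hQ1 hQ⟩

lemma abs_ncard_congruentGenerators_sub_le {r : ℕ} {c : Fin r → ℕ} {d : ℕ} (hr : 2 ≤ r)
    (hd : 1 ≤ d) {Q : ℕ} (hQ : 1 ≤ Q) :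
    |((congruentGenerators Q r c d).ncard : ℝ) -
      (∑ k ∈ (finite_relevantVectors Q r hQ c d).toFinset, planeArea (fareyPolygon k)) *
        ((Q : ℝ) ^ 2 / (d : ℝ) ^ 2) * ∑ e ∈ (Finset.Icc 1 Q).filter (Nat.Coprime · d),
          (ArithmeticFunction.moebius e : ℝ) / (e : ℝ) ^ 2| ≤
      8 * perimeterSum Q r c d * (Q * (1 + Real.log Q)) := by
  have hT : 0 ≤ (Q : ℝ) * (1 + Real.log Q) := by
    have : 0 ≤ Real.log Q := Real.log_nonneg (by exact_mod_cast hQ)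
    positivity
  rw [ncard_congruentGenerators hr hQ, perimeterSum_eq Q r hQ, Nat.cast_sum, Finset.sum_mul,
    Finset.sum_mul, ← Finset.sum_sub_distrib, Finset.mul_sum, Finset.sum_mul]
  refine (Finset.abs_sum_le_sum_abs _ _).trans (Finset.sum_le_sum fun k hk => ?_)
  rw [Set.Finite.mem_toFinset] at hk
  rw [planeArea_fareyPolygon]
  refine (abs_ncard_primitivePoints_chainRegion_sub_le hQ hd (gcd_eq_one_of_mem hr hk.1)
    (chainRegion_nonempty_of_mem hk.1)).trans ?_
  have := projectionLength_le_planePerimeter k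
  exact mul_le_mul_of_nonneg_right (by linarith) hT

/-! ### The asymptotic formula -/

lemma eventually_le_mul_log (A : ℝ) {B : ℝ} (hB : 0 < B) :
    ∀ᶠ Q : ℕ in Filter.atTop, A ≤ B * Real.log Q := by
  have h : Filter.Tendsto (fun Q : ℕ => Real.log Q) Filter.atTop Filter.atTop :=
    Real.tendsto_log_atTop.comp tendsto_natCast_atTop_atTop
  filter_upwards [h.eventually_ge_atTop (A / B)] with Q hQ
  rw [div_le_iff₀ hB] at hQ
  linarith

lemma eventually_log_le_mul {B : ℝ} (hB : 0 < B) :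
    ∀ᶠ Q : ℕ in Filter.atTop, Real.log Q ≤ B * Q := by
  have h := (Real.isLittleO_log_id_atTop.comp_tendsto
    tendsto_natCast_atTop_atTop).def hB
  filter_upwards [h] with Q hQ
  simp only [Function.comp, id, Real.norm_eq_abs, Nat.abs_cast] at hQ
  exact (le_abs_self _).trans hQ

/-- The quotient of two quantities with known main terms. -/
lemma abs_div_sub_le {N F S q m D κ E E' : ℝ} (hκ : 0 ≤ κ) (hS : 0 ≤ S) (hq : 0 < q) (hm : 0 < m)
    (hκm : κ * (m / 2) = D) (hN : |N - S * q * D| ≤ E) (hF : |F - q * m / 2| ≤ E')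
    (hE' : E' ≤ q * m / 4) :
    |N / F - κ * S| ≤ 4 / m * (E + κ * S * E') / q := by
  have hF' : q * m / 4 ≤ F := by
    have := (abs_le.1 hF).1
    linarith
  have hq0 : 0 < q * m / 4 := by positivity
  have hF0 : 0 < F := hq0.trans_le hF'
  have e : N / F - κ * S = ((N - S * q * D) - κ * S * (F - q * m / 2)) / F := by
    rw [← hκm]; field_simp; ring
  have hEnn : 0 ≤ E := (abs_nonneg _).trans hN
  have hE'nn : 0 ≤ E' := (abs_nonneg _).trans hF
  rw [e, abs_div, abs_of_pos hF0]
  calc _ ≤ (E + κ * S * E') / F := by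
        gcongr
        refine (abs_sub _ _).trans (add_le_add hN ?_)
        rw [abs_mul, abs_of_nonneg (mul_nonneg hκ hS)]
        gcongr
    _ ≤ (E + κ * S * E') / (q * m / 4) := by gcongr
    _ = _ := by field_simp

/-- The number of congruent tuples of denominators, up to the error term. -/
lemma eventually_abs_ncard_sub_le {r : ℕ} (hr : 2 ≤ r) {c : Fin r → ℕ} {d : ℕ} (hd : 1 ≤ d)
    (hne : (admissibleCongruent r c d).Nonempty) :
    ∀ᶠ Q : ℕ in Filter.atTop,
      |((congruentDenominators Q r c d).ncard : ℝ) -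
        (∑' k : admissibleCongruent r c d, planeArea (fareyPolygon k.1)) * (Q : ℝ) ^ 2 *
          ((∑' n, moebiusTerm d n) / (d : ℝ) ^ 2)| ≤
        20 * perimeterSum Q r c d * (Q * Real.log Q) ∧
      ∑' k : admissibleCongruent r c d, planeArea (fareyPolygon k.1) ≤
        3 * perimeterSum Q r c d := by
  obtain ⟨P, hP, hPL⟩ := eventually_le_perimeterSum hne
  set S := ∑' k : admissibleCongruent r c d, planeArea (fareyPolygon k.1) with hS
  set M := ∑' n, moebiusTerm d n with hM
  set B : ℝ := 8 * ((r - 2 : ℕ) + 1 : ℝ) ^ 2 with hB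
  have hB0 : 0 ≤ B := by positivity
  -- Every quantity depending on `r`, `c` or `P` is made smaller than `perimeterSum` or its product
  -- with `log Q` here; the four approximations below then cost `1 + 16 + 2 + 1 = 20`.
  filter_upwards [hPL, eventually_area_tail_le r c d, Filter.eventually_ge_atTop 1,
    eventually_le_mul_log 1 one_pos, eventually_le_mul_log (B * |M|) hP,
    eventually_le_mul_log r hP,
    tendsto_natCast_atTop_atTop.eventually_ge_atTop (B / P)] with Q hL htail hQ hlog1 hlogM hlogr hQB
  obtain ⟨ht0, ht1⟩ := htail hQ
  have hQ1 : (1 : ℝ) ≤ Q := by exact_mod_cast hQ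
  have hQ0 : (0 : ℝ) < Q := by linarith
  have hd1 : (1 : ℝ) ≤ d := by exact_mod_cast hd
  have hd0 : (0 : ℝ) < d := by linarith
  set L := perimeterSum Q r c d with hLdef
  set SR := ∑ k ∈ (finite_relevantVectors Q r hQ c d).toFinset, planeArea (fareyPolygon k)
  set mQ := ∑ e ∈ (Finset.Icc 1 Q).filter (Nat.Coprime · d),
          (ArithmeticFunction.moebius e : ℝ) / (e : ℝ) ^ 2
  have hL0 : 0 < L := hP.trans_le hL
  rw [one_mul] at hlog1
  have hlog0 : 0 ≤ Real.log Q := by linarith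
  have hSR0 : 0 ≤ SR := Finset.sum_nonneg fun k _ => ENNReal.toReal_nonneg
  have hSRL : SR ≤ 2 * L := by
    rw [hLdef, perimeterSum_eq Q r hQ, Finset.mul_sum]
    exact Finset.sum_le_sum fun k _ => planeArea_le_planePerimeter k
  have hBQ : B / Q ≤ P := by
    rw [div_le_iff₀ hP] at hQB
    rw [div_le_iff₀ hQ0]; linarith
  refine ⟨?_, by linarith⟩
  have hgen := abs_ncard_congruentGenerators_sub_le (c := c) hr hd hQ
  have hmob := abs_sum_moebius_sub_tsum_le hQ d
  -- the successive approximations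
  have hX1 : |((congruentDenominators Q r c d).ncard : ℝ) - (congruentGenerators Q r c d).ncard|
      ≤ L * (Q * Real.log Q) := by
    have h1 : ((congruentDenominators Q r c d).ncard : ℝ) ≤ (congruentGenerators Q r c d).ncard := by
      exact_mod_cast ncard_congruentDenominators_le hr c d
    have h2 : ((congruentGenerators Q r c d).ncard : ℝ)
        ≤ (congruentDenominators Q r c d).ncard + r := by
      exact_mod_cast ncard_congruentGenerators_le hr c d
    have h3 : (r : ℝ) ≤ L * (Q * Real.log Q) := by
      calc (r : ℝ) ≤ P * Real.log Q := hlogr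
        _ ≤ L * (1 * Real.log Q) := by rw [one_mul]; gcongr
        _ ≤ L * (Q * Real.log Q) := by gcongr
    rw [abs_le]; constructor <;> linarith
  have hX2 : |((congruentGenerators Q r c d).ncard : ℝ) - SR * ((Q : ℝ) ^ 2 / (d : ℝ) ^ 2) * mQ|
      ≤ 16 * L * (Q * Real.log Q) := by
    refine hgen.trans ?_
    have h1 : (Q : ℝ) * (1 + Real.log Q) ≤ Q * (2 * Real.log Q) := by gcongr; linarith
    have h2 := mul_le_mul_of_nonneg_left h1 (by positivity : 0 ≤ 8 * L)
    linarith
  have hfrac : (Q : ℝ) ^ 2 / (d : ℝ) ^ 2 ≤ Q ^ 2 :=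
    div_le_self (by positivity) (one_le_pow₀ hd1)
  have hX3 : |SR * ((Q : ℝ) ^ 2 / (d : ℝ) ^ 2) * mQ - SR * ((Q : ℝ) ^ 2 / (d : ℝ) ^ 2) * M|
      ≤ 2 * L * (Q * Real.log Q) := by
    rw [← mul_sub, abs_mul, abs_of_nonneg (by positivity)]
    calc SR * ((Q : ℝ) ^ 2 / (d : ℝ) ^ 2) * |mQ - M| ≤ (2 * L) * (Q ^ 2) * (1 / Q) := by gcongr
      _ = 2 * L * (Q * 1) := by field_simp
      _ ≤ _ := by gcongr
  have hX4 : |SR * ((Q : ℝ) ^ 2 / (d : ℝ) ^ 2) * M - S * (Q : ℝ) ^ 2 * (M / (d : ℝ) ^ 2)|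
      ≤ L * (Q * Real.log Q) := by
    have e : SR * ((Q : ℝ) ^ 2 / (d : ℝ) ^ 2) * M - S * (Q : ℝ) ^ 2 * (M / (d : ℝ) ^ 2)
        = -((S - SR) * ((Q : ℝ) ^ 2 / (d : ℝ) ^ 2) * M) := by ring
    rw [e, abs_neg, abs_mul, abs_of_nonneg (by positivity)]
    calc (S - SR) * ((Q : ℝ) ^ 2 / (d : ℝ) ^ 2) * |M| ≤ (B / Q) * Q ^ 2 * |M| := by gcongr
      _ = (B * |M|) * Q := by field_simp
      _ ≤ (P * Real.log Q) * Q := by gcongr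
      _ ≤ (L * Real.log Q) * Q := by gcongr
      _ = _ := by ring
  have htri := (abs_sub_le ((congruentDenominators Q r c d).ncard : ℝ)
    ((congruentGenerators Q r c d).ncard : ℝ) (S * (Q : ℝ) ^ 2 * (M / (d : ℝ) ^ 2)))
  have htri2 := (abs_sub_le ((congruentGenerators Q r c d).ncard : ℝ)
    (SR * ((Q : ℝ) ^ 2 / (d : ℝ) ^ 2) * mQ) (S * (Q : ℝ) ^ 2 * (M / (d : ℝ) ^ 2)))
  have htri3 := (abs_sub_le (SR * ((Q : ℝ) ^ 2 / (d : ℝ) ^ 2) * mQ)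
    (SR * ((Q : ℝ) ^ 2 / (d : ℝ) ^ 2) * M) (S * (Q : ℝ) ^ 2 * (M / (d : ℝ) ^ 2)))
  linarith

lemma moebiusSum_one_eq : ∑' n, moebiusTerm 1 n = 6 / Real.pi ^ 2 := by
  have h := moebiusSum_mul le_rfl
  have hpi := Real.pi_pos
  rw [Nat.primeFactors_one, Finset.prod_empty, one_mul] at h
  rw [eq_div_iff (by positivity)]
  linarith

/-- The number of Farey fractions, with an error term that is uniform for large `Q`. -/
lemma eventually_abs_ncard_fareySet_sub_le (r : ℕ) :
    ∀ᶠ Q : ℕ in Filter.atTop,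
      |((fareySet Q).ncard : ℝ) - ((r : ℝ) - 1) - (Q : ℝ) ^ 2 * (6 / Real.pi ^ 2) / 2| ≤
        16 * (Q * Real.log Q) := by
  -- With `log Q ≥ r + 1`, the errors `7 * Q * (1 + log Q)`, `Q / 2` and `r - 1` fit into `16 * Q *
  -- log Q`.
  filter_upwards [Filter.eventually_ge_atTop 1, eventually_le_mul_log (r + 1) one_pos] with
    Q hQ hlog
  have hQ1 : (1 : ℝ) ≤ Q := by exact_mod_cast hQ
  have hQ0 : (0 : ℝ) < Q := by linarith
  rw [one_mul] at hlog
  have hr0 : (0 : ℝ) ≤ r := Nat.cast_nonneg r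
  have h1 := abs_ncard_fareySet_sub_le hQ
  have h2 := abs_sum_moebius_sub_tsum_le hQ 1
  rw [moebiusSum_one_eq] at h2
  set m := ∑ e ∈ (Finset.Icc 1 Q).filter (Nat.Coprime · 1),
        (ArithmeticFunction.moebius e : ℝ) / (e : ℝ) ^ 2
  have h3 : |(Q : ℝ) ^ 2 / 2 * m - (Q : ℝ) ^ 2 / 2 * (6 / Real.pi ^ 2)| ≤ (Q : ℝ) / 2 := by
    rw [← mul_sub, abs_mul, abs_of_nonneg (by positivity)]
    calc _ ≤ (Q : ℝ) ^ 2 / 2 * (1 / Q) := by gcongr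
      _ = _ := by field_simp
  have h4 : (Q : ℝ) * 1 ≤ Q * Real.log Q := by gcongr; linarith
  have h5 : 1 * Real.log Q ≤ Q * Real.log Q := by gcongr
  rw [abs_le] at h1 h3 ⊢
  constructor <;> linarith [h1.1, h1.2, h3.1, h3.2]

lemma prod_one_sub_inv_sq_pos (d : ℕ) : 0 < ∏ p ∈ d.primeFactors, (1 - 1 / (p : ℝ) ^ 2) := by
  refine Finset.prod_pos fun p hp => ?_
  have h2 : (2 : ℝ) ≤ p := by exact_mod_cast (Nat.prime_of_mem_primeFactors hp).two_le
  rw [sub_pos, div_lt_one (by positivity)]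
  nlinarith

lemma moebiusSum_eq {d : ℕ} (hd : 1 ≤ d) :
    ∑' n, moebiusTerm d n =
      (∏ p ∈ d.primeFactors, (1 - 1 / (p : ℝ) ^ 2)⁻¹) * (6 / Real.pi ^ 2) := by
  have h := moebiusSum_mul hd
  have hpi := Real.pi_pos
  have hprod := prod_one_sub_inv_sq_pos d
  rw [Finset.prod_inv_distrib]
  field_simp at h ⊢
  linarith

theorem theorem1 (d : ℕ) (hd : 2 ≤ d) :
    ∃ C : ℝ, 0 < C ∧ ∀ (r : ℕ), 3 ≤ r → ∀ (c : Fin r → ℕ), (∀ j, c j < d) →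
      Summable (fun k : admissibleCongruent r c d => planeArea (fareyPolygon k.1)) ∧
      (∀ Q : ℕ, 1 ≤ Q → (relevantVectors Q r c d).Finite) ∧
      ∃ Q₀ : ℕ, ∀ Q : ℕ, Q₀ ≤ Q →
        |fareyProportion Q r c d -
            2 / (d : ℝ) ^ 2 * (∏ p ∈ d.primeFactors, (1 - 1 / (p : ℝ) ^ 2)⁻¹) *
              ∑' k : admissibleCongruent r c d, planeArea (fareyPolygon k.1)| ≤
          C * (perimeterSum Q r c d * (Q : ℝ)⁻¹ * Real.log Q) := by
  have hd0 : (0 : ℝ) < d := by exact_mod_cast (by omega : 0 < d)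
  have hpi := Real.pi_pos
  have hprod : 0 < ∏ p ∈ d.primeFactors, (1 - 1 / (p : ℝ) ^ 2)⁻¹ := by
    rw [Finset.prod_inv_distrib]
    exact inv_pos.2 (prod_one_sub_inv_sq_pos d)
  set κ := 2 / (d : ℝ) ^ 2 * (∏ p ∈ d.primeFactors, (1 - 1 / (p : ℝ) ^ 2)⁻¹) with hκ
  have hκ0 : 0 < κ := by positivity
  set m : ℝ := 6 / Real.pi ^ 2 with hm
  have hm0 : 0 < m := by positivity
  -- The constant is that of `abs_div_sub_le`: `20` comes from the numerator, and `48 = 3 * 16` from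
  -- the area bound by `3 * perimeterSum` times the error of the denominator. It involves `d` only.
  refine ⟨4 / m * (20 + 48 * κ), by positivity, fun r hr c _ => ⟨?_,
    fun Q hQ => finite_relevantVectors Q r hQ c d, ?_⟩⟩
  · simp_rw [planeArea_fareyPolygon]
    exact (hasSum_volume_chainRegion (admissibleCongruent r c d)).summable
  rw [← Filter.eventually_atTop]
  -- Without admissible vectors no positive lower bound for the perimeter sum exists, but then the
  -- count, the area series and the error term all vanish.
  rcases (admissibleCongruent r c d).eq_empty_or_nonempty with hempty | hne
  · filter_upwards [Filter.eventually_ge_atTop 1] with Q hQ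
    have hR : relevantVectors Q r c d = ∅ :=
      Set.eq_empty_of_forall_notMem fun k hk => by
        have := hk.1
        rw [hempty] at this
        exact this
    have hG : congruentGenerators Q r c d = ∅ := by
      rw [congruentGenerators_eq_iUnion (by omega) hQ, hR]
      simp
    have hN : (congruentDenominators Q r c d).ncard = 0 := by
      have := ncard_congruentDenominators_le (Q := Q) (by omega : 2 ≤ r) c d
      rw [hG, Set.ncard_empty] at this
      omega
    have hS : ∑' k : admissibleCongruent r c d, planeArea (fareyPolygon k.1) = 0 := by
      have : IsEmpty (admissibleCongruent r c d) := by
        rw [hempty]; infer_instance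
      exact tsum_empty
    rw [fareyProportion, hN, hS, perimeterSum, hR]
    simp
  · filter_upwards [eventually_abs_ncard_sub_le (by omega) (by omega : 1 ≤ d) hne,
      eventually_abs_ncard_fareySet_sub_le r, Filter.eventually_ge_atTop 1,
      eventually_log_le_mul (B := m / 64) (by positivity)] with Q hN hF hQ hlog
    obtain ⟨hN, hSL⟩ := hN
    have hQ1 : (1 : ℝ) ≤ Q := by exact_mod_cast hQ
    have hQ0 : (0 : ℝ) < Q := by linarith
    have hlog0 : 0 ≤ Real.log Q := Real.log_nonneg hQ1
    set S := ∑' k : admissibleCongruent r c d, planeArea (fareyPolygon k.1)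
    have hS0 : 0 ≤ S := tsum_nonneg fun k => ENNReal.toReal_nonneg
    set L := perimeterSum Q r c d
    have hκm : κ * (m / 2) = (∑' n, moebiusTerm d n) / (d : ℝ) ^ 2 := by
      rw [moebiusSum_eq (by omega), hκ, hm]; ring
    have hE' : 16 * (Q * Real.log Q) ≤ (Q : ℝ) ^ 2 * m / 4 := by
      have := mul_le_mul_of_nonneg_left hlog hQ0.le
      nlinarith
    refine (abs_div_sub_le hκ0.le hS0 (by positivity) hm0 hκm hN hF hE').trans ?_
    have hstep : 20 * L * (Q * Real.log Q) + κ * S * (16 * (Q * Real.log Q))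
        ≤ (20 + 48 * κ) * (L * (Q * Real.log Q)) := by
      have : κ * S * (16 * (Q * Real.log Q)) ≤ κ * (3 * L) * (16 * (Q * Real.log Q)) := by gcongr
      linarith
    calc _ ≤ 4 / m * ((20 + 48 * κ) * (L * (Q * Real.log Q))) / (Q : ℝ) ^ 2 := by gcongr
      _ = _ := by field_simp
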